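/- Work with finite-dimensional $\mathbb Z/2$-graded vector spaces (superspaces) over $\mathbb R$ and the Koszul sign rule; $|a|$ is the parity of $a$. **Lie algebras and relative complex.** Let $n,m\ge 0$ and let $V$ be the superspace of dimension $2n|m$ with even coordinates $p_1,\dots,p_n,q_1,\dots,q_n$, odd coordinates $x_1,\dots,x_m$ and even symplectic form $\omega=\sum_i dp_i\,dq_i+\tfrac12\sum_i dx_i\,dx_i$; write $\langle-,-\rangle_V$ for the corresponding skew-symmetric bilinear form. The symmetric superalgebra $S(V^*)$ is a Lie superalgebra for the Poisson bracket $\{a,b\}=\sum_i(\partial_{q_i}a\,\partial_{p_i}b-\partial_{p_i}a\,\partial_{q_i}b)+(-1)^{|a|}\sum_i\partial_{x_i}a\,\partial_{x_i}b$ (left derivatives). Let $\mathfrak g_{2n|m}=\bigoplus_{i\ge2}S^i(V^*)$, $\tilde{\mathfrak g}_{2n|m}=\bigoplus_{i\ge3}S^i(V^*)$ and $\mathfrak{osp}_{2n|m}=S^2(V^*)$. The relative Chevalley–Eilenberg complex $C_\bullet$ of $\mathfrak g_{2n|m}$ modulo $\mathfrak{osp}_{2n|m}$ is the space of $\mathfrak{osp}_{2n|m}$-coinvariants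 of $\Lambda(\tilde{\mathfrak g}_{2n|m})$ with the differential $$\delta(g_1\wedge\cdots\wedge g_l)=\sum_{i<j}(-1)^{p(g)}[g_i,g_j]\wedge g_1\wedge\cdots\widehat{g_i}\cdots\widehat{g_j}\cdots\wedge g_l,$$ $$p(g)=|g_i|(|g_1|+\cdots+|g_{i-1}|)+|g_j|(|g_1|+\cdots+|g_{j-1}|)+|g_i||g_j|+i+j-1.$$ Relative cochains are the linear functionals on $C_\bullet$; a cochain $S$ is a cocycle if $S\circ\delta=0$ and a coboundary if $S=G\circ\delta$ for some relative cochain $G$. **Data.** Let $A=A_0\oplus A_1$ be a finite-dimensional associative supercommutative algebra (a unit is not required) with an odd derivation $d$, $d^2=0$, which is contractible (acyclic), and a nondegenerate, odd, symmetric scalar product $\langle-,-\rangle$ with $\langle ab,c\rangle=\langle a,bc\rangle$ and $\langle da,b\rangle+(-1)^{|a|}\langle a,db\rangle=0$. For $N\ge2$ let $\tilde m(a_1,\dots,a_N)=\langle a_1\cdots a_{N-1},a_N\rangle$, regarded as a tensor in $(A^*)^{\otimes N}$. Define $\Psi_A:\mathfrak g_{2n|m}\to S(A^*\otimes V^*)$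 on a product of linear functions $v_1\cdots v_N$ as the image of $\tilde m\otimes(v_1\otimes\cdots\otimes v_N)$ under $(A^*)^{\otimes N}\otimes(V^*)^{\otimes N}\cong(A^*\otimes V^*)^{\otimes N}\to S^N(A^*\otimes V^*)$. Let $\tilde\sigma\in S^2(A^*\otimes V^*)$ be the even quadratic function $\tilde\sigma=\tfrac12\langle-,-\rangle_{\tilde d}$ of the symmetric bilinear form $$\langle a_1\otimes w_1,a_2\otimes w_2\rangle_{\tilde d}=(-1)^{|w_1||a_2|}(-1)^{|a_1|}\langle a_1,da_2\rangle\,\langle w_1,w_2\rangle_V .$$ Let $L\subset A$ be a maximally isotropic graded subspace with $A=L\oplus d(A)$. Then the restriction of $\tilde\sigma$ to $L\otimes V$ is nondegenerate, and for a polynomial superfunction $f$ put $$\langle f\rangle_0=\frac{\int_{L\otimes V}f\,e^{-\tilde\sigma}}{\int_{L\otimes V}e^{-\tilde\sigma}},$$ a quotient of superintegrals: Berezin integrals in the odd coordinates, and Gaussian integrals in the even coordinates, which are defined by Wick rotation if the form is indefinite (in coordinates with even part of $\tilde\sigma$ equal to $\frac12(\sum x_i^2-\sum x_i'^2)$, replace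 the exponent by $-\frac12(\sum x_i^2+t^2\sum x_i'^2)$, $t>0$, continue analytically to $t\in\mathbb C\setminus\{0\}$, and put $t=\sqrt{-1}$). Put $$S_A^L(h_1\wedge\cdots\wedge h_l)=(-1)^{p(h)}\langle\Psi_A(h_1)\cdots\Psi_A(h_l)\rangle_0,\qquad p(h)=\sum_{i<j}|h_i| .$$ **Theorem.** 1. For every such $L$, the formula above gives a well-defined linear functional $S_A^L:C_\bullet\to\mathbb R$ on the relative Chevalley–Eilenberg complex of $\mathfrak g_{2n|m}$ modulo $\mathfrak{osp}_{2n|m}$, and it is a cocycle. 2. Its cohomology class does not depend on $L$: for any two such subspaces $L_0,L_1$, the difference $S_A^{L_1}-S_A^{L_0}$ is a coboundary. -/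

import Mathlib

noncomputable section

namespace DualConstruction

/-- The sign `(-1)^x` for `x` in `ℤ/2`. -/
def sgn (x : ZMod 2) : ℝ := if x = 0 then 1 else -1

theorem sgn_add (x y : ZMod 2) : sgn (x + y) = sgn x * sgn y := by
  revert x y
  have h : ∀ x y : ZMod 2, (x = 0 ∨ x = 1) ∧ (y = 0 ∨ y = 1) := by decide
  intro x y
  have h11 : (1 : ZMod 2) + 1 = 0 := by decide
  rcases h x y with ⟨rfl | rfl, rfl | rfl⟩ <;> simp [sgn, h11]

/-! ## Polynomial superfunctions -/

section SuperPolynomials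

variable {ι : Type*}

/-- Supercommutativity relations `z i * z j = (-1)^(|i||j|) z j * z i` between the coordinate
functions `z i`, of parity `p i`. -/
inductive SRel (p : ι → ZMod 2) : FreeAlgebra ℝ ι → FreeAlgebra ℝ ι → Prop
  | swap (i j : ι) : SRel p (FreeAlgebra.ι ℝ i * FreeAlgebra.ι ℝ j)
      (sgn (p i * p j) • (FreeAlgebra.ι ℝ j * FreeAlgebra.ι ℝ i))

/-- The symmetric superalgebra `S(W*)`, i.e. the free supercommutative algebra on coordinate
functions `z i` of parity `p i` of a superspace `W`. -/
abbrev SPoly (p : ι → ZMod 2) : Type _ := RingQuot (SRel p)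

variable (p : ι → ZMod 2)

/-- The coordinate function `z i`. -/
def gen (i : ι) : SPoly p := RingQuot.mkAlgHom ℝ (SRel p) (FreeAlgebra.ι ℝ i)

theorem gen_mul_gen (i j : ι) :
    gen p i * gen p j = sgn (p i * p j) • (gen p j * gen p i) := by
  have h := RingQuot.mkAlgHom_rel ℝ (SRel.swap (p := p) i j)
  simpa [gen] using h

/-- Universal property: supercommuting images of the coordinates extend to an algebra map. -/
def sLift {B : Type*} [Ring B] [Algebra ℝ B] (f : ι → B)
    (hf : ∀ i j, f i * f j = sgn (p i * p j) • (f j * f i)) : SPoly p →ₐ[ℝ] B :=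
  RingQuot.liftAlgHom ℝ ⟨FreeAlgebra.lift ℝ f, by
    rintro _ _ ⟨i, j⟩
    simpa using hf i j⟩

@[simp] theorem sLift_gen {B : Type*} [Ring B] [Algebra ℝ B] (f : ι → B)
    (hf : ∀ i j, f i * f j = sgn (p i * p j) • (f j * f i)) (i : ι) :
    sLift p f hf (gen p i) = f i := by
  simp [sLift, gen]

/-- The parity involution, `(-1)^|f| f` on homogeneous `f`. -/
def parityInv : SPoly p →ₐ[ℝ] SPoly p :=
  sLift p (fun i => sgn (p i) • gen p i) (fun i j => by
    simp only [smul_mul_smul_comm]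
    rw [gen_mul_gen p i j, smul_comm, mul_comm (sgn (p i))])

/-- `f` is homogeneous of parity `x`. -/
def IsHomog (x : ZMod 2) (f : SPoly p) : Prop := parityInv p f = sgn x • f

section Derivative
variable [DecidableEq ι]

/-- The operator `(f, g) ↦ (z j * f, ∂ᵢ(z j) f + (-1)^(|i||j|) z j * g)`; it acts on
pairs `(f, ∂ᵢ f)` as multiplication by `z j`. -/
def derivStep (i j : ι) : Module.End ℝ (SPoly p × SPoly p) where
  toFun v := (gen p j * v.1,
    (if i = j then (1 : ℝ) else 0) • v.1 + sgn (p i * p j) • (gen p j * v.2))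
  map_add' v w := by
    refine Prod.ext (mul_add _ _ _) ?_
    simp only [Prod.snd_add, Prod.fst_add, mul_add, smul_add]
    abel
  map_smul' c v := by
    refine Prod.ext (mul_smul_comm _ _ _) ?_
    simp only [Prod.smul_snd, Prod.smul_fst, mul_smul_comm, smul_add, RingHom.id_apply]
    rw [smul_comm c, smul_comm c]

theorem sgn_self_mul (x : ZMod 2) : sgn x * sgn x = 1 := by
  unfold sgn; split_ifs <;> norm_num

theorem derivStep_comm (i j k : ι) :
    derivStep p i j * derivStep p i k =
      sgn (p j * p k) • (derivStep p i k * derivStep p i j) := by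
  refine LinearMap.ext fun v => ?_
  have e : ∀ w : SPoly p,
      gen p j * (gen p k * w) = sgn (p j * p k) • (gen p k * (gen p j * w)) := by
    intro w
    rw [← mul_assoc, gen_mul_gen p j k, smul_mul_assoc, mul_assoc]
  refine Prod.ext (e v.1) ?_
  change (if i = j then (1 : ℝ) else 0) • (gen p k * v.1) + sgn (p i * p j) • (gen p j *
      ((if i = k then (1 : ℝ) else 0) • v.1 + sgn (p i * p k) • (gen p k * v.2))) =
    sgn (p j * p k) • ((if i = k then (1 : ℝ) else 0) • (gen p j * v.1) +
      sgn (p i * p k) • (gen p k *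
        ((if i = j then (1 : ℝ) else 0) • v.1 + sgn (p i * p j) • (gen p j * v.2))))
  simp only [mul_add, mul_smul_comm, e, smul_add, smul_smul]
  have h1 : (if i = j then (1 : ℝ) else 0) =
      sgn (p j * p k) * (sgn (p i * p k) * if i = j then (1 : ℝ) else 0) := by
    split_ifs with h
    · rw [h, mul_one, sgn_self_mul]
    · simp
  have h2 : (sgn (p i * p j) * if i = k then (1 : ℝ) else 0) =
      sgn (p j * p k) * if i = k then (1 : ℝ) else 0 := by
    split_ifs with h
    · rw [h, mul_comm (p k)]
    · simp
  have h3 : sgn (p i * p j) * (sgn (p i * p k) * sgn (p j * p k)) =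
      sgn (p j * p k) * (sgn (p i * p k) * sgn (p i * p j)) := by ring
  rw [← h1, h2, h3]
  abel

/-- The left partial derivative `∂ᵢ`, with `∂ᵢ 1 = 0` and
`∂ᵢ(z j * f) = δᵢⱼ f + (-1)^(|i||j|) z j * ∂ᵢ f`. -/
def pderiv (i : ι) : SPoly p →ₗ[ℝ] SPoly p :=
  LinearMap.snd ℝ _ _ ∘ₗ
    LinearMap.applyₗ ((1, 0) : SPoly p × SPoly p) ∘ₗ
      (sLift p (derivStep p i) (derivStep_comm p i)).toLinearMap

theorem pderiv_one (i : ι) : pderiv p i 1 = 0 := by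
  simp [pderiv]

theorem sLift_derivStep_fst (i : ι) (f : SPoly p) : ∀ v : SPoly p × SPoly p,
    (sLift p (derivStep p i) (derivStep_comm p i) f v).1 = f * v.1 := by
  obtain ⟨g, rfl⟩ := RingQuot.mkAlgHom_surjective ℝ (SRel p) f
  induction g using FreeAlgebra.induction with
  | grade0 r =>
    intro v
    rw [AlgHom.commutes, AlgHom.commutes, Algebra.algebraMap_eq_smul_one,
      Algebra.algebraMap_eq_smul_one, smul_mul_assoc, one_mul]
    rfl
  | grade1 j =>
    intro v
    change (sLift p (derivStep p i) (derivStep_comm p i) (gen p j) v).1 = gen p j * v.1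
    rw [sLift_gen]
    rfl
  | mul a b ha hb =>
    intro v
    rw [map_mul, map_mul, Module.End.mul_apply, ha, hb, mul_assoc]
  | add a b ha hb =>
    intro v
    rw [map_add, map_add, LinearMap.add_apply, Prod.fst_add, ha, hb, add_mul]

theorem pderiv_gen_mul (i j : ι) (f : SPoly p) :
    pderiv p i (gen p j * f) =
      (if i = j then (1 : ℝ) else 0) • f + sgn (p i * p j) • (gen p j * pderiv p i f) := by
  have h : (sLift p (derivStep p i) (derivStep_comm p i) f (1, 0)).1 = f := by
    rw [sLift_derivStep_fst, mul_one]
  change (sLift p (derivStep p i) (derivStep_comm p i) (gen p j * f) (1, 0)).2 = _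
  rw [map_mul, sLift_gen, Module.End.mul_apply]
  change _ • (sLift p (derivStep p i) (derivStep_comm p i) f (1, 0)).1 + _ = _
  rw [h]
  rfl

end Derivative

/-- The space `S^k(W*)` of homogeneous polynomial superfunctions of degree `k`. -/
def homogDeg (k : ℕ) : Submodule ℝ (SPoly p) := Submodule.span ℝ (Set.range (gen p)) ^ k

theorem gen_mem (i : ι) : gen p i ∈ Submodule.span ℝ (Set.range (gen p)) :=
  Submodule.subset_span ⟨i, rfl⟩

theorem homogDeg_succ_le {N : Submodule ℝ (SPoly p)} (k : ℕ)
    (h : ∀ i, ∀ f ∈ homogDeg p k, gen p i * f ∈ N) : homogDeg p (k + 1) ≤ N := by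
  unfold homogDeg at h ⊢
  rw [pow_succ', Submodule.mul_le]
  intro x hx f hf
  induction hx using Submodule.span_induction with
  | mem x hx =>
    obtain ⟨i, rfl⟩ := hx
    exact h i f hf
  | zero => simp
  | add a b _ _ ha hb => rw [add_mul]; exact N.add_mem ha hb
  | smul c a _ ha => rw [smul_mul_assoc]; exact N.smul_mem c ha

theorem gen_mul_mem (i : ι) {k : ℕ} {f : SPoly p} (hf : f ∈ homogDeg p k) :
    gen p i * f ∈ homogDeg p (k + 1) := by
  unfold homogDeg at *
  rw [pow_succ']
  exact Submodule.mul_mem_mul (gen_mem p i) hf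

theorem parityInv_mem (k : ℕ) : homogDeg p k ≤ (homogDeg p k).comap
    (parityInv p).toLinearMap := by
  induction k with
  | zero =>
    intro f hf
    simp only [homogDeg, pow_zero, Submodule.mem_one] at hf
    obtain ⟨r, rfl⟩ := hf
    simp only [homogDeg, pow_zero, Submodule.mem_comap, AlgHom.toLinearMap_apply,
      AlgHom.commutes]
    exact Submodule.mem_one.2 ⟨r, rfl⟩
  | succ k ih =>
    refine homogDeg_succ_le p k fun i f hf => ?_
    rw [Submodule.mem_comap, AlgHom.toLinearMap_apply, map_mul]
    rw [show parityInv p (gen p i) = sgn (p i) • gen p i by simp [parityInv], smul_mul_assoc]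
    exact Submodule.smul_mem _ _ (gen_mul_mem p i (ih hf))

theorem pderiv_mem [DecidableEq ι] (i : ι) (k : ℕ) :
    homogDeg p (k + 1) ≤ (homogDeg p k).comap (pderiv p i) := by
  induction k with
  | zero =>
    refine homogDeg_succ_le p 0 fun j f hf => ?_
    have h0 : pderiv p i f = 0 := by
      simp only [homogDeg, pow_zero, Submodule.mem_one] at hf
      obtain ⟨r, rfl⟩ := hf
      rw [Algebra.algebraMap_eq_smul_one, map_smul, pderiv_one, smul_zero]
    rw [Submodule.mem_comap, pderiv_gen_mul, h0, mul_zero, smul_zero, add_zero]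
    exact Submodule.smul_mem _ _ hf
  | succ k ih =>
    refine homogDeg_succ_le p (k + 1) fun j f hf => ?_
    rw [Submodule.mem_comap, pderiv_gen_mul]
    exact Submodule.add_mem _ (Submodule.smul_mem _ _ hf)
      (Submodule.smul_mem _ _ (gen_mul_mem p j (ih hf)))

theorem mul_mem_homogDeg {j k : ℕ} {f g : SPoly p} (hf : f ∈ homogDeg p j)
    (hg : g ∈ homogDeg p k) : f * g ∈ homogDeg p (j + k) := by
  unfold homogDeg at *
  rw [pow_add]
  exact Submodule.mul_mem_mul hf hg

/-- The monomial `z (w 0) * ⋯ * z (w (N-1))`. -/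
def monomial {N : ℕ} (w : Fin N → ι) : SPoly p := (List.ofFn fun i => gen p (w i)).prod

theorem monomial_mem {N : ℕ} (w : Fin N → ι) : monomial p w ∈ homogDeg p N := by
  induction N with
  | zero =>
    simp only [monomial, homogDeg, List.ofFn_zero, List.prod_nil, pow_zero]
    exact Submodule.mem_one.2 ⟨1, map_one _⟩
  | succ N ih =>
    have h : monomial p w = gen p (w 0) * monomial p (fun i : Fin N => w i.succ) := by
      simp [monomial, List.ofFn_succ]
    rw [h]
    exact gen_mul_mem p _ (ih _)

end SuperPolynomials

/-! ## The Lie superalgebra of polynomial Hamiltonians on the canonical symplectic superspace -/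

/-- Labels of the canonical coordinates `p₁,…,pₙ; q₁,…,qₙ` (even) and `x₁,…,xₘ` (odd) on the
canonical symplectic superspace `V` of dimension `2n|m`. -/
abbrev Coord (n m : ℕ) : Type := (Fin n ⊕ Fin n) ⊕ Fin m

/-- The label of `pᵢ`. -/
abbrev cp {n m : ℕ} (i : Fin n) : Coord n m := Sum.inl (Sum.inl i)
/-- The label of `qᵢ`. -/
abbrev cq {n m : ℕ} (i : Fin n) : Coord n m := Sum.inl (Sum.inr i)
/-- The label of `xᵢ`. -/
abbrev cx {n m : ℕ} (i : Fin m) : Coord n m := Sum.inr i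

/-- Parity of the canonical coordinates. -/
def parV (n m : ℕ) : Coord n m → ZMod 2 := Sum.elim (fun _ => 0) (fun _ => 1)

/-- The Lie superalgebra `𝔥_{2n|m} = S(V*)` of polynomial Hamiltonians. -/
abbrev Ham (n m : ℕ) : Type := SPoly (parV n m)

/-- The Poisson bracket on `S(V*)` for `ω = ∑ dpᵢ dqᵢ + ½ ∑ dxᵢ dxᵢ`: for homogeneous `a`,
`{a,b} = (-1)^|a| α(b)`, where `α` is the derivation determined by `i_α ω = da`, that is
`α(pᵢ) = (-1)^|a| ∂a/∂qᵢ`, `α(qᵢ) = -(-1)^|a| ∂a/∂pᵢ`, `α(xᵢ) = ∂a/∂xᵢ`. -/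
def bracket {n m : ℕ} (a b : Ham n m) : Ham n m :=
  ∑ i : Fin n, (pderiv (parV n m) (cq i) a * pderiv (parV n m) (cp i) b -
      pderiv (parV n m) (cp i) a * pderiv (parV n m) (cq i) b) +
    ∑ i : Fin m, pderiv (parV n m) (cx i) (parityInv (parV n m) a) *
      pderiv (parV n m) (cx i) b

theorem bracket_mem {n m j k : ℕ} {a b : Ham n m} (ha : a ∈ homogDeg (parV n m) (j + 1))
    (hb : b ∈ homogDeg (parV n m) (k + 1)) : bracket a b ∈ homogDeg (parV n m) (j + k) := by
  refine Submodule.add_mem _ (Submodule.sum_mem _ fun i _ => Submodule.sub_mem _ ?_ ?_)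
    (Submodule.sum_mem _ fun i _ => ?_)
  · exact mul_mem_homogDeg _ (pderiv_mem _ _ _ ha) (pderiv_mem _ _ _ hb)
  · exact mul_mem_homogDeg _ (pderiv_mem _ _ _ ha) (pderiv_mem _ _ _ hb)
  · exact mul_mem_homogDeg _ (pderiv_mem _ _ _ (parityInv_mem _ _ ha)) (pderiv_mem _ _ _ hb)

theorem bracket_add_left {n m : ℕ} (a b c : Ham n m) :
    bracket (a + b) c = bracket a c + bracket b c := by
  simp only [bracket, map_add, add_mul, Finset.sum_add_distrib, Finset.sum_sub_distrib]
  abel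

theorem bracket_add_right {n m : ℕ} (a b c : Ham n m) :
    bracket a (b + c) = bracket a b + bracket a c := by
  simp only [bracket, map_add, mul_add, Finset.sum_add_distrib, Finset.sum_sub_distrib]
  abel

/-- The Lie subalgebra `𝔤̃_{2n|m}` of polynomials all of whose terms have degree `≥ 3`. -/
def gTilde (n m : ℕ) : Submodule ℝ (Ham n m) := ⨆ k : ℕ, homogDeg (parV n m) (k + 3)

/-- The quadratic part of `𝔤_{2n|m}`, identified with `𝔬𝔰𝔭_{2n|m}`. -/
def osp (n m : ℕ) : Submodule ℝ (Ham n m) := homogDeg (parV n m) 2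

theorem homogDeg_le_gTilde {n m k : ℕ} (hk : 3 ≤ k) : homogDeg (parV n m) k ≤ gTilde n m := by
  obtain ⟨r, rfl⟩ := Nat.exists_eq_add_of_le' hk
  exact le_iSup (fun k : ℕ => homogDeg (parV n m) (k + 3)) r

theorem bracket_mem_gTilde_of {n m j : ℕ} {a b : Ham n m}
    (ha : a ∈ homogDeg (parV n m) (j + 2)) (hb : b ∈ gTilde n m) :
    bracket a b ∈ gTilde n m := by
  induction hb using Submodule.iSup_induction' with
  | mem k b hb =>
    exact homogDeg_le_gTilde (by omega) (bracket_mem (j := j + 1) (k := k + 2) ha hb)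
  | zero => simp [bracket]
  | add b c _ _ hb hc => rw [bracket_add_right]; exact Submodule.add_mem _ hb hc

theorem bracket_mem_gTilde {n m : ℕ} {a b : Ham n m} (ha : a ∈ gTilde n m)
    (hb : b ∈ gTilde n m) : bracket a b ∈ gTilde n m := by
  induction ha using Submodule.iSup_induction' with
  | mem k a ha => exact bracket_mem_gTilde_of (j := k + 1) ha hb
  | zero => simp [bracket]
  | add a c _ _ ha hc => rw [bracket_add_left]; exact Submodule.add_mem _ ha hc

/-- The bracket of `𝔤̃_{2n|m}`. -/
def brG {n m : ℕ} (g h : gTilde n m) : gTilde n m :=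
  ⟨bracket g.1 h.1, bracket_mem_gTilde g.2 h.2⟩

/-- The adjoint action of `𝔬𝔰𝔭_{2n|m}` on `𝔤̃_{2n|m}`. -/
def adOsp {n m : ℕ} (k : osp n m) (h : gTilde n m) : gTilde n m :=
  ⟨bracket k.1 h.1, bracket_mem_gTilde_of (j := 0) k.2 h.2⟩

/-! ## The relative Chevalley-Eilenberg complex -/

section ChevalleyEilenberg

variable {n m : ℕ}

/-- The relations `g ⊗ h = -(-1)^(|g||h|) h ⊗ g` for homogeneous `g`, `h`. -/
inductive ExtRel (n m : ℕ) :
    TensorAlgebra ℝ (gTilde n m) → TensorAlgebra ℝ (gTilde n m) → Prop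
  | swap (g h : gTilde n m) (x y : ZMod 2) (hg : IsHomog (parV n m) x g.1)
      (hh : IsHomog (parV n m) y h.1) :
      ExtRel n m (TensorAlgebra.ι ℝ g * TensorAlgebra.ι ℝ h)
        (-(sgn (x * y)) • (TensorAlgebra.ι ℝ h * TensorAlgebra.ι ℝ g))

/-- The exterior superalgebra `Λ(𝔤̃_{2n|m})` of Chevalley-Eilenberg chains. -/
abbrev Chain (n m : ℕ) : Type := RingQuot (ExtRel n m)

/-- The inclusion of `𝔤̃_{2n|m}` into `Λ(𝔤̃_{2n|m})`. -/
def chainOf (g : gTilde n m) : Chain n m :=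
  RingQuot.mkAlgHom ℝ (ExtRel n m) (TensorAlgebra.ι ℝ g)

/-- `g₁ ∧ ⋯ ∧ g_l`. -/
def wedge {l : ℕ} (g : Fin l → gTilde n m) : Chain n m :=
  (List.ofFn fun i => chainOf (g i)).prod

/-- `P i` is the parity of the homogeneous element `g i`. -/
def IsHomogFamily {l : ℕ} (g : Fin l → gTilde n m) (P : Fin l → ZMod 2) : Prop :=
  ∀ i, IsHomog (parV n m) (P i) (g i).1

/-- The Chevalley-Eilenberg differential `δ(g₁ ∧ ⋯ ∧ g_l)` for homogeneous `g i` of parity `P i`: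
the sum over `i < j` of
`(-1)^(p(g)) [g_i, g_j] ∧ g₁ ∧ ⋯ ĝ_i ⋯ ĝ_j ⋯ ∧ g_l`, where `p(g)` is
`|g_i|(|g₁|+⋯+|g_{i-1}|) + |g_j|(|g₁|+⋯+|g_{j-1}|) + |g_i||g_j| + i + j - 1`
(indices starting from `1`). -/
def ceDelta {l : ℕ} (g : Fin l → gTilde n m) (P : Fin l → ZMod 2) : Chain n m :=
  ∑ i : Fin l, ∑ j ∈ Finset.Ioi i,
    sgn (P i * ∑ k ∈ Finset.Iio i, P k + P j * ∑ k ∈ Finset.Iio j, P k + P i * P j +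
        ((((i : ℕ) + 1) + ((j : ℕ) + 1) - 1 : ℕ) : ZMod 2)) •
      (chainOf (brG (g i) (g j)) *
        (((List.finRange l).filter fun k => k ≠ i ∧ k ≠ j).map fun k => chainOf (g k)).prod)

/-- The action of a homogeneous `k ∈ 𝔬𝔰𝔭_{2n|m}`, of parity `κ`, on `g₁ ∧ ⋯ ∧ g_l` induced by the
adjoint action. -/
def ospAct {l : ℕ} (k : osp n m) (κ : ZMod 2) (g : Fin l → gTilde n m) (P : Fin l → ZMod 2) :
    Chain n m :=
  ∑ i : Fin l, sgn (κ * ∑ j ∈ Finset.Iio i, P j) •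
    wedge (Function.update g i (adOsp k (g i)))

/-- The subspace of `Λ(𝔤̃_{2n|m})` spanned by the image of the action of `𝔬𝔰𝔭_{2n|m}`. -/
def ospImage (n m : ℕ) : Submodule ℝ (Chain n m) :=
  Submodule.span ℝ {c | ∃ (k : osp n m) (κ : ZMod 2) (l : ℕ) (g : Fin l → gTilde n m)
    (P : Fin l → ZMod 2), IsHomog (parV n m) κ k.1 ∧ IsHomogFamily g P ∧ c = ospAct k κ g P}

/-- The relative Chevalley-Eilenberg chains `Λ(𝔤̃_{2n|m})_{𝔬𝔰𝔭_{2n|m}}` of `𝔤_{2n|m}` modulo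
`𝔬𝔰𝔭_{2n|m}`. -/
abbrev RelChain (n m : ℕ) : Type := Chain n m ⧸ ospImage n m

/-- Passage to coinvariants. -/
abbrev toRel (c : Chain n m) : RelChain n m := (ospImage n m).mkQ c

/-- Relative Chevalley-Eilenberg cochains: the linear dual of the relative chains. -/
abbrev RelCochain (n m : ℕ) : Type := RelChain n m →ₗ[ℝ] ℝ

/-- `S ∘ δ = 0`. -/
def IsCocycle (S : RelCochain n m) : Prop :=
  ∀ (l : ℕ) (g : Fin l → gTilde n m) (P : Fin l → ZMod 2), IsHomogFamily g P →
    S (toRel (ceDelta g P)) = 0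

/-- `S = G ∘ δ` for some relative cochain `G`. -/
def IsCoboundary (S : RelCochain n m) : Prop :=
  ∃ G : RelCochain n m, ∀ (l : ℕ) (g : Fin l → gTilde n m) (P : Fin l → ZMod 2),
    IsHomogFamily g P → S (toRel (wedge g)) = G (toRel (ceDelta g P))

end ChevalleyEilenberg

/-! ## Gaussian expectation values on superspaces -/

section Gaussian

/-- Parity of standard coordinates `x₁,…,x_a, x'₁,…,x'_b` (even), `ξ₁,…,ξ_s` (odd). -/
def parC (a b s : ℕ) : (Fin a ⊕ Fin b) ⊕ Fin s → ZMod 2 :=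
  Sum.elim (fun _ => 0) (fun _ => 1)

variable {J : Type*} [Fintype J] [DecidableEq J] {p : J → ZMod 2}

/-- A system of new linear coordinates `x, x'` (even) and `ξ` (odd) on a superspace with given
coordinates `y j` of parity `p j`: `y j = ∑ k, M j k • w k`, where `w` runs through the new
coordinates, `N` is the inverse of `M`, and parity is preserved. -/
structure LinCoords (p : J → ZMod 2) where
  (a b s : ℕ)
  M : Matrix J ((Fin a ⊕ Fin b) ⊕ Fin s) ℝ
  N : Matrix ((Fin a ⊕ Fin b) ⊕ Fin s) J ℝ
  mul_inv : M * N = 1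
  inv_mul : N * M = 1
  even : ∀ j k, M j k ≠ 0 → p j = parC a b s k

namespace LinCoords

variable (C : LinCoords p)

/-- Superfunctions in the new coordinates. -/
abbrev Fun : Type := SPoly (parC C.a C.b C.s)

/-- The function `xᵢ`. -/
def x (i : Fin C.a) : C.Fun := gen _ (Sum.inl (Sum.inl i))
/-- The function `x'ᵢ`. -/
def x' (i : Fin C.b) : C.Fun := gen _ (Sum.inl (Sum.inr i))
/-- The function `ξᵢ`. -/
def ξ (i : Fin C.s) : C.Fun := gen _ (Sum.inr i)

/-- Expresses a superfunction in the new coordinates. -/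
def subst : SPoly p →ₐ[ℝ] C.Fun :=
  sLift p (fun j => ∑ k, C.M j k • gen (parC C.a C.b C.s) k) (fun i j => by
    rw [Finset.sum_mul_sum, Finset.sum_mul_sum, Finset.sum_comm, Finset.smul_sum]
    refine Finset.sum_congr rfl fun l _ => ?_
    rw [Finset.smul_sum]
    refine Finset.sum_congr rfl fun k _ => ?_
    by_cases h1 : C.M i k = 0
    · simp [h1]
    by_cases h2 : C.M j l = 0
    · simp [h2]
    rw [C.even i k h1, C.even j l h2, smul_mul_smul_comm, smul_mul_smul_comm, gen_mul_gen _ k l,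
      smul_comm, mul_comm (C.M i k)])

/-- Restriction to the body, `ξ = 0`. -/
def body : C.Fun →ₐ[ℝ] MvPolynomial (Fin C.a ⊕ Fin C.b) ℝ :=
  sLift _ (Sum.elim MvPolynomial.X (fun _ => 0)) (fun i j => by
    rcases i with i | i <;> rcases j with j | j <;> simp [parC, sgn, mul_comm])

/-- The Berezin integral `∫ dξ₁ ⋯ dξ_s`: successive partial derivatives acting on the right, the
right derivative of `f` being `(-1)^(|f|+1) ∂f/∂ξᵢ` in terms of the left one. -/
def berezin (f : C.Fun) : MvPolynomial (Fin C.a ⊕ Fin C.b) ℝ :=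
  C.body ((List.finRange C.s).foldl
    (fun g j => -pderiv _ (Sum.inr j) (parityInv _ g)) f)

/-- `∫ f(x,x') exp(-½(∑ xᵢ² + ∑ (t x'ᵢ)²)) dx dx'`. -/
def gaussian (f : MvPolynomial (Fin C.a ⊕ Fin C.b) ℝ) (t : ℝ) : ℝ :=
  ∫ v : Fin C.a ⊕ Fin C.b → ℝ, MvPolynomial.eval v f *
    Real.exp (-(1 / 2) * (∑ i, v (Sum.inl i) ^ 2 + ∑ i, (t * v (Sum.inr i)) ^ 2))

/-- Wick rotation: `z` is the value of `∫ f(x,x') exp(-½(∑ xᵢ² - ∑ x'ᵢ²)) dx dx'`, i.e. the value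
at `t = i` of the analytic continuation to nonzero complex `t` of `gaussian f t`, `t > 0`. -/
def IsWickIntegral (f : MvPolynomial (Fin C.a ⊕ Fin C.b) ℝ) (z : ℂ) : Prop :=
  ∃ G : ℂ → ℂ, DifferentiableOn ℂ G {0}ᶜ ∧
    (∀ t : ℝ, 0 < t → G (t : ℂ) = (C.gaussian f t : ℂ)) ∧ G Complex.I = z

end LinCoords

/-- Linear coordinates in which the quadratic function `σ` takes the form
`½(∑ xᵢ² - ∑ x'ᵢ²) + ∑ c i j ξᵢ ξⱼ`. -/
structure GaussCoords (σ : SPoly p) extends LinCoords p where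
  c : Fin s → Fin s → ℝ
  sigma_eq : toLinCoords.subst σ =
    (1 / 2 : ℝ) • (∑ i, toLinCoords.x i ^ 2 - ∑ i, toLinCoords.x' i ^ 2) +
      ∑ i, ∑ j, c i j • (toLinCoords.ξ i * toLinCoords.ξ j)

namespace GaussCoords

variable {σ : SPoly p} (C : GaussCoords σ)

/-- The odd part `∑ c i j ξᵢ ξⱼ` of `σ`. -/
def oddPart : C.Fun := ∑ i, ∑ j, C.c i j • (C.ξ i * C.ξ j)

/-- `exp(-∑ c i j ξᵢ ξⱼ)`; the exponential series terminates since products of more than `s` odd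
coordinates vanish. -/
def expOdd : C.Fun :=
  ∑ k ∈ Finset.range (C.s + 1), ((k.factorial : ℝ)⁻¹) • (-C.oddPart) ^ k

/-- `z` is the value of the superintegral `∫ f e^{-σ} dx dx' dξ`. -/
def IsSuperIntegral (f : SPoly p) (z : ℂ) : Prop :=
  C.IsWickIntegral (C.berezin (C.subst f * C.expOdd)) z

end GaussCoords

/-- `z` is the Gaussian expectation value `⟨f⟩₀ = ∫ f e^{-σ} / ∫ e^{-σ}`: coordinates as above
exist, and in any such coordinates both integrals are defined, the denominator is nonzero and the
quotient is `z`. -/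
def IsExpectation (σ f : SPoly p) (z : ℝ) : Prop :=
  Nonempty (GaussCoords σ) ∧ ∀ C : GaussCoords σ, ∃ num den : ℂ,
    C.IsSuperIntegral f num ∧ C.IsSuperIntegral 1 den ∧ den ≠ 0 ∧ (z : ℂ) = num / den

end Gaussian

/-! ## Contractible differential graded commutative Frobenius algebras -/

/-- The structure of a contractible differential `ℤ/2`-graded commutative Frobenius algebra with
odd symmetric scalar product on a finite-dimensional associative algebra `A` with a decomposition
`A = 𝒜 0 ⊕ 𝒜 1`. A unit is not required. -/
structure FrobeniusDGA {A : Type*} [NonUnitalRing A] [Module ℝ A]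
    (𝒜 : ZMod 2 → Submodule ℝ A) where
  mul_mem : ∀ {i j : ZMod 2} {a b : A}, a ∈ 𝒜 i → b ∈ 𝒜 j → a * b ∈ 𝒜 (i + j)
  mul_comm : ∀ {i j : ZMod 2} {a b : A}, a ∈ 𝒜 i → b ∈ 𝒜 j → a * b = sgn (i * j) • (b * a)
  /-- the scalar product -/
  form : A →ₗ[ℝ] A →ₗ[ℝ] ℝ
  form_odd : ∀ {i : ZMod 2} {a b : A}, a ∈ 𝒜 i → b ∈ 𝒜 i → form a b = 0
  form_symm : ∀ {i j : ZMod 2} {a b : A}, a ∈ 𝒜 i → b ∈ 𝒜 j →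
    form a b = sgn (i * j) * form b a
  form_nondegenerate : ∀ a, (∀ b, form a b = 0) → a = 0
  form_assoc : ∀ a b c, form (a * b) c = form a (b * c)
  /-- the differential -/
  d : A →ₗ[ℝ] A
  d_mem : ∀ {i : ZMod 2} {a : A}, a ∈ 𝒜 i → d a ∈ 𝒜 (i + 1)
  d_d : ∀ a, d (d a) = 0
  d_mul : ∀ {i : ZMod 2} {a : A}, a ∈ 𝒜 i → ∀ b, d (a * b) = d a * b + sgn i • (a * d b)
  form_d : ∀ {i : ZMod 2} {a : A}, a ∈ 𝒜 i → ∀ b, form (d a) b + sgn i * form a (d b) = 0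
  contractible : ∀ a, d a = 0 → ∃ b, d b = a

namespace FrobeniusDGA

variable {A : Type*} [NonUnitalRing A] [Module ℝ A]
  {𝒜 : ZMod 2 → Submodule ℝ A} (F : FrobeniusDGA 𝒜)

/-- `X` is a graded subspace on which the scalar product vanishes. -/
def IsIsotropic [DirectSum.Decomposition 𝒜] (X : Submodule ℝ A) : Prop :=
  (∀ a ∈ X, ∀ i, (DirectSum.decompose 𝒜 a i : A) ∈ X) ∧ ∀ a ∈ X, ∀ b ∈ X, F.form a b = 0

/-- `L` is a maximally isotropic (graded) subspace with `A = L ⊕ d(A)`. -/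
structure IsGauge [DirectSum.Decomposition 𝒜] (L : Submodule ℝ A) : Prop where
  isotropic : F.IsIsotropic L
  maximal : ∀ X : Submodule ℝ A, F.IsIsotropic X → Module.finrank ℝ X ≤ Module.finrank ℝ L
  isCompl : IsCompl L (LinearMap.range F.d)

/-- `⟨a b₁ ⋯ b_{k-1}, b_k⟩` for the list `b₁, …, b_k`. -/
def iterForm : A → List A → ℝ
  | _, [] => 0
  | a, [b] => F.form a b
  | a, b :: c :: l => iterForm (a * b) (c :: l)

/-- `m̃(a₁, …, a_N) = ⟨a₁ ⋯ a_{N-1}, a_N⟩`. -/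
def mTilde {N : ℕ} (a : Fin N → A) : ℝ :=
  match List.ofFn a with
  | [] => 0
  | b :: l => F.iterForm b l

variable {r n m : ℕ}

/-- Parity of the coordinates `eᵃ ⊗ zᵢ` on `L ⊗ V`, where `(eᵃ)` is dual to a basis of `L` of
parities `q`. -/
def parLV (n m : ℕ) (q : Fin r → ZMod 2) : Fin r × Coord n m → ZMod 2 :=
  fun u => q u.1 + parV n m u.2

/-- The restriction to `L ⊗ V` of `Ψ_A(z_{w 1} ⋯ z_{w N})`, i.e. of the image of `m̃ ⊗ z_w` under
`(A*)^{⊗N} ⊗ (V*)^{⊗N} = (A* ⊗ V*)^{⊗N} → S^N(A* ⊗ V*)`, where `e` is a homogeneous basis of `L`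
of parities `q`. The sign is the Koszul sign both for writing the function `m̃` as the tensor
`∑ (-1)^{∑_{i<j} |aᵢ||aⱼ|} m̃(e_{a₁},…,e_{a_N}) e^{a₁} ⊗ ⋯ ⊗ e^{a_N}` and for the shuffle
`e^{a₁} ⊗ ⋯ ⊗ e^{a_N} ⊗ z_{w 1} ⊗ ⋯ ⊗ z_{w N} ↦ (e^{a₁} ⊗ z_{w 1}) ⊗ ⋯ ⊗ (e^{a_N} ⊗ z_{w N})`. -/
def Psi (e : Fin r → A) (q : Fin r → ZMod 2) {N : ℕ} (w : Fin N → Coord n m) :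
    SPoly (parLV n m q) :=
  ∑ a : Fin N → Fin r,
    (sgn (∑ j, ∑ i ∈ Finset.Iio j,
        (q (a i) * q (a j) + parV n m (w i) * q (a j))) * F.mTilde fun i => e (a i)) •
      monomial (parLV n m q) fun i => (a i, w i)

/-- The skew-symmetric form `⟨-,-⟩_V` corresponding to `ω`, on the basis of `V` dual to the
canonical coordinates: `⟨∂_{pᵢ},∂_{qᵢ}⟩ = 1 = -⟨∂_{qᵢ},∂_{pᵢ}⟩`, `⟨∂_{xᵢ},∂_{xᵢ}⟩ = 1`, and zero
otherwise. -/
def formV : Coord n m → Coord n m → ℝ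
  | Sum.inl (Sum.inl i), Sum.inl (Sum.inr j) => if i = j then 1 else 0
  | Sum.inl (Sum.inr i), Sum.inl (Sum.inl j) => if i = j then -1 else 0
  | Sum.inr i, Sum.inr j => if i = j then 1 else 0
  | _, _ => 0

/-- The symmetric form `(-1)^{|w₁||a₂|} ⟨a₁,a₂⟩_d ⟨w₁,w₂⟩_V` on `L ⊗ V`, where
`⟨a₁,a₂⟩_d = (-1)^{|a₁|} ⟨a₁, d a₂⟩`, on basis vectors `e_a ⊗ ∂_{zᵢ}`. -/
def formLV (e : Fin r → A) (q : Fin r → ZMod 2) (u v : Fin r × Coord n m) : ℝ :=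
  sgn (parV n m u.2 * q v.1) * (sgn (q u.1) * F.form (e u.1) (F.d (e v.1))) * formV u.2 v.2

/-- The function on `L ⊗ V` dual to the basis vector `e_a ⊗ ∂_{zᵢ}`, which is
`(-1)^{|e_a||zᵢ|} eᵃ ⊗ zᵢ`. -/
def dualCoord (q : Fin r → ZMod 2) (u : Fin r × Coord n m) : SPoly (parLV n m q) :=
  sgn (q u.1 * parV n m u.2) • gen (parLV n m q) u

/-- The restriction of `σ̃` to `L ⊗ V`: the quadratic function `½⟨-,-⟩` of the form above,
written as the tensor `∑ (-1)^{|u||v|} ⟨u,v⟩ u* ⊗ v*`. -/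
def sigma (e : Fin r → A) (q : Fin r → ZMod 2) : SPoly (parLV n m q) :=
  (1 / 2 : ℝ) • ∑ u : Fin r × Coord n m, ∑ v : Fin r × Coord n m,
    (sgn (parLV n m q u * parLV n m q v) * F.formLV e q u v) • (dualCoord q u * dualCoord q v)

/-- A monomial of degree `≥ 3` in the canonical coordinates of `V`. -/
structure Mono (n m : ℕ) where
  len : ℕ
  three_le : 3 ≤ len
  letter : Fin len → Coord n m

/-- The element of `𝔤̃_{2n|m}` given by a monomial. -/
def Mono.toG (h : Mono n m) : gTilde n m :=
  ⟨monomial (parV n m) h.letter, homogDeg_le_gTilde h.three_le (monomial_mem _ _)⟩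

/-- The parity of a monomial. -/
def Mono.par (h : Mono n m) : ZMod 2 := ∑ i, parV n m (h.letter i)

/-- `S` is the functional `S_A^L` on relative Chevalley-Eilenberg chains: for all monomials
`h₁,…,h_l` (which span), `S(h₁ ∧ ⋯ ∧ h_l) = (-1)^{p(h)} ⟨Ψ_A(h₁) ⋯ Ψ_A(h_l)⟩₀`, the expectation
being taken over `L ⊗ V` (in terms of any homogeneous basis of `L`). The sign
`p(h) = ∑_{i<j} |hᵢ|` is the Koszul sign for moving the odd maps `Ψ_A` past the `hᵢ`. -/
def IsDualFunctional (L : Submodule ℝ A) (S : RelCochain n m) : Prop :=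
  ∀ (r : ℕ) (e : Module.Basis (Fin r) ℝ L) (q : Fin r → ZMod 2), (∀ a, (e a : A) ∈ 𝒜 (q a)) →
    ∀ (l : ℕ) (h : Fin l → Mono n m),
      IsExpectation (F.sigma (fun a => (e a : A)) q)
        (List.ofFn fun i => F.Psi (fun a => (e a : A)) q (h i).letter).prod
        (sgn (∑ j, ∑ i ∈ Finset.Iio j, (h i).par) * S (toRel (wedge fun i => (h i).toG)))

end FrobeniusDGA

end DualConstruction

end

/-!
The dual construction produces relative cocycles because `Ψ_A` represents Hamiltonian functions on
`V` by functions on `L ⊗ V` in such a way that Poisson brackets become derivatives along vector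
fields that preserve the Gaussian weight.

*Superfields.* The algebra `A` is extended to the unital supercommutative algebra
`F.Ext = ℝ ⊕ A ⊕ ℝθ` with `a b = ab + ⟨a,b⟩ θ` and trace `τ`, the coefficient of `θ`. The generic
point of `L ⊗ V` is a family `X w` of even and odd elements of the graded tensor product of `F.Ext`
with the functions on `L ⊗ V`, and `Ψ(h) = τ(h(X))` (`GaugeData.psi`, `psi_monomial`). For each `h`
the vector field `GaugeData.ham` on `L ⊗ V` is the value of the Hamiltonian vector field of `h` at
the generic point, projected to `L` along `d A`. As `L` and `d A` are both isotropic, the derivative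
of `Ψ(f)` along `ham h` plus that of `Ψ(h)` along `ham f`, with signs, is `Ψ` of the bracket
(`ham_psi_add`); for quadratic `h` a single term suffices (`ham_psi_osp`). The field `ham h`
preserves `σ̃` (`ham_quad_d`) and is divergence free (`div_ham`), so that mean values of its
derivatives vanish (`expectation_ham`).

*The cocycle.* The products `Ψ(h₁) ⋯ Ψ(h_l)`, with their sign, are a linear function `chainProd` on
the exterior superalgebra, which is defined by letting the algebra act on pairs of functions. The
Chevalley-Eilenberg differential and the action of `𝔬𝔰𝔭` are carried by it to sums of derivatives
along the fields `ham` (`chainProd_ceDelta`, `chainProd_ospAct`). Hence the mean value descends to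
coinvariants and vanishes on boundaries.

*Mean values.* Standard coordinates for `σ̃` exist by Sylvester's law
(`IsSupersymm.nonempty_gaussCoords`). In them the superintegral is the Berezin integral followed by
the Gaussian functional with second moments `±1`, the negative ones arising by Wick rotation
(`isWickIntegral`). It satisfies the Schwinger-Dyson equations `E(∂ᵤ f) = E(∂ᵤσ̃ f)`, which determine
a linear functional up to its value at `1` (`SchwingerDyson.eq_zero`). So mean values exist, do not
depend on coordinates (`exists_expectation`), and are compatible with a change of the basis of `L`
(`expectation_change`). Uniqueness of the functional holds because wedge products of monomials span
(`span_wedge_toG`).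

*Independence of `L`.* Another gauge is the graph over `L` of a map into `d A`, which is the
difference `ψ` of the two projections along `d A` (`GaugeData.isVariation_sub`). All the subspaces
`(1 + tψ) L` are gauges with the same `σ̃` (`deform_quad`), and only `Ψ` depends on `t`. The
derivative of `Ψ(h)` in `t` is, up to sign, the derivative along `ham h` of the quadratic function
`R` given by `ψ` (`ham_deform_quad`). Integrating by parts (`expectation_quad_mul_ham`), the
derivative in `t` of the mean value of a product is minus the mean value of `R` times the product
for the Chevalley-Eilenberg boundary (`hasDerivAt_expectation_wedge`). Integrated over `[0, 1]`, this
exhibits the difference of the two cocycles as a coboundary (`isCoboundary_deform`,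
`isCoboundary_sub`).
-/

noncomputable section

set_option linter.unusedSectionVars false

namespace DualConstruction

/-! ### Supercommutative algebras and superderivations -/

theorem zmod2_cases (x : ZMod 2) : x = 0 ∨ x = 1 := by
  revert x; decide

theorem two_eq_zero : (2 : ZMod 2) = 0 := rfl

@[simp] theorem sgn_zero : sgn 0 = 1 := by simp [sgn]

@[simp] theorem sgn_one : sgn 1 = -1 := by simp [sgn]

theorem sgn_mul_sgn_self (x : ZMod 2) : sgn x * sgn x = 1 := sgn_self_mul x

theorem sgn_smul_sgn_smul {M : Type*} [AddCommGroup M] [Module ℝ M] (x y : ZMod 2) (v : M) :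
    sgn x • sgn y • v = sgn (x + y) • v := by
  rw [smul_smul, sgn_add]

theorem sgn_smul_self_smul {M : Type*} [AddCommGroup M] [Module ℝ M] (x : ZMod 2) (v : M) :
    sgn x • sgn x • v = v := by
  rw [smul_smul, sgn_self_mul, one_smul]

theorem sgn_ne_zero (x : ZMod 2) : sgn x ≠ 0 := by
  intro h
  have := sgn_self_mul x
  rw [h] at this
  norm_num at this

/-- A supercommutative algebra; the `ℤ/2`-grading is encoded by the parity involution `J`, which
multiplies homogeneous elements of parity `x` by `(-1)^x`. -/
class SuperAlg (R : Type*) [Ring R] [Algebra ℝ R] where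
  /-- the parity involution -/
  J : R →ₐ[ℝ] R
  J_J : ∀ a, J (J a) = a
  comm : ∀ {x y : ZMod 2} {a b : R}, J a = sgn x • a → J b = sgn y • b →
    a * b = sgn (x * y) • (b * a)

open SuperAlg (J)

section SuperAlg
variable (R : Type*) [Ring R] [Algebra ℝ R] [SuperAlg R]

/-- The homogeneous elements of parity `x`. -/
def par (x : ZMod 2) : Submodule ℝ R where
  carrier := {a | J a = sgn x • a}
  add_mem' {a b} ha hb := by
    change J (a + b) = _
    rw [map_add, show J a = _ from ha, show J b = _ from hb, smul_add]
  zero_mem' := by change J (0 : R) = _; simp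
  smul_mem' c a ha := by
    change J (c • a) = _
    rw [map_smul, show J a = _ from ha, smul_comm]

variable {R}

theorem mem_par {x : ZMod 2} {a : R} : a ∈ par R x ↔ J a = sgn x • a := Iff.rfl

theorem one_mem_par : (1 : R) ∈ par R 0 := by simp [mem_par]

theorem mul_mem_par {x y : ZMod 2} {a b : R} (ha : a ∈ par R x) (hb : b ∈ par R y) :
    a * b ∈ par R (x + y) := by
  rw [mem_par] at *
  rw [map_mul, ha, hb, smul_mul_smul_comm, sgn_add]

/-- The homogeneous component of parity `x`. -/
def comp (x : ZMod 2) (a : R) : R := (1 / 2 : ℝ) • (a + sgn x • J a)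

theorem comp_mem (x : ZMod 2) (a : R) : comp x a ∈ par R x := by
  rw [mem_par, comp, map_smul, map_add, map_smul, SuperAlg.J_J]
  match_scalars
  · linear_combination (-1 / 2 : ℝ) * sgn_self_mul x
  · ring

theorem comp_add_comp (a : R) : comp 0 a + comp 1 a = a := by
  simp only [comp, sgn_zero, sgn_one]
  module

theorem comp_of_mem {x y : ZMod 2} {a : R} (ha : a ∈ par R x) :
    comp y a = if y = x then a else 0 := by
  rw [mem_par] at ha
  rw [comp, ha, sgn_smul_sgn_smul]
  rcases zmod2_cases x with rfl | rfl <;> rcases zmod2_cases y with rfl | rfl <;>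
    simp [show (1 : ZMod 2) + 1 = 0 from rfl, ← two_smul ℝ a, smul_smul]

/-- A property closed under sums holds everywhere once it holds for homogeneous elements. -/
theorem homog_induction {Q : R → Prop} (hadd : ∀ a b, Q a → Q b → Q (a + b))
    (h : ∀ x, ∀ a ∈ par R x, Q a) (a : R) : Q a := by
  rw [← comp_add_comp a]
  exact hadd _ _ (h _ _ (comp_mem _ _)) (h _ _ (comp_mem _ _))

/-- The power `J ^ x`, `x ∈ ℤ/2`, of the parity involution. -/
def Jp (x : ZMod 2) : R →ₐ[ℝ] R := if x = 0 then AlgHom.id ℝ R else J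

@[simp] theorem Jp_zero : Jp 0 = AlgHom.id ℝ R := by simp [Jp]

@[simp] theorem Jp_one : (Jp 1 : R →ₐ[ℝ] R) = J := by simp [Jp]

theorem Jp_of_mem {x : ZMod 2} {a : R} (y : ZMod 2) (ha : a ∈ par R x) :
    Jp y a = sgn (y * x) • a := by
  rcases zmod2_cases y with rfl | rfl
  · simp
  · simpa using mem_par.1 ha

theorem mul_comm_of_mem {x y : ZMod 2} {a b : R} (ha : a ∈ par R x) (hb : b ∈ par R y) :
    a * b = sgn (x * y) • (b * a) := SuperAlg.comm ha hb

/-- `D` is a superderivation of parity `δ`. -/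
structure IsSDer (δ : ZMod 2) (D : R →ₗ[ℝ] R) : Prop where
  leibniz : ∀ a b, D (a * b) = D a * b + Jp δ a * D b
  parity : ∀ a, J (D a) = sgn δ • D (J a)

theorem IsSDer.mem {δ x : ZMod 2} {D : R →ₗ[ℝ] R} (hD : IsSDer δ D) {a : R}
    (ha : a ∈ par R x) : D a ∈ par R (δ + x) := by
  rw [mem_par] at *
  rw [hD.parity, ha, map_smul, sgn_smul_sgn_smul]

theorem IsSDer.map_one {δ : ZMod 2} {D : R →ₗ[ℝ] R} (hD : IsSDer δ D) : D 1 = 0 := by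
  have := hD.leibniz 1 1
  simpa using this

/-- The multiple `c D` of a superderivation `D` of parity `ε` by a homogeneous element `c`. -/
theorem IsSDer.mulLeft {δ ε : ZMod 2} {D : R →ₗ[ℝ] R} (hD : IsSDer ε D) {c : R}
    (hc : c ∈ par R (δ + ε)) : IsSDer δ (LinearMap.mulLeft ℝ c ∘ₗ D) where
  leibniz a b := by
    simp only [LinearMap.comp_apply, LinearMap.mulLeft_apply, hD.leibniz]
    rw [mul_add, ← mul_assoc, ← mul_assoc, ← mul_assoc]
    congr 2
    refine homog_induction (Q := fun a => c * Jp ε a = Jp δ a * c) (fun a b ha hb => ?_)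
      (fun x a ha => ?_) a
    · rw [map_add, map_add, mul_add, add_mul, ha, hb]
    · rw [Jp_of_mem _ ha, Jp_of_mem _ ha, mul_smul_comm, smul_mul_assoc,
        mul_comm_of_mem hc ha, sgn_smul_sgn_smul]
      congr 2
      linear_combination (ε * x) * two_eq_zero
  parity a := by
    simp only [LinearMap.comp_apply, LinearMap.mulLeft_apply, map_mul, hD.parity]
    rw [mem_par.1 hc, smul_mul_smul_comm, ← sgn_add]
    congr 2
    linear_combination ε * two_eq_zero

theorem IsSDer.sum {κ : Type*} {s : Finset κ} {δ : ZMod 2} {D : κ → R →ₗ[ℝ] R}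
    (hD : ∀ k ∈ s, IsSDer δ (D k)) : IsSDer δ (∑ k ∈ s, D k) where
  leibniz a b := by
    simp only [LinearMap.sum_apply, Finset.sum_mul, Finset.mul_sum, ← Finset.sum_add_distrib]
    exact Finset.sum_congr rfl fun k hk => (hD k hk).leibniz a b
  parity a := by
    simp only [LinearMap.sum_apply, map_sum, Finset.smul_sum]
    exact Finset.sum_congr rfl fun k hk => (hD k hk).parity a

end SuperAlg

/-! ### Calculus of polynomial superfunctions -/

section SPoly
variable {ι : Type*} (p : ι → ZMod 2)

/-- Every superpolynomial is built from `1` by multiplying by coordinates from the left, adding and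
scaling. -/
theorem spoly_induction {Q : SPoly p → Prop} (one : Q 1) (mul : ∀ i f, Q f → Q (gen p i * f))
    (add : ∀ f g, Q f → Q g → Q (f + g)) (smul : ∀ (c : ℝ) f, Q f → Q (c • f))
    (f : SPoly p) : Q f := by
  suffices h : ∀ g, Q g → Q (f * g) by simpa using h 1 one
  obtain ⟨f, rfl⟩ := RingQuot.mkAlgHom_surjective ℝ (SRel p) f
  induction f using FreeAlgebra.induction with
  | grade0 r =>
    intro g hg
    rw [AlgHom.commutes, ← Algebra.smul_def]
    exact smul r g hg
  | grade1 j => exact fun g hg => mul j g hg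
  | mul a b ha hb =>
    intro g hg
    rw [map_mul, mul_assoc]
    exact ha _ (hb _ hg)
  | add a b ha hb =>
    intro g hg
    rw [map_add, add_mul]
    exact add _ _ (ha _ hg) (hb _ hg)

theorem spoly_algHom_ext {C : Type*} [Ring C] [Algebra ℝ C]
    {F G : SPoly p →ₐ[ℝ] C} (h : ∀ i, F (gen p i) = G (gen p i)) : F = G := by
  refine AlgHom.ext fun f => ?_
  induction f using spoly_induction with
  | one => simp
  | mul i f hf => rw [map_mul, map_mul, h, hf]
  | add f g hf hg => rw [map_add, map_add, hf, hg]
  | smul c f hf => rw [map_smul, map_smul, hf]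

@[simp] theorem parityInv_gen (i : ι) : parityInv p (gen p i) = sgn (p i) • gen p i := by
  simp [parityInv]

theorem parityInv_parityInv (f : SPoly p) : parityInv p (parityInv p f) = f := by
  induction f using spoly_induction with
  | one => simp
  | mul i f hf =>
    rw [map_mul, map_mul, hf, parityInv_gen, map_smul, parityInv_gen, smul_smul, sgn_self_mul, one_smul]
  | add f g hf hg => rw [map_add, map_add, hf, hg]
  | smul c f hf => rw [map_smul, map_smul, hf]

theorem gen_mul_of_homog (i : ι) {y : ZMod 2} (f : SPoly p) (hf : IsHomog p y f) :
    gen p i * f = sgn (p i * y) • (f * gen p i) := by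
  have key : ∀ f : SPoly p, gen p i * f =
      (if p i = 0 then f else parityInv p f) * gen p i := by
    intro f
    induction f using spoly_induction with
    | one => simp
    | mul j f hf =>
      rw [← mul_assoc, gen_mul_gen, smul_mul_assoc, mul_assoc, hf]
      rcases zmod2_cases (p i) with h | h <;> simp [h, mul_assoc]
    | add f g hf hg => rw [mul_add, hf, hg]; split_ifs <;> simp [add_mul]
    | smul c f hf => rw [mul_smul_comm, hf]; split_ifs <;> simp
  rw [key]
  rcases zmod2_cases (p i) with h | h
  · simp [h]
  · rw [IsHomog] at hf
    simp [h, hf]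

theorem homog_mul_comm {x y : ZMod 2} {f g : SPoly p} (hf : IsHomog p x f)
    (hg : IsHomog p y g) : f * g = sgn (x * y) • (g * f) := by
  have key : ∀ f : SPoly p, f * g = g * (if y = 0 then f else parityInv p f) := by
    intro f
    induction f using spoly_induction with
    | one => simp
    | mul i f hf =>
      rw [mul_assoc, hf, ← mul_assoc, gen_mul_of_homog p i g hg, smul_mul_assoc, mul_assoc]
      rcases zmod2_cases y with h | h <;> simp [h]
    | add f g hf hg => rw [add_mul, hf, hg]; split_ifs <;> simp [mul_add]
    | smul c f hf => rw [smul_mul_assoc, hf]; split_ifs <;> simp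
  rw [key]
  rcases zmod2_cases y with h | h
  · simp [h]
  · rw [IsHomog] at hf
    simp [h, hf]

instance : SuperAlg (SPoly p) where
  J := parityInv p
  J_J := parityInv_parityInv p
  comm ha hb := homog_mul_comm p ha hb

theorem J_spoly (f : SPoly p) : J f = parityInv p f := rfl

theorem mem_par_iff_isHomog {x : ZMod 2} {f : SPoly p} : f ∈ par _ x ↔ IsHomog p x f := Iff.rfl

theorem gen_mem_par (i : ι) : gen p i ∈ par _ (p i) := parityInv_gen p i

variable [DecidableEq ι]

/-- The Leibniz rule for left derivatives, extended from the defining case of a product with a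
coordinate. -/
theorem isSDer_pderiv (i : ι) : IsSDer (p i) (pderiv p i) where
  leibniz f g := by
    induction f using spoly_induction with
    | one => simp [pderiv_one]
    | mul j f hf =>
      rw [mul_assoc, pderiv_gen_mul, hf, pderiv_gen_mul, map_mul, Jp_of_mem _ (gen_mem_par p j)]
      simp only [add_mul, mul_add, smul_add, smul_mul_assoc, mul_assoc, add_assoc]
    | add f g hf hg =>
      rw [add_mul, map_add, map_add, map_add, hf, hg]
      simp only [add_mul]
      abel
    | smul c f hf =>
      rw [smul_mul_assoc, map_smul, map_smul, map_smul, hf]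
      simp
  parity f := by
    simp only [J_spoly]
    induction f using spoly_induction with
    | one => simp [pderiv_one]
    | mul j f hf =>
      rw [pderiv_gen_mul, map_mul, parityInv_gen, smul_mul_assoc, map_smul, pderiv_gen_mul,
        map_add, map_smul, map_smul, map_mul, parityInv_gen, hf]
      simp only [smul_add, smul_mul_assoc, mul_smul_comm, sgn_smul_sgn_smul]
      congr 1
      · split_ifs with h
        · subst h
          simp [sgn_add, sgn_self_mul]
        · simp
      · rw [smul_smul, smul_smul, smul_smul, sgn_add]
        congr 1
        ring
    | add f g hf hg => simp only [map_add, hf, hg, smul_add]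
    | smul c f hf => simp only [map_smul, hf, smul_comm c]

@[simp] theorem pderiv_gen (i j : ι) :
    pderiv p i (gen p j) = if i = j then 1 else 0 := by
  have := pderiv_gen_mul p i j 1
  rw [mul_one, pderiv_one] at this
  rw [this]
  split_ifs <;> simp

/-- Partial derivatives supercommute; in particular the square of an odd one is zero. -/
theorem pderiv_pderiv_comm (i j : ι) (f : SPoly p) :
    pderiv p i (pderiv p j f) = sgn (p i * p j) • pderiv p j (pderiv p i f) := by
  induction f using spoly_induction with
  | one => simp [pderiv_one]
  | mul k f hf =>
    simp only [pderiv_gen_mul, map_add, map_smul, hf, smul_add, mul_smul_comm]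
    have h1 : (sgn (p j * p k) * if i = k then (1 : ℝ) else 0) =
        sgn (p i * p j) * (if i = k then 1 else 0) := by
      split_ifs with h
      · subst h; rw [mul_comm (p j)]
      · simp
    have h2 : (if j = k then (1 : ℝ) else 0) =
        sgn (p i * p j) * (sgn (p i * p k) * (if j = k then (1 : ℝ) else 0)) := by
      split_ifs with h
      · subst h; simp [sgn_self_mul]
      · simp
    match_scalars
    · linear_combination h2
    · linear_combination h1
    · ring
  | add f g hf hg => simp only [map_add, hf, hg, smul_add]
  | smul c f hf => simp only [map_smul, hf, smul_comm c]

end SPoly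
end DualConstruction

namespace DualConstruction
open SuperAlg (J)
open scoped TensorProduct

/-! ### Graded tensor products of supercommutative algebras -/

section Graded
variable (R : Type*) [Ring R] [Algebra ℝ R] [SuperAlg R]

/-- The homogeneous component of parity `x`, as a linear map to the component. -/
def compL (x : ZMod 2) : R →ₗ[ℝ] par R x where
  toFun a := ⟨comp x a, comp_mem x a⟩
  map_add' a b := Subtype.ext <| by
    simp only [comp, map_add, Submodule.coe_add]
    module
  map_smul' c a := Subtype.ext <| by
    simp only [comp, map_smul, RingHom.id_apply, Submodule.coe_smul]
    module

instance : GradedAlgebra (par R) where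
  one_mem := one_mem_par
  mul_mem _ _ _ _ ha hb := mul_mem_par ha hb
  decompose' a := ∑ x, DirectSum.of (fun x => par R x) x (compL R x a)
  left_inv a := by
    rw [map_sum]
    simp only [DirectSum.coeAddMonoidHom_of]
    exact (Fin.sum_univ_two _).trans (comp_add_comp a)
  right_inv a := by
    induction a using DirectSum.induction_on with
    | zero => simp
    | of x a =>
      rw [DirectSum.coeAddMonoidHom_of]
      beta_reduce
      rw [Finset.sum_eq_single x]
      · congr 1
        refine Subtype.ext ?_
        change comp x (a : R) = a
        rw [comp_of_mem a.2, if_pos rfl]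
      · intro y _ hy
        rw [show compL R y (a : R) = 0 from Subtype.ext ?_, map_zero]
        change comp y (a : R) = 0
        rw [comp_of_mem a.2, if_neg hy]
      · simp
    | add a b ha hb =>
      simp only [map_add, Finset.sum_add_distrib] at *
      rw [ha, hb]

end Graded

/-- The graded tensor product `B ⊗ S` of superalgebras, with the Koszul sign rule. -/
abbrev STensor (B S : Type*) [Ring B] [Algebra ℝ B] [SuperAlg B] [Ring S] [Algebra ℝ S]
    [SuperAlg S] : Type _ := GradedTensorProduct ℝ (par B) (par S)

section STensor
variable {B S : Type*} [Ring B] [Algebra ℝ B] [SuperAlg B] [Ring S] [Algebra ℝ S] [SuperAlg S]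

/-- The tensor `b ⊗ s`. -/
def tm (b : B) (s : S) : STensor B S := GradedTensorProduct.tmul ℝ b s

theorem add_tm (b b' : B) (s : S) : tm (b + b') s = tm b s + tm b' s := by
  simp [tm, GradedTensorProduct.tmul, TensorProduct.add_tmul]

theorem tm_add (b : B) (s s' : S) : tm b (s + s') = tm b s + tm b s' := by
  simp [tm, GradedTensorProduct.tmul, TensorProduct.tmul_add]

theorem smul_tm (c : ℝ) (b : B) (s : S) : tm (c • b) s = c • tm b s := by
  rw [tm, GradedTensorProduct.tmul, ← TensorProduct.smul_tmul', map_smul]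
  rfl

theorem tm_smul (c : ℝ) (b : B) (s : S) : tm b (c • s) = c • tm b s := by
  simp [tm, GradedTensorProduct.tmul, TensorProduct.tmul_smul]

@[simp] theorem zero_tm (s : S) : tm (0 : B) s = 0 := by
  simp [tm, GradedTensorProduct.tmul]

@[simp] theorem tm_zero (b : B) : tm b (0 : S) = 0 := by
  simp [tm, GradedTensorProduct.tmul]

theorem tm_one_one : tm (1 : B) (1 : S) = 1 := rfl

theorem neg_one_uzpow_smul {M : Type*} [AddCommGroup M] [Module ℝ M] (x : ZMod 2) (v : M) :
    ((-1 : ℤˣ) ^ x) • v = sgn x • v := by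
  rcases zmod2_cases x with rfl | rfl
  · simp
  · rw [uzpow_one, sgn_one, Units.neg_smul, one_smul, neg_smul, one_smul]

theorem tm_mul_tm {ς β : ZMod 2} (b : B) {s : S} (hs : s ∈ par S ς) {b' : B} (hb : b' ∈ par B β)
    (s' : S) : tm b s * tm b' s' = sgn (ς * β) • tm (b * b') (s * s') := by
  have := GradedTensorProduct.tmul_coe_mul_coe_tmul (par B) (par S) b ⟨s, hs⟩ ⟨b', hb⟩ s'
  rw [neg_one_uzpow_smul] at this
  exact this

/-- Additive properties of graded tensors may be checked on homogeneous pure tensors. -/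
theorem tensor_induction {Q : STensor B S → Prop} (add : ∀ x y, Q x → Q y → Q (x + y))
    (tm : ∀ β ς, ∀ b ∈ par B β, ∀ s ∈ par S ς, Q (tm b s)) (x : STensor B S) : Q x := by
  obtain ⟨x, rfl⟩ := (GradedTensorProduct.of ℝ (par B) (par S)).surjective x
  induction x using TensorProduct.induction_on with
  | zero => simpa using tm 0 0 0 (Submodule.zero_mem _) 0 (Submodule.zero_mem _)
  | tmul b s =>
    change Q (DualConstruction.tm b s)
    refine homog_induction (Q := fun b => Q (DualConstruction.tm b s)) (fun b b' hb hb' => ?_)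
      (fun β b hb => ?_) b
    · rw [add_tm]; exact add _ _ hb hb'
    · refine homog_induction (Q := fun s => Q (DualConstruction.tm b s)) (fun s s' hs hs' => ?_)
        (fun ς s hs => tm β ς b hb s hs) s
      rw [tm_add]; exact add _ _ hs hs'
  | add x y hx hy => rw [map_add]; exact add _ _ hx hy

/-- The map `φ ⊗ ψ` for linear maps `φ`, `ψ`, without signs. -/
def tmap {B' S' : Type*} [Ring B'] [Algebra ℝ B'] [SuperAlg B'] [Ring S'] [Algebra ℝ S']
    [SuperAlg S'] (φ : B →ₗ[ℝ] B') (ψ : S →ₗ[ℝ] S') : STensor B S →ₗ[ℝ] STensor B' S' :=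
  (GradedTensorProduct.of ℝ (par B') (par S')).toLinearMap ∘ₗ TensorProduct.map φ ψ ∘ₗ
    (GradedTensorProduct.of ℝ (par B) (par S)).symm.toLinearMap

@[simp] theorem tmap_tm {B' S' : Type*} [Ring B'] [Algebra ℝ B'] [SuperAlg B'] [Ring S']
    [Algebra ℝ S'] [SuperAlg S'] (φ : B →ₗ[ℝ] B') (ψ : S →ₗ[ℝ] S') (b : B) (s : S) :
    tmap φ ψ (tm b s) = tm (φ b) (ψ s) := by
  rfl

/-- The `S`-linear extension `B ⊗ S → S` of a linear functional on `B`. -/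
def slice (π : B →ₗ[ℝ] ℝ) : STensor B S →ₗ[ℝ] S :=
  (TensorProduct.lid ℝ S).toLinearMap ∘ₗ TensorProduct.map π LinearMap.id ∘ₗ
    (GradedTensorProduct.of ℝ (par B) (par S)).symm.toLinearMap

@[simp] theorem slice_tm (π : B →ₗ[ℝ] ℝ) (b : B) (s : S) : slice π (tm b s) = π b • s := by
  rfl

theorem J_tm_aux (b b' : B) (s s' : S) :
    tmap J.toLinearMap J.toLinearMap (tm b s * tm b' s') =
    tmap (B := B) (S := S) J.toLinearMap J.toLinearMap (tm b s) *
      tmap (B := B) (S := S) J.toLinearMap J.toLinearMap (tm b' s') := by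
  refine homog_induction (Q := fun b' => tmap J.toLinearMap J.toLinearMap (tm b s * tm b' s') =
    tmap (B := B) (S := S) J.toLinearMap J.toLinearMap (tm b s) *
      tmap (B := B) (S := S) J.toLinearMap J.toLinearMap (tm b' s')) (fun x y hx hy => ?_)
    (fun β b' hb' => ?_) b'
  · simp only [add_tm, mul_add, map_add, hx, hy]
  refine homog_induction (Q := fun s => tmap J.toLinearMap J.toLinearMap (tm b s * tm b' s') =
    tmap (B := B) (S := S) J.toLinearMap J.toLinearMap (tm b s) *
      tmap (B := B) (S := S) J.toLinearMap J.toLinearMap (tm b' s')) (fun x y hx hy => ?_)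
    (fun ς s hs => ?_) s
  · simp only [tm_add, add_mul, map_add, hx, hy]
  · rw [tm_mul_tm _ hs hb', map_smul]
    simp only [tmap_tm, AlgHom.toLinearMap_apply, map_mul, mem_par.1 hs, mem_par.1 hb']
    rw [tm_smul, smul_tm, smul_mul_smul_comm, tm_mul_tm _ hs hb', smul_mul_assoc, mul_smul_comm,
      tm_smul, smul_tm, smul_smul, smul_smul, smul_smul]
    congr 1
    ring

theorem tm_mem_eigen {β ς : ZMod 2} {b : B} {s : S} (hb : b ∈ par B β) (hs : s ∈ par S ς) :
    tmap J.toLinearMap J.toLinearMap (tm b s) = sgn (β + ς) • tm b s := by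
  rw [tmap_tm, AlgHom.toLinearMap_apply, AlgHom.toLinearMap_apply, mem_par.1 hb, mem_par.1 hs,
    smul_tm, tm_smul, sgn_smul_sgn_smul]

/-- Supercommutativity of the graded tensor product, for a homogeneous left factor; the general
right factor is moved past it by the parity involution. -/
theorem tensor_comm {x : STensor B S} {α : ZMod 2}
    (hx : tmap J.toLinearMap J.toLinearMap x = sgn α • x) (y : STensor B S) :
    x * y = (if α = 0 then y else tmap J.toLinearMap J.toLinearMap y) * x := by
  refine tensor_induction (Q := fun y => x * y =
    (if α = 0 then y else tmap J.toLinearMap J.toLinearMap y) * x) (fun y y' hy hy' => ?_)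
    (fun β ς b hb s hs => ?_) y
  · rw [mul_add, hy, hy', ← add_mul]
    split_ifs <;> simp
  have key : ∀ x : STensor B S, x * tm b s =
      tm b s * (if β + ς = 0 then x else tmap J.toLinearMap J.toLinearMap x) := by
    intro x
    refine tensor_induction (Q := fun x => x * tm b s =
      tm b s * (if β + ς = 0 then x else tmap J.toLinearMap J.toLinearMap x))
      (fun y y' hy hy' => ?_) (fun β' ς' b' hb' s' hs' => ?_) x
    · rw [add_mul, hy, hy', ← mul_add]
      split_ifs <;> simp
    · rw [tm_mem_eigen hb' hs', tm_mul_tm _ hs' hb, mul_comm_of_mem hb' hb,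
        mul_comm_of_mem hs' hs, smul_tm, tm_smul]
      have h : (if β + ς = 0 then tm b' s' else sgn (β' + ς') • tm b' s') =
          sgn ((β + ς) * (β' + ς')) • tm b' s' := by
        rcases zmod2_cases (β + ς) with h | h <;> simp [h]
      rw [h, mul_smul_comm, tm_mul_tm _ hs hb', sgn_smul_sgn_smul, sgn_smul_sgn_smul,
        sgn_smul_sgn_smul]
      congr 2
      linear_combination (-β' * ς) * two_eq_zero
  rw [key, tm_mem_eigen hb hs, hx]
  rcases zmod2_cases α with rfl | rfl <;> rcases zmod2_cases (β + ς) with h | h <;> simp [h]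

/-- The parity involution of a graded tensor product. -/
def tensorJ : STensor B S →ₐ[ℝ] STensor B S :=
  AlgHom.ofLinearMap (tmap J.toLinearMap J.toLinearMap) (by
    rw [← tm_one_one, tmap_tm]; simp) (fun x y => by
    induction x using tensor_induction with
    | add x x' hx hx' => rw [add_mul, map_add, hx, hx', map_add, add_mul]
    | tm β ς b hb s hs =>
      induction y using tensor_induction with
      | add y y' hy hy' => rw [mul_add, map_add, hy, hy', map_add, mul_add]
      | tm β' ς' b' hb' s' hs' => exact J_tm_aux _ _ _ _)

instance : SuperAlg (STensor B S) where
  J := tensorJ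
  J_J x := by
    induction x using tensor_induction with
    | add x y hx hy => rw [map_add, map_add, hx, hy]
    | tm β ς b hb s hs =>
      change tmap J.toLinearMap J.toLinearMap (tmap J.toLinearMap J.toLinearMap (tm b s)) = _
      simp [SuperAlg.J_J]
  comm {α β x y} hx hy := by
    change tmap J.toLinearMap J.toLinearMap x = _ at hx
    change tmap J.toLinearMap J.toLinearMap y = _ at hy
    rw [tensor_comm hx, hy]
    rcases zmod2_cases α with rfl | rfl <;> simp

@[simp] theorem J_tm (b : B) (s : S) : J (tm b s) = tm (J b) (J s) := rfl

theorem tm_mem_par {β ς : ZMod 2} {b : B} {s : S} (hb : b ∈ par B β) (hs : s ∈ par S ς) :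
    tm b s ∈ par (STensor B S) (β + ς) := tm_mem_eigen hb hs

end STensor
end DualConstruction

namespace DualConstruction
open SuperAlg (J)
open scoped TensorProduct

/-! ### Operators on graded tensor products -/

section STensor
variable {B S : Type*} [Ring B] [Algebra ℝ B] [SuperAlg B] [Ring S] [Algebra ℝ S] [SuperAlg S]

/-- The linear map `φ : B → B'` has parity `ε`. -/
def MapParity {B' : Type*} [Ring B'] [Algebra ℝ B'] [SuperAlg B'] (ε : ZMod 2)
    (φ : B →ₗ[ℝ] B') : Prop := ∀ b, J (φ b) = sgn ε • φ (J b)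

/-- The linear functional `π` has parity `ε`. -/
def FunParity (ε : ZMod 2) (π : B →ₗ[ℝ] ℝ) : Prop := ∀ b, π (J b) = sgn ε * π b

theorem MapParity.mem {B' : Type*} [Ring B'] [Algebra ℝ B'] [SuperAlg B'] {ε β : ZMod 2}
    {φ : B →ₗ[ℝ] B'} (h : MapParity ε φ) {b : B} (hb : b ∈ par B β) : φ b ∈ par B' (ε + β) := by
  rw [mem_par, h, mem_par.1 hb, map_smul, sgn_smul_sgn_smul]

theorem FunParity.eq_zero {ε β : ZMod 2} {π : B →ₗ[ℝ] ℝ} (h : FunParity ε π) {b : B}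
    (hb : b ∈ par B β) (hne : β ≠ ε) : π b = 0 := by
  have h1 := h b
  rw [mem_par.1 hb, map_smul, smul_eq_mul] at h1
  rcases zmod2_cases β with rfl | rfl <;> rcases zmod2_cases ε with rfl | rfl <;>
    first | exact absurd rfl hne | (simp at h1; linarith)

theorem J_slice {ε : ZMod 2} {π : B →ₗ[ℝ] ℝ} (h : FunParity ε π) (x : STensor B S) :
    J (slice π x) = sgn ε • slice π (J x) := by
  induction x using tensor_induction with
  | add x y hx hy => simp only [map_add, hx, hy, smul_add]
  | tm β ς b hb s hs =>
    rw [J_tm, slice_tm, slice_tm, h, map_smul, smul_smul, ← mul_assoc, sgn_self_mul, one_mul]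

theorem slice_mem {ε α : ZMod 2} {π : B →ₗ[ℝ] ℝ} (h : FunParity ε π) {x : STensor B S}
    (hx : x ∈ par _ α) : slice π x ∈ par S (ε + α) := by
  rw [mem_par, J_slice h, mem_par.1 hx, map_smul, sgn_smul_sgn_smul]

/-- The extension `b ⊗ s ↦ (-1)^(δ|b|) b ⊗ D s` to `B ⊗ S` of a map `D` of parity `δ`. -/
def extDer (δ : ZMod 2) (D : S →ₗ[ℝ] S) : STensor B S →ₗ[ℝ] STensor B S :=
  tmap (Jp δ).toLinearMap D

theorem extDer_tm (δ : ZMod 2) (D : S →ₗ[ℝ] S) {β : ZMod 2} {b : B} (hb : b ∈ par B β) (s : S) :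
    extDer δ D (tm b s) = sgn (δ * β) • tm b (D s) := by
  rw [extDer, tmap_tm, AlgHom.toLinearMap_apply, Jp_of_mem _ hb, smul_tm]

/-- A derivation in the second factor commutes with a functional on the first one, up to the Koszul
sign. -/
theorem slice_extDer {ε : ZMod 2} {π : B →ₗ[ℝ] ℝ} (h : FunParity ε π) (δ : ZMod 2)
    (D : S →ₗ[ℝ] S) (x : STensor B S) :
    slice π (extDer δ D x) = sgn (δ * ε) • D (slice π x) := by
  induction x using tensor_induction with
  | add x y hx hy => simp only [map_add, hx, hy, smul_add]
  | tm β ς b hb s hs =>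
    rw [extDer_tm _ _ hb, map_smul, slice_tm, slice_tm, map_smul]
    by_cases hβ : β = ε
    · rw [hβ]
    · rw [h.eq_zero hb hβ, zero_smul, smul_zero, smul_zero]

theorem IsSDer.extDer {δ : ZMod 2} {D : S →ₗ[ℝ] S} (hD : IsSDer δ D) :
    IsSDer δ (extDer (B := B) δ D) where
  leibniz x y := by
    induction x using tensor_induction with
    | add x x' hx hx' => simp only [add_mul, map_add, hx, hx']; abel
    | tm β ς b hb s hs =>
      induction y using tensor_induction with
      | add y y' hy hy' => simp only [mul_add, map_add, hy, hy']; abel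
      | tm β' ς' b' hb' s' hs' =>
        rw [tm_mul_tm _ hs hb', map_smul, extDer_tm _ _ (mul_mem_par hb hb'), hD.leibniz,
          Jp_of_mem _ hs, Jp_of_mem _ (tm_mem_par hb hs), extDer_tm _ _ hb, extDer_tm _ _ hb',
          smul_mul_smul_comm, smul_mul_assoc, smul_mul_assoc, tm_mul_tm _ hs hb',
          tm_mul_tm _ (hD.mem hs) hb', tm_add, tm_smul, smul_add, smul_add, sgn_smul_sgn_smul,
          sgn_smul_sgn_smul, sgn_smul_sgn_smul, sgn_smul_sgn_smul, ← sgn_add, sgn_smul_sgn_smul]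
        congr 3
        · linear_combination 0 * two_eq_zero
        · ring
  parity x := by
    induction x using tensor_induction with
    | add x x' hx hx' => simp only [map_add, hx, hx', smul_add]
    | tm β ς b hb s hs =>
      rw [J_tm, extDer_tm _ _ hb, mem_par.1 hb, map_smul, J_tm, hD.parity, mem_par.1 hb, smul_tm,
        smul_tm, map_smul, extDer_tm _ _ hb, tm_smul]
      match_scalars
      ring

/-- Applying a linear map to the first tensor factor. -/
abbrev lmap (φ : B →ₗ[ℝ] B) : STensor B S →ₗ[ℝ] STensor B S := tmap φ LinearMap.id

theorem lmap_mem {ε α : ZMod 2} {φ : B →ₗ[ℝ] B} (h : MapParity ε φ) {x : STensor B S}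
    (hx : x ∈ par _ α) : lmap φ x ∈ par _ (ε + α) := by
  have key : ∀ x : STensor B S, J (lmap φ x) = sgn ε • lmap φ (J x) := by
    intro x
    induction x using tensor_induction with
    | add x y hx hy => simp only [map_add, hx, hy, smul_add]
    | tm β ς b hb s hs => simp [h b, smul_tm]
  rw [mem_par, key, mem_par.1 hx, map_smul, sgn_smul_sgn_smul]

theorem lmap_extDer {ε : ZMod 2} {φ : B →ₗ[ℝ] B} (h : MapParity ε φ) (δ : ZMod 2)
    (D : S →ₗ[ℝ] S) (x : STensor B S) :
    extDer δ D (lmap φ x) = sgn (δ * ε) • lmap φ (extDer δ D x) := by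
  induction x using tensor_induction with
  | add x y hx hy => simp only [map_add, hx, hy, smul_add]
  | tm β ς b hb s hs =>
    simp only [tmap_tm, LinearMap.id_apply]
    rw [extDer_tm _ _ hb, extDer_tm _ _ (h.mem hb), map_smul, tmap_tm, sgn_smul_sgn_smul, mul_add]
    rfl

theorem IsSDer.lmap {δ : ZMod 2} {d : B →ₗ[ℝ] B} (hd : IsSDer δ d) :
    IsSDer δ (lmap (S := S) d) where
  leibniz x y := by
    induction x using tensor_induction with
    | add x x' hx hx' => simp only [add_mul, map_add, hx, hx']; abel
    | tm β ς b hb s hs =>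
      induction y using tensor_induction with
      | add y y' hy hy' => simp only [mul_add, map_add, hy, hy']; abel
      | tm β' ς' b' hb' s' hs' =>
        rw [Jp_of_mem _ (tm_mem_par hb hs), tm_mul_tm _ hs hb']
        simp only [map_smul, tmap_tm, LinearMap.id_apply]
        rw [tm_mul_tm _ hs hb', hd.leibniz, Jp_of_mem _ hb, add_tm, smul_mul_assoc, smul_tm,
          smul_mul_assoc, tm_mul_tm _ hs (hd.mem hb'), smul_add, sgn_smul_sgn_smul,
          sgn_smul_sgn_smul]
        congr 3
        linear_combination (-δ * ς) * two_eq_zero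
  parity x := by
    induction x using tensor_induction with
    | add x x' hx hx' => simp only [map_add, hx, hx', smul_add]
    | tm β ς b hb s hs => simp [hd.parity b, smul_tm]

theorem tm_mul_tm' {ς β : ZMod 2} (b : B) {s : S} (hs : s ∈ par S ς) {b' : B}
    (hb : b' ∈ par B β) (s' : S) (π : B →ₗ[ℝ] ℝ) :
    slice π (tm b s * tm b' s') = (sgn (ς * β) * π (b * b')) • (s * s') := by
  rw [tm_mul_tm _ hs hb, map_smul, slice_tm, smul_smul]

/-- The adjunction rule `τ(φ(a) b) = -τ(J^ε(a) φ(b))` extends from `B` to `B ⊗ S`. -/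
theorem slice_mul_lmap {π : B →ₗ[ℝ] ℝ} {φ : B →ₗ[ℝ] B} {ε : ZMod 2} (h0 : MapParity ε φ)
    (h : ∀ a b, π (φ a * b) = - π (Jp ε a * φ b)) (x y : STensor B S) :
    slice π (lmap φ x * y) = - slice π (Jp ε x * lmap φ y) := by
  induction x using tensor_induction with
  | add x x' hx hx' => simp only [add_mul, map_add, hx, hx', neg_add]
  | tm β ς b hb s hs =>
    induction y using tensor_induction with
    | add y y' hy hy' => simp only [mul_add, map_add, hy, hy', neg_add]
    | tm β' ς' b' hb' s' hs' =>
      rw [Jp_of_mem _ (tm_mem_par hb hs), smul_mul_assoc, map_smul]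
      simp only [tmap_tm, LinearMap.id_apply]
      rw [tm_mul_tm' _ hs hb', tm_mul_tm' _ hs (h0.mem hb'), h, Jp_of_mem _ hb, smul_mul_assoc,
        map_smul, smul_eq_mul, mul_add ε, mul_add ς, sgn_add, sgn_add, mul_comm ε ς]
      have h2 := sgn_self_mul (ς * ε)
      match_scalars
      linear_combination sgn (ς * β') * sgn (ε * β) * π (b * φ b') * h2

/-- A decomposition of the pairing `π (x y)` by an even operator `P` and its adjoint, up to terms
containing the augmentation `ε`, extends from `B` to `B ⊗ S`. -/
theorem slice_mul_proj {π ε : B →ₗ[ℝ] ℝ} {P : B →ₗ[ℝ] B} (h0 : MapParity 0 P)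
    (hπ : FunParity 1 π)
    (h : ∀ a b, π (P a * b) + π (a * P b) = π (a * b) - ε a * π b - π a * ε b)
    (hε : FunParity 0 ε) (x y : STensor B S) :
    slice π (lmap P x * y) + slice π (x * lmap P y) =
      slice π (x * y) - J (slice ε x) * slice π y - slice π x * slice ε y := by
  induction x using tensor_induction with
  | add x x' hx hx' =>
    simp only [add_mul, map_add]
    rw [add_add_add_comm, hx, hx']
    abel
  | tm β ς b hb s hs =>
    induction y using tensor_induction with
    | add y y' hy hy' =>
      simp only [mul_add, map_add]
      rw [add_add_add_comm, hy, hy']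
      abel
    | tm β' ς' b' hb' s' hs' =>
      simp only [tmap_tm, LinearMap.id_apply]
      rw [tm_mul_tm' _ hs hb', tm_mul_tm' _ hs (h0.mem hb'), tm_mul_tm' _ hs hb', zero_add,
        ← add_smul, ← mul_add, h, slice_tm, slice_tm, slice_tm, slice_tm, map_smul,
        mem_par.1 hs, smul_mul_smul_comm, smul_mul_assoc, smul_mul_smul_comm]
      by_cases hβ : β' = 0
      · subst hβ
        rw [hπ.eq_zero hb' (by decide)]
        simp [sub_smul]
      · obtain rfl : β' = 1 := (zmod2_cases β').resolve_left hβ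
        rw [hε.eq_zero hb' (by decide), mul_one]
        match_scalars
        ring

theorem slice_mul_of_slice_left {ε : B →ₗ[ℝ] ℝ} (hε : FunParity 0 ε)
    (h : ∀ a b, ε (a * b) = ε a * ε b) (x y : STensor B S) :
    slice ε (x * y) = slice ε x * slice ε y := by
  induction x using tensor_induction with
  | add x x' hx hx' => simp only [add_mul, map_add, hx, hx']
  | tm β ς b hb s hs =>
    induction y using tensor_induction with
    | add y y' hy hy' => simp only [mul_add, map_add, hy, hy']
    | tm β' ς' b' hb' s' hs' =>
      rw [tm_mul_tm' _ hs hb', h, slice_tm, slice_tm, smul_mul_smul_comm]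
      by_cases hβ : β' = 0
      · simp [hβ]
      · simp [hε.eq_zero hb' hβ]

end STensor

/-! ### The chain rule for polynomial superfunctions of superfields -/

section ChainRule
variable {ι : Type*} {p : ι → ZMod 2}
  {R : Type*} [Ring R] [Algebra ℝ R] [SuperAlg R]

/-- Substitution of homogeneous elements `X i` of a supercommutative algebra for the
coordinates. -/
def evalAt (X : ι → R) (hX : ∀ i, X i ∈ par R (p i)) : SPoly p →ₐ[ℝ] R :=
  sLift p X fun i j => mul_comm_of_mem (hX i) (hX j)

variable {X : ι → R} (hX : ∀ i, X i ∈ par R (p i))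

@[simp] theorem evalAt_gen (i : ι) : evalAt X hX (gen p i) = X i := sLift_gen _ _ _ _

/-- Evaluation preserves parity, since the coordinate `i` is sent to an element of parity `p i`. -/
theorem J_evalAt (f : SPoly p) : J (evalAt X hX f) = evalAt X hX (J f) := by
  induction f using spoly_induction with
  | one => simp
  | mul i f hf =>
    rw [map_mul, map_mul, map_mul, map_mul, hf, mem_par.1 (gen_mem_par p i), map_smul, evalAt_gen,
      mem_par.1 (hX i)]
  | add f g hf hg => simp only [map_add, hf, hg]
  | smul c f hf => simp only [map_smul, hf]

theorem evalAt_mem {x : ZMod 2} {f : SPoly p} (hf : f ∈ par _ x) : evalAt X hX f ∈ par R x := by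
  rw [mem_par, J_evalAt, mem_par.1 hf, map_smul]

/-- The chain rule: a superderivation applied to a superpolynomial in elements `X i`. -/
theorem IsSDer.chain [Fintype ι] [DecidableEq ι] {δ : ZMod 2} {D : R →ₗ[ℝ] R} (hD : IsSDer δ D)
    (f : SPoly p) :
    D (evalAt X hX f) = ∑ i, D (X i) * evalAt X hX (pderiv p i f) := by
  induction f using spoly_induction with
  | one => simp [hD.map_one, pderiv_one]
  | mul j f hf =>
    simp only [map_mul, evalAt_gen, hD.leibniz, hf, pderiv_gen_mul, map_add, map_smul, mul_add,
      Finset.sum_add_distrib]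
    congr 1
    · simp
    · rw [Finset.mul_sum]
      refine Finset.sum_congr rfl fun i _ => ?_
      rw [Jp_of_mem _ (hX j), mul_smul_comm, smul_mul_assoc, ← mul_assoc, ← mul_assoc,
        mul_comm_of_mem (hX j) (hD.mem (hX i)), smul_mul_assoc, sgn_smul_sgn_smul]
      congr 2
      linear_combination (δ * p j) * two_eq_zero
  | add f g hf hg => rw [map_add, map_add, hf, hg, ← Finset.sum_add_distrib]; simp only [map_add, mul_add]
  | smul c f hf => rw [map_smul, map_smul, hf, Finset.smul_sum]; simp only [map_smul, mul_smul_comm]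

theorem map_evalAt {R' : Type*} [Ring R'] [Algebra ℝ R'] [SuperAlg R'] (F : R →ₐ[ℝ] R')
    {X' : ι → R'} (hX' : ∀ i, X' i ∈ par R' (p i)) (h : ∀ i, F (X i) = X' i) (f : SPoly p) :
    F (evalAt X hX f) = evalAt X' hX' f := by
  have : F.comp (evalAt X hX) = evalAt X' hX' := spoly_algHom_ext p fun i => by simp [h]
  rw [← this]
  rfl

end ChainRule
end DualConstruction

namespace DualConstruction
open SuperAlg (J)
open scoped TensorProduct

/-! ### Vector fields on superspaces and their divergence -/

section VectorField
variable {ι : Type*} [Fintype ι] [DecidableEq ι] (p : ι → ZMod 2)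

/-- The vector field `∑ c u ∂_u`, acting on superfunctions. -/
def vfield (c : ι → SPoly p) : SPoly p →ₗ[ℝ] SPoly p :=
  ∑ u, LinearMap.mulLeft ℝ (c u) ∘ₗ pderiv p u

theorem vfield_apply (c : ι → SPoly p) (f : SPoly p) :
    vfield p c f = ∑ u, c u * pderiv p u f := by
  simp [vfield]

@[simp] theorem vfield_gen (c : ι → SPoly p) (u : ι) : vfield p c (gen p u) = c u := by
  simp [vfield_apply]

variable {p} in
theorem isSDer_vfield {δ : ZMod 2} {c : ι → SPoly p} (hc : ∀ u, c u ∈ par _ (δ + p u)) :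
    IsSDer δ (vfield p c) :=
  IsSDer.sum fun u _ => (isSDer_pderiv p u).mulLeft (hc u)

/-- The Schwinger-Dyson equations of the quadratic function `σ`: integrals of total derivatives
of `f e^{-σ}` vanish. -/
def SchwingerDyson {p : ι → ZMod 2} {M : Type*} [AddCommGroup M] [Module ℝ M] (σ : SPoly p)
    (E : SPoly p →ₗ[ℝ] M) : Prop :=
  ∀ u f, E (pderiv p u f) = E (pderiv p u σ * f)

variable {p} in
/-- A divergence-free vector field preserving `σ` has vanishing mean values. -/
theorem SchwingerDyson.vfield_eq_zero {σ : SPoly p} {E : SPoly p →ₗ[ℝ] ℝ}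
    (hE : SchwingerDyson σ E) (hσ : σ ∈ par _ 0) {δ : ZMod 2} {c : ι → SPoly p}
    (hc : ∀ u, c u ∈ par _ (δ + p u)) (hcσ : vfield p c σ = 0)
    (hdiv : ∑ u, sgn (p u * (δ + p u)) • pderiv p u (c u) = 0) (f : SPoly p) :
    E (vfield p c f) = 0 := by
  have key : ∀ u, E (c u * pderiv p u f) = E (c u * pderiv p u σ * f) -
      E (sgn (p u * (δ + p u)) • pderiv p u (c u) * f) := by
    intro u
    have h1 := hE u (c u * f)
    rw [(isSDer_pderiv p u).leibniz, Jp_of_mem _ (hc u), ← mul_assoc,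
      mul_comm_of_mem ((isSDer_pderiv p u).mem hσ) (hc u), map_add, add_zero] at h1
    simp only [smul_mul_assoc, map_smul, smul_eq_mul] at h1 ⊢
    have h2 := sgn_self_mul (p u * (δ + p u))
    linear_combination sgn (p u * (δ + p u)) * h1 -
      (E (c u * pderiv p u f) - E (c u * pderiv p u σ * f)) * h2
  rw [vfield_apply] at hcσ
  rw [vfield_apply, map_sum, Finset.sum_congr rfl fun u _ => key u, Finset.sum_sub_distrib,
    ← map_sum, ← map_sum, ← Finset.sum_mul, ← Finset.sum_mul, hcσ, hdiv]
  simp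

end VectorField

/-! ### Hamiltonian vector fields on the canonical symplectic superspace -/

section Hamiltonian
variable {n m : ℕ}

@[simp] theorem parV_inl (i : Fin n ⊕ Fin n) : parV n m (Sum.inl i) = 0 := rfl

@[simp] theorem parV_inr (i : Fin m) : parV n m (Sum.inr i) = 1 := rfl

/-- The coordinates of the Hamiltonian vector field of `h`. -/
def hamField : Coord n m → Ham n m →ₗ[ℝ] Ham n m
  | Sum.inl (Sum.inl i) => pderiv (parV n m) (cq i)
  | Sum.inl (Sum.inr i) => -pderiv (parV n m) (cp i)
  | Sum.inr i => pderiv (parV n m) (cx i) ∘ₗ (parityInv (parV n m)).toLinearMap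

theorem bracket_eq_sum (a b : Ham n m) :
    bracket a b = ∑ w, hamField w a * pderiv (parV n m) w b := by
  simp only [bracket, Fintype.sum_sum_type, hamField, sub_eq_add_neg, Finset.sum_add_distrib]
  congr 2
  exact Finset.sum_congr rfl fun i _ =>
    (neg_mul (pderiv (parV n m) (cp i) a) (pderiv (parV n m) (cq i) b)).symm

theorem hamField_mem {δ : ZMod 2} {h : Ham n m} (hh : h ∈ par _ δ) (w : Coord n m) :
    hamField w h ∈ par _ (δ + parV n m w) := by
  rcases w with (i | i) | i
  · have h1 := (isSDer_pderiv (parV n m) (cq i)).mem hh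
    rwa [add_comm] at h1
  · have h1 := (isSDer_pderiv (parV n m) (cp i)).mem hh
    rw [add_comm] at h1
    exact Submodule.neg_mem _ h1
  · have h1 := (isSDer_pderiv (parV n m) (cx i)).mem hh
    have h2 : hamField (cx i) h = sgn δ • pderiv (parV n m) (cx i) h := by
      simp only [hamField, LinearMap.comp_apply, AlgHom.toLinearMap_apply]
      rw [← J_spoly, mem_par.1 hh, map_smul]
    rw [h2, add_comm]
    exact Submodule.smul_mem _ _ h1

/-- The Hamiltonians without constant and linear terms. -/
def hamTwo (n m : ℕ) : Submodule ℝ (Ham n m) := ⨆ k : ℕ, homogDeg (parV n m) (k + 2)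

theorem gTilde_le_hamTwo : gTilde n m ≤ hamTwo n m :=
  iSup_le fun k => le_iSup (fun k : ℕ => homogDeg (parV n m) (k + 2)) (k + 1)

theorem osp_le_hamTwo : osp n m ≤ hamTwo n m :=
  le_iSup (fun k : ℕ => homogDeg (parV n m) (k + 2)) 0

theorem hamField_mem_homogDeg {k : ℕ} {h : Ham n m} (hh : h ∈ homogDeg (parV n m) (k + 1))
    (w : Coord n m) : hamField w h ∈ homogDeg (parV n m) k := by
  rcases w with (i | i) | i
  · exact pderiv_mem _ _ _ hh
  · exact Submodule.neg_mem _ (pderiv_mem _ _ _ hh)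
  · exact pderiv_mem _ _ _ (parityInv_mem _ _ hh)

/-- Exchanging the roles of two Hamiltonians in the pairing of a Hamiltonian vector field with a
differential. -/
theorem sum_hamField_swap {R : Type*} [Ring R] [Algebra ℝ R] [SuperAlg R]
    (F : Ham n m →ₐ[ℝ] R) (hF : ∀ {x f}, f ∈ par _ x → F f ∈ par R x) {Q : R →ₗ[ℝ] R}
    (hQ : ∀ {x f}, f ∈ par R x → Q f ∈ par R x) {γ φ : ZMod 2} {g f : Ham n m}
    (hg : g ∈ par _ γ) (hf : f ∈ par _ φ) :
    ∑ w, Q (F (hamField w f)) * F (pderiv (parV n m) w g) =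
      -sgn (γ * φ) • ∑ w, F (hamField w g) * Q (F (pderiv (parV n m) w f)) := by
  have hd : ∀ {x f} (w : Coord n m), f ∈ par _ x →
      F (pderiv (parV n m) w f) ∈ par R (parV n m w + x) :=
    fun w hf => hF ((isSDer_pderiv _ w).mem hf)
  rw [Fintype.sum_sum_type, Fintype.sum_sum_type, Fintype.sum_sum_type, Fintype.sum_sum_type,
    smul_add, smul_add, add_comm (-sgn (γ * φ) • _) (-sgn (γ * φ) • _), Finset.smul_sum,
    Finset.smul_sum, Finset.smul_sum]
  congr 1
  · congr 1
    · refine Finset.sum_congr rfl fun i _ => ?_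
      have h := mul_comm_of_mem (hQ (hd (cq i) hf)) (hd (cp i) hg)
      simp only [hamField, LinearMap.neg_apply, map_neg, neg_mul, neg_smul, smul_neg, neg_neg]
      refine h.trans ?_
      simp only [parV_inl, zero_add, mul_comm φ]
    · refine Finset.sum_congr rfl fun i _ => ?_
      have h := mul_comm_of_mem (hQ (hd (cp i) hf)) (hd (cq i) hg)
      simp only [hamField, LinearMap.neg_apply, map_neg, neg_mul, neg_smul]
      rw [h]
      simp only [parV_inl, zero_add, mul_comm φ]
  · refine Finset.sum_congr rfl fun i _ => ?_
    have h := mul_comm_of_mem (hQ (hd (cx i) hf)) (hd (cx i) hg)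
    simp only [hamField, LinearMap.comp_apply, AlgHom.toLinearMap_apply]
    rw [← J_spoly, ← J_spoly, mem_par.1 hf, mem_par.1 hg]
    simp only [map_smul, smul_mul_assoc]
    rw [h, smul_smul, smul_smul]
    congr 1
    have : sgn φ * sgn ((parV n m (cx i) + φ) * (parV n m (cx i) + γ)) =
        sgn 1 * (sgn (γ * φ) * sgn γ) := by
      rw [← sgn_add, ← sgn_add, ← sgn_add]
      congr 1
      simp only [parV_inr]
      linear_combination φ * two_eq_zero
    rw [this, sgn_one]
    ring

end Hamiltonian
end DualConstruction

namespace DualConstruction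
open SuperAlg (J)
open scoped TensorProduct

/-! ### Superfields -/

/-- The algebraic data of a gauge in a contractible algebra: a supercommutative algebra `B` with
odd trace `τ`, augmentation `ε` and differential `d`, and a homogeneous basis `e` of a Lagrangian
subspace whose complement `d B` is Lagrangian; `π` are the coordinates, with respect to `e`, of
the projection along the complement. -/
structure GaugeData (B : Type*) [Ring B] [Algebra ℝ B] [SuperAlg B] {r : ℕ}
    (q : Fin r → ZMod 2) where
  e : Fin r → B
  e_mem : ∀ a, e a ∈ par B (q a)
  τ : B →ₗ[ℝ] ℝ
  τ_odd : FunParity 1 τ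
  ε : B →ₗ[ℝ] ℝ
  ε_even : FunParity 0 ε
  ε_mul : ∀ a b, ε (a * b) = ε a * ε b
  ε_e : ∀ a, ε (e a) = 0
  d : B →ₗ[ℝ] B
  d_der : IsSDer 1 d
  τ_d : ∀ a, τ (d a) = 0
  ε_d : ∀ a, ε (d a) = 0
  π : Fin r → B →ₗ[ℝ] ℝ
  π_par : ∀ a, FunParity (q a) (π a)
  π_d : ∀ a b, π a (d b) = 0
  π_e : ∀ a b, π a (e b) = if a = b then 1 else 0
  lagrangian : ∀ a b, τ ((∑ c, π c a • e c) * b) + τ (a * ∑ c, π c b • e c) =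
    τ (a * b) - ε a * τ b - τ a * ε b

namespace GaugeData
open FrobeniusDGA (parLV)

variable {B : Type*} [Ring B] [Algebra ℝ B] [SuperAlg B] {r : ℕ} {q : Fin r → ZMod 2}
  (G : GaugeData B q) {n m : ℕ}

/-- The projection onto the Lagrangian subspace. -/
def P : B →ₗ[ℝ] B := ∑ c, (G.π c).smulRight (G.e c)

theorem P_apply (b : B) : G.P b = ∑ c, G.π c b • G.e c := by simp [P]

theorem P_even : MapParity 0 G.P := fun b => by
  simp only [P_apply, map_sum, map_smul, sgn_zero, one_smul]
  refine Finset.sum_congr rfl fun c _ => ?_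
  rw [mem_par.1 (G.e_mem c), G.π_par, smul_smul, mul_comm]

/-- The superalgebra of superfields. -/
abbrev Field (_ : GaugeData B q) (n m : ℕ) : Type _ := STensor B (SPoly (parLV n m q))

/-- The generic point of `L ⊗ V`, as a family of superfields. -/
def X (w : Coord n m) : G.Field n m := ∑ a, tm (G.e a) (gen (parLV n m q) (a, w))

theorem X_mem (w : Coord n m) : G.X w ∈ par _ (parV n m w) := by
  refine Submodule.sum_mem _ fun a _ => ?_
  have h := tm_mem_par (G.e_mem a) (gen_mem_par (parLV n m q) (a, w))
  rwa [show q a + parLV n m q (a, w) = parV n m w by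
    simp only [FrobeniusDGA.parLV]
    linear_combination q a * two_eq_zero] at h

/-- Evaluation of a Hamiltonian at the generic point. -/
def ev : Ham n m →ₐ[ℝ] G.Field n m := evalAt G.X G.X_mem

@[simp] theorem ev_gen (w : Coord n m) : G.ev (gen _ w) = G.X w := evalAt_gen _ _

theorem ev_mem {x : ZMod 2} {f : Ham n m} (hf : f ∈ par _ x) : G.ev f ∈ par _ x :=
  evalAt_mem _ hf

theorem ev_pderiv_mem {x : ZMod 2} {f : Ham n m} (hf : f ∈ par _ x) (w : Coord n m) :
    G.ev (pderiv (parV n m) w f) ∈ par _ (parV n m w + x) :=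
  G.ev_mem ((isSDer_pderiv _ w).mem hf)

/-- The map `Ψ`: the trace of the value of a Hamiltonian at the generic point. -/
def psi : Ham n m →ₗ[ℝ] SPoly (parLV n m q) := slice G.τ ∘ₗ G.ev.toLinearMap

theorem psi_apply (f : Ham n m) : G.psi f = slice G.τ (G.ev f) := rfl

theorem psi_mem {x : ZMod 2} {f : Ham n m} (hf : f ∈ par _ x) : G.psi f ∈ par _ (x + 1) := by
  rw [add_comm]
  exact slice_mem G.τ_odd (G.ev_mem hf)

/-- The coefficients of the vector field `ham`. -/
def hamCoeff (δ : ZMod 2) (h : Ham n m) (u : Fin r × Coord n m) : SPoly (parLV n m q) :=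
  sgn (δ * q u.1) • slice (G.π u.1) (G.ev (hamField u.2 h))

theorem hamCoeff_mem {δ : ZMod 2} {h : Ham n m} (hh : h ∈ par _ δ) (u : Fin r × Coord n m) :
    G.hamCoeff δ h u ∈ par _ (δ + parLV n m q u) := by
  refine Submodule.smul_mem _ _ ?_
  have h1 := slice_mem (G.π_par u.1) (G.ev_mem (hamField_mem hh u.2))
  rwa [show q u.1 + (δ + parV n m u.2) = δ + parLV n m q u by
    simp only [FrobeniusDGA.parLV]; ring] at h1

/-- The vector field on `L ⊗ V` whose value at a point is the projection to `L ⊗ V` of the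
Hamiltonian vector field of `h`, for `h` of parity `δ`. -/
def ham (δ : ZMod 2) (h : Ham n m) : SPoly (parLV n m q) →ₗ[ℝ] SPoly (parLV n m q) :=
  vfield _ (G.hamCoeff δ h)

theorem isSDer_ham {δ : ZMod 2} {h : Ham n m} (hh : h ∈ par _ δ) : IsSDer δ (G.ham δ h) :=
  isSDer_vfield (G.hamCoeff_mem hh)

/-- The projection of a superfield to `L`, expanded in the basis `e`. -/
theorem lmap_P (y : G.Field n m) : lmap G.P y = ∑ a, tm (G.e a) (slice (G.π a) y) := by
  induction y using tensor_induction with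
  | add x y hx hy => simp only [map_add, hx, hy, tm_add, Finset.sum_add_distrib]
  | tm β ς b hb s hs =>
    simp only [tmap_tm, LinearMap.id_apply, slice_tm, P_apply, tm_smul]
    rw [← Finset.sum_congr rfl fun a _ => smul_tm (G.π a b) (G.e a) s]
    exact map_sum (AddMonoidHom.mk' (fun b => tm b s) fun b b' => add_tm b b' s) _ _

/-- The vector field `ham` moves the generic point by the projection of the Hamiltonian vector
field of `h`. -/
theorem extDer_ham_X (δ : ZMod 2) (h : Ham n m) (w : Coord n m) :
    extDer δ (G.ham δ h) (G.X w) = lmap G.P (G.ev (hamField w h)) := by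
  rw [X, map_sum, lmap_P]
  refine Finset.sum_congr rfl fun a _ => ?_
  rw [extDer_tm _ _ (G.e_mem a), ham, vfield_gen, hamCoeff, tm_smul, sgn_smul_self_smul]

/-- The derivative of `Ψ(f)` along the projected Hamiltonian vector field of `h`: only the
projection of the Hamiltonian vector field of `h` is paired with the derivatives of `f`. -/
theorem ham_psi {δ : ZMod 2} {h : Ham n m} (hh : h ∈ par _ δ) (f : Ham n m) :
    G.ham δ h (G.psi f) = sgn δ • slice G.τ
      (∑ w, lmap G.P (G.ev (hamField w h)) * G.ev (pderiv (parV n m) w f)) := by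
  have h1 := slice_extDer G.τ_odd δ (G.ham δ h) (G.ev f)
  rw [ev, (G.isSDer_ham hh).extDer.chain, mul_one] at h1
  rw [psi_apply, ev, ← sgn_smul_self_smul δ (G.ham δ h _), ← h1]
  simp only [extDer_ham_X]
  rfl

/-- A function without constant term has values in the augmentation ideal at the generic point. -/
theorem slice_ε_ev {k : ℕ} {f : Ham n m} (hf : f ∈ homogDeg (parV n m) (k + 1)) :
    slice G.ε (G.ev f) = 0 := by
  suffices h : homogDeg (parV n m) (k + 1) ≤ LinearMap.ker (slice G.ε ∘ₗ G.ev.toLinearMap) from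
    h hf
  refine homogDeg_succ_le _ k fun w f _ => ?_
  rw [LinearMap.mem_ker, LinearMap.comp_apply, AlgHom.toLinearMap_apply, map_mul,
    slice_mul_of_slice_left G.ε_even G.ε_mul, ev_gen, X, map_sum,
    Finset.sum_eq_zero fun a _ => by rw [slice_tm, G.ε_e, zero_smul], zero_mul]

theorem slice_ε_ev_pderiv {f : Ham n m} (hf : f ∈ hamTwo n m) (w : Coord n m) :
    slice G.ε (G.ev (pderiv (parV n m) w f)) = 0 := by
  suffices h : hamTwo n m ≤ LinearMap.ker (slice G.ε ∘ₗ G.ev.toLinearMap ∘ₗ pderiv (parV n m) w)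
    from h hf
  exact iSup_le fun k f hf => G.slice_ε_ev (pderiv_mem _ w _ hf)

theorem slice_ε_ev_hamField {f : Ham n m} (hf : f ∈ hamTwo n m) (w : Coord n m) :
    slice G.ε (G.ev (hamField w f)) = 0 := by
  suffices h : hamTwo n m ≤ LinearMap.ker (slice G.ε ∘ₗ G.ev.toLinearMap ∘ₗ hamField w)
    from h hf
  exact iSup_le fun k f hf => G.slice_ε_ev (hamField_mem_homogDeg hf w)

/-- `P` and its complement are adjoint, since both the subspace and its complement are
isotropic. -/
theorem slice_P_add {x y : G.Field n m} (hx : slice G.ε x = 0) (hy : slice G.ε y = 0) :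
    slice G.τ (lmap G.P x * y) + slice G.τ (x * lmap G.P y) = slice G.τ (x * y) := by
  have h := slice_mul_proj G.P_even G.τ_odd
    (fun a b => by simp only [P_apply]; exact G.lagrangian a b) G.ε_even x y
  rw [h, hx, hy]
  simp

/-- The projected Hamiltonian vector fields represent the bracket on the functions `Ψ`. -/
theorem ham_psi_add {γ φ : ZMod 2} {g f : Ham n m} (hg : g ∈ par _ γ) (hf : f ∈ par _ φ)
    (hg2 : g ∈ hamTwo n m) (hf2 : f ∈ hamTwo n m) :
    G.ham γ g (G.psi f) + sgn ((γ + 1) * (φ + 1)) • G.ham φ f (G.psi g) =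
      sgn γ • G.psi (bracket g f) := by
  rw [G.ham_psi hg, G.ham_psi hf, sum_hamField_swap G.ev (fun h => G.ev_mem h)
    (fun h => by simpa using lmap_mem G.P_even h) hg hf, map_smul, smul_smul, smul_smul]
  have h1 : sgn ((γ + 1) * (φ + 1)) * sgn φ * -sgn (γ * φ) = sgn γ := by
    rw [show -sgn (γ * φ) = sgn 1 * sgn (γ * φ) by simp, ← sgn_add, ← sgn_add, ← sgn_add]
    congr 1
    linear_combination (γ * φ + φ + 1) * two_eq_zero
  rw [h1, ← smul_add, psi_apply, bracket_eq_sum]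
  congr 1
  simp only [map_sum, map_mul, ← Finset.sum_add_distrib]
  exact Finset.sum_congr rfl fun w _ =>
    G.slice_P_add (G.slice_ε_ev_hamField hg2 w) (G.slice_ε_ev_pderiv hf2 w)

theorem P_e (a : Fin r) : G.P (G.e a) = G.e a := by
  simp [P_apply, G.π_e]

theorem lmap_P_X (w : Coord n m) : lmap G.P (G.X w) = G.X w := by
  simp [X, P_e]

/-- The vector fields of quadratic Hamiltonians are tangent to `L ⊗ V`. -/
theorem ham_psi_osp {κ : ZMod 2} {k : Ham n m} (hk : k ∈ par _ κ) (hk2 : k ∈ osp n m)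
    (f : Ham n m) : G.ham κ k (G.psi f) = sgn κ • G.psi (bracket k f) := by
  have h1 : ∀ y ∈ homogDeg (parV n m) 1, lmap G.P (G.ev y) = G.ev y := by
    intro y hy
    suffices h : homogDeg (parV n m) (0 + 1) ≤
        LinearMap.eqLocus (lmap G.P ∘ₗ G.ev.toLinearMap) G.ev.toLinearMap from h hy
    refine homogDeg_succ_le _ 0 fun w f hf => ?_
    simp only [homogDeg, pow_zero, Submodule.mem_one] at hf
    obtain ⟨c, rfl⟩ := hf
    rw [Algebra.algebraMap_eq_smul_one, mul_smul_comm, mul_one]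
    refine Submodule.smul_mem _ _ ?_
    simp [LinearMap.mem_eqLocus, lmap_P_X]
  rw [G.ham_psi hk, psi_apply, bracket_eq_sum, map_sum G.ev]
  congr 2
  refine Finset.sum_congr rfl fun w _ => ?_
  rw [map_mul, h1 _ (hamField_mem_homogDeg hk2 w)]

end GaugeData
end DualConstruction

namespace DualConstruction
open SuperAlg (J)
open scoped TensorProduct
/-! ### Invariance of the Gaussian weight -/

namespace GaugeData
open FrobeniusDGA (parLV)

variable {B : Type*} [Ring B] [Algebra ℝ B] [SuperAlg B] {r : ℕ} {q : Fin r → ZMod 2}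
  (G : GaugeData B q) {n m : ℕ}

/-- The quadratic function on `L ⊗ V` given by the symplectic form of `V` and the bilinear form
`τ(a φ(b))` on `L`, for a map `φ` of parity `ε`. -/
def quad (φ : B →ₗ[ℝ] B) (ε : ZMod 2) (n m : ℕ) : SPoly (parLV n m q) :=
  (1 / 2 : ℝ) • (∑ i : Fin n, (slice G.τ (G.X (cp i) * lmap φ (G.X (cq i))) -
      slice G.τ (G.X (cq i) * lmap φ (G.X (cp i)))) -
    sgn ε • ∑ i : Fin m, slice G.τ ((G.X (cx i) : G.Field n m) * lmap φ (G.X (cx i))))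

theorem slice_X_mul_mem {φ : B →ₗ[ℝ] B} {ε : ZMod 2} (hφ : MapParity ε φ) {i j : Coord n m}
    (hij : parV n m i = parV n m j) :
    slice G.τ (G.X i * lmap φ (G.X j)) ∈ par _ (ε + 1) := by
  have h := slice_mem G.τ_odd (mul_mem_par (G.X_mem i) (lmap_mem hφ (G.X_mem j)))
  rwa [hij, show 1 + (parV n m j + (ε + parV n m j)) = ε + 1 by
    linear_combination parV n m j * two_eq_zero] at h

theorem quad_mem {φ : B →ₗ[ℝ] B} {ε : ZMod 2} (hφ : MapParity ε φ) :
    G.quad φ ε n m ∈ par _ (ε + 1) :=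
  Submodule.smul_mem _ _ (Submodule.sub_mem _
    (Submodule.sum_mem _ fun _ _ => Submodule.sub_mem _ (G.slice_X_mul_mem hφ rfl)
      (G.slice_X_mul_mem hφ rfl))
    (Submodule.smul_mem _ _ (Submodule.sum_mem _ fun _ _ => G.slice_X_mul_mem hφ rfl)))

/-- The complement of `L` is isotropic, so that the projection can be dropped in a pairing with an
operator into the complement. -/
theorem slice_lmap_P_mul {φ : B →ₗ[ℝ] B} (hPφ : ∀ b, G.P (φ b) = 0)
    (hεφ : ∀ b, G.ε (φ b) = 0) {y : G.Field n m} (hy : slice G.ε y = 0) (x : G.Field n m) :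
    slice G.τ (lmap G.P y * lmap φ x) = slice G.τ (y * lmap φ x) := by
  have h1 : lmap G.P (lmap φ x) = 0 := by
    induction x using tensor_induction with
    | add x y hx hy => rw [map_add, map_add, hx, hy, add_zero]
    | tm β ς b hb s hs => simp [hPφ]
  have h2 : slice G.ε (lmap φ x) = 0 := by
    clear h1
    induction x using tensor_induction with
    | add x y hx hy => rw [map_add, map_add, hx, hy, add_zero]
    | tm β ς b hb s hs => simp [hεφ]
  have h := G.slice_P_add hy h2
  rwa [h1, mul_zero, map_zero, add_zero] at h

section
variable {φ : B →ₗ[ℝ] B} {ε : ZMod 2} (hφ : MapParity ε φ)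
  (hadj : ∀ a b, G.τ (φ a * b) = -G.τ (Jp ε a * φ b))
include hφ hadj

/-- The derivative of a term of the quadratic function of `φ`: both factors are moved by the vector
field, and the skew-adjointness of `φ` brings the two contributions to the same shape. -/
theorem ham_slice_X {δ : ZMod 2} {h : Ham n m} (hh : h ∈ par _ δ) {i j : Coord n m}
    (hij : parV n m i = parV n m j) :
    G.ham δ h (slice G.τ (G.X i * lmap φ (G.X j))) = sgn δ •
      (slice G.τ (lmap G.P (G.ev (hamField i h)) * lmap φ (G.X j)) -
        sgn (parV n m i) • slice G.τ (lmap G.P (G.ev (hamField j h)) * lmap φ (G.X i))) := by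
  have h1 := slice_extDer G.τ_odd δ (G.ham δ h) (G.X i * lmap φ (G.X j))
  have hZ : lmap G.P (G.ev (hamField j h)) ∈ par _ (δ + parV n m j) := by
    simpa using lmap_mem G.P_even (G.ev_mem (hamField_mem hh j))
  rw [mul_one, (G.isSDer_ham hh).extDer.leibniz, lmap_extDer hφ, extDer_ham_X, extDer_ham_X,
    Jp_of_mem _ (G.X_mem i)] at h1
  rw [← sgn_smul_self_smul δ (G.ham δ h _), ← h1, map_add, sub_eq_add_neg]
  congr 2
  rw [smul_mul_smul_comm, map_smul]
  have h2 := slice_mul_lmap hφ hadj (G.X i) (lmap G.P (G.ev (hamField j h)))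
  rw [mul_comm_of_mem (lmap_mem hφ (G.X_mem i)) hZ, Jp_of_mem _ (G.X_mem i), smul_mul_assoc,
    map_smul, map_smul] at h2
  rw [← sgn_smul_self_smul (ε * parV n m i)
    (slice G.τ (G.X i * lmap φ (lmap G.P (G.ev (hamField j h))))), ← neg_eq_iff_eq_neg.2 h2,
    smul_neg, smul_neg, smul_smul, smul_smul]
  congr 2
  rw [← sgn_add, ← sgn_add, ← sgn_add, ← hij]
  congr 1
  have h3 : parV n m i * parV n m i = parV n m i := by
    rcases zmod2_cases (parV n m i) with h | h <;> rw [h] <;> rfl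
  linear_combination h3 + (δ * parV n m i + δ * ε + ε * parV n m i) * two_eq_zero

theorem ham_quad_aux {δ : ZMod 2} {h : Ham n m} (hh : h ∈ par _ δ) :
    G.ham δ h (G.quad φ ε n m) = sgn δ • (∑ i : Fin n,
      (slice G.τ (lmap G.P (G.ev (hamField (cp i) h)) * lmap φ (G.X (cq i))) -
        slice G.τ (lmap G.P (G.ev (hamField (cq i) h)) * lmap φ (G.X (cp i)))) -
      sgn ε • ∑ i : Fin m,
        slice G.τ (lmap G.P (G.ev (hamField (cx i) h)) * lmap φ (G.X (cx i)))) := by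
  simp only [quad, map_smul, map_sub, map_sum]
  rw [Finset.sum_congr rfl fun i _ => by
      rw [G.ham_slice_X hφ hadj hh (i := cp i) (j := cq i) rfl,
        G.ham_slice_X hφ hadj hh (i := cq i) (j := cp i) rfl],
    Finset.sum_congr rfl fun i _ => G.ham_slice_X hφ hadj hh (i := cx i) (j := cx i) rfl]
  simp only [parV_inl, parV_inr, sgn_zero, sgn_one, one_smul]
  rw [smul_sub, smul_sub, Finset.smul_sum, Finset.smul_sum, Finset.smul_sum, Finset.smul_sum,
    Finset.smul_sum, Finset.smul_sum]
  congr 1 <;> refine Finset.sum_congr rfl fun i _ => ?_ <;> module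

variable (hPφ : ∀ b, G.P (φ b) = 0) (hεφ : ∀ b, G.ε (φ b) = 0)
include hPφ hεφ

/-- The projected Hamiltonian vector field of `h` acts on the quadratic function of `φ` by the
variation of `Ψ(h)` along `φ`. -/
theorem ham_quad {δ : ZMod 2} {h : Ham n m} (hh : h ∈ par _ δ) (h2 : h ∈ hamTwo n m) :
    G.ham δ h (G.quad φ ε n m) = sgn (δ + δ * ε) •
      slice G.τ (∑ w, lmap φ (G.X w) * G.ev (pderiv (parV n m) w h)) := by
  rw [G.ham_quad_aux hφ hadj hh, sgn_add, mul_smul]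
  congr 1
  simp only [G.slice_lmap_P_mul hPφ hεφ (G.slice_ε_ev_hamField h2 _)]
  have hc : ∀ w, lmap φ (G.X w) * G.ev (pderiv (parV n m) w h) =
      sgn ((ε + parV n m w) * (parV n m w + δ)) •
        (G.ev (pderiv (parV n m) w h) * lmap φ (G.X w)) :=
    fun w => mul_comm_of_mem (lmap_mem hφ (G.X_mem w)) (G.ev_pderiv_mem hh w)
  simp only [hc]
  rw [map_sum, Fintype.sum_sum_type, Fintype.sum_sum_type, smul_add, Finset.sum_sub_distrib,
    sub_eq_add_neg (∑ i : Fin n, _), add_comm (∑ i : Fin n, _), sub_eq_add_neg]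
  congr 1
  · rw [smul_add, Finset.smul_sum, Finset.smul_sum, ← Finset.sum_neg_distrib]
    congr 1 <;> refine Finset.sum_congr rfl fun i _ => ?_
    · simp only [parV_inl, hamField, map_smul, smul_smul, ← sgn_add]
      rw [show δ * ε + (ε + 0) * (0 + δ) = 0 by linear_combination (δ * ε) * two_eq_zero]
      simp
    · simp only [parV_inl, hamField, map_smul, smul_smul, ← sgn_add]
      rw [show δ * ε + (ε + 0) * (0 + δ) = 0 by linear_combination (δ * ε) * two_eq_zero]
      simp
  · rw [Finset.smul_sum, Finset.smul_sum, ← Finset.sum_neg_distrib]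
    refine Finset.sum_congr rfl fun i _ => ?_
    simp only [parV_inr, hamField, LinearMap.comp_apply, AlgHom.toLinearMap_apply]
    rw [← J_spoly, mem_par.1 hh]
    simp only [map_smul, smul_mul_assoc, smul_smul]
    rw [← neg_smul]
    congr 1
    rw [← sgn_add, ← sgn_add, show δ * ε + (ε + 1) * (1 + δ) = 1 + (ε + δ) by
      linear_combination (δ * ε) * two_eq_zero, sgn_add 1, sgn_one]
    ring

end

theorem P_d (b : B) : G.P (G.d b) = 0 := by
  simp [P_apply, G.π_d]

/-- The differential is skew-adjoint, since the trace vanishes on boundaries. -/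
theorem τ_d_mul (a b : B) : G.τ (G.d a * b) = -G.τ (Jp 1 a * G.d b) := by
  have h := G.τ_d (a * b)
  rw [G.d_der.leibniz, map_add] at h
  linarith

/-- The quadratic function `σ` is preserved by the projected Hamiltonian vector fields. -/
theorem ham_quad_d {δ : ZMod 2} {h : Ham n m} (hh : h ∈ par _ δ) (h2 : h ∈ hamTwo n m) :
    G.ham δ h (G.quad G.d 1 n m) = 0 := by
  rw [G.ham_quad (fun b => G.d_der.parity b) G.τ_d_mul G.P_d G.ε_d hh h2]
  have h1 : lmap G.d (G.ev h) = ∑ w, lmap G.d (G.X w) * G.ev (pderiv (parV n m) w h) :=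
    (IsSDer.lmap G.d_der).chain G.X_mem h
  rw [← h1]
  have h3 : ∀ x : G.Field n m, slice G.τ (lmap G.d x) = 0 := by
    intro x
    induction x using tensor_induction with
    | add x y hx hy => rw [map_add, map_add, hx, hy, add_zero]
    | tm β ς b hb s hs => simp [G.τ_d]
  rw [h3, smul_zero]

theorem extDer_pderiv_X (a : Fin r) (w w' : Coord n m) :
    extDer (parLV n m q (a, w)) (pderiv _ (a, w)) (G.X w') =
      if w' = w then sgn (parLV n m q (a, w) * q a) • tm (G.e a) 1 else 0 := by
  rw [X, map_sum, Finset.sum_eq_single a]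
  · rw [extDer_tm _ _ (G.e_mem _), pderiv_gen]
    by_cases h : w' = w
    · rw [if_pos h, if_pos (by rw [h])]
    · rw [if_neg h, if_neg fun h' => h (Prod.ext_iff.1 h').2.symm, tm_zero, smul_zero]
  · intro b _ hb
    rw [extDer_tm _ _ (G.e_mem b), pderiv_gen, if_neg fun h' => hb (Prod.ext_iff.1 h').1.symm,
      tm_zero, smul_zero]
  · simp

/-- The chain rule for the diagonal derivatives of the coefficients of `ham`, whose sum is the
divergence. -/
theorem pderiv_hamCoeff (δ : ZMod 2) (h : Ham n m) (a : Fin r) (w : Coord n m) :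
    pderiv _ (a, w) (G.hamCoeff δ h (a, w)) = sgn (δ * q a) •
      slice (G.π a) (tm (G.e a) 1 * G.ev (pderiv _ w (hamField w h))) := by
  have h1 := slice_extDer (G.π_par a) (parLV n m q (a, w)) (pderiv _ (a, w))
    (G.ev (hamField w h))
  rw [ev, (isSDer_pderiv (parLV n m q) (a, w)).extDer.chain] at h1
  simp only [extDer_pderiv_X] at h1
  rw [Finset.sum_eq_single w (fun w' _ hw => by rw [if_neg hw, zero_mul]) (by simp), if_pos rfl,
    smul_mul_assoc, map_smul] at h1
  have h2 := smul_right_injective _ (sgn_ne_zero _) h1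
  rw [hamCoeff, map_smul, ev, h2]

/-- The projected Hamiltonian vector fields are divergence-free: second derivatives of the
Hamiltonian are contracted with the symplectic form. -/
theorem div_ham (δ : ZMod 2) (h : Ham n m) :
    ∑ u, sgn (parLV n m q u * (δ + parLV n m q u)) •
      pderiv _ u (G.hamCoeff δ h u) = 0 := by
  rw [Fintype.sum_prod_type]
  refine Finset.sum_eq_zero fun a _ => ?_
  simp only [pderiv_hamCoeff]
  rw [Fintype.sum_sum_type, Fintype.sum_sum_type, ← Finset.sum_add_distrib,
    Finset.sum_eq_zero, Finset.sum_eq_zero, add_zero]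
  · intro i _
    have h1 : pderiv (parV n m) (cx i) (hamField (cx i) h) = 0 := by
      have h2 := pderiv_pderiv_comm (parV n m) (cx i) (cx i) (parityInv _ h)
      rw [parV_inr, mul_one, sgn_one] at h2
      change pderiv (parV n m) (cx i) (pderiv (parV n m) (cx i) (parityInv _ h)) = 0
      generalize pderiv (parV n m) (cx i) (pderiv (parV n m) (cx i) (parityInv _ h)) = y at h2 ⊢
      calc y = (1 / 2 : ℝ) • (y - (-1 : ℝ) • y) := by module
        _ = 0 := by rw [← h2, sub_self, smul_zero]
    rw [h1]
    simp
  · intro i _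
    have h1 := pderiv_pderiv_comm (parV n m) (cp i) (cq i) h
    rw [parV_inl, zero_mul, sgn_zero, one_smul] at h1
    simp only [hamField, FrobeniusDGA.parLV, parV_inl, LinearMap.neg_apply, map_neg]
    rw [h1, mul_neg, map_neg, smul_neg, smul_neg, add_neg_cancel]

/-- Mean values of the projected Hamiltonian vector fields vanish. -/
theorem expectation_ham {E : SPoly (parLV n m q) →ₗ[ℝ] ℝ}
    (hE : SchwingerDyson (G.quad G.d 1 n m) E) {δ : ZMod 2} {h : Ham n m} (hh : h ∈ par _ δ)
    (h2 : h ∈ hamTwo n m) (f : SPoly (parLV n m q)) : E (G.ham δ h f) = 0 := by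
  refine hE.vfield_eq_zero ?_ (G.hamCoeff_mem hh) (G.ham_quad_d hh h2) (G.div_ham δ h) f
  have h := G.quad_mem (n := n) (m := m) (ε := 1) (fun b => G.d_der.parity b)
  rwa [show (1 : ZMod 2) + 1 = 0 from rfl] at h

end GaugeData
end DualConstruction

namespace DualConstruction
open SuperAlg (J)

/-! ### Schwinger-Dyson equations determine Gaussian expectations -/

section Uniqueness
variable {ι : Type*} {p : ι → ZMod 2}

/-- Every superpolynomial is a sum of homogeneous ones. -/
theorem iSup_homogDeg : ⨆ k, homogDeg p k = ⊤ := by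
  suffices h : ∀ f : SPoly p, f ∈ ⨆ k, homogDeg p k from eq_top_iff.2 fun f _ => h f
  intro f
  induction f using spoly_induction with
  | one =>
    refine Submodule.mem_iSup_of_mem 0 ?_
    simp only [homogDeg, pow_zero]
    exact Submodule.one_le.1 le_rfl
  | mul i f hf =>
    induction hf using Submodule.iSup_induction' with
    | mem k f hf => exact Submodule.mem_iSup_of_mem (k + 1) (gen_mul_mem p i hf)
    | zero => simp
    | add f g _ _ hf hg => rw [mul_add]; exact Submodule.add_mem _ hf hg
  | add f g hf hg => exact Submodule.add_mem _ hf hg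
  | smul c f hf => exact Submodule.smul_mem _ _ hf

variable [DecidableEq ι]

theorem pderiv_homogDeg_zero (u : ι) {f : SPoly p} (hf : f ∈ homogDeg p 0) :
    pderiv p u f = 0 := by
  simp only [homogDeg, pow_zero, Submodule.mem_one] at hf
  obtain ⟨c, rfl⟩ := hf
  rw [Algebra.algebraMap_eq_smul_one, map_smul, pderiv_one, smul_zero]

variable [Fintype ι]

/-- A quadratic function is nondegenerate if its derivatives span the coordinates. -/
def Nondeg (σ : SPoly p) : Prop :=
  ∃ H : ι → ι → ℝ, ∀ v, gen p v = ∑ u, H v u • pderiv p u σ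

/-- The Schwinger-Dyson equations of a nondegenerate quadratic function reduce every mean value
to that of `1`. -/
theorem SchwingerDyson.eq_zero {M : Type*} [AddCommGroup M] [Module ℝ M] {σ : SPoly p}
    (hσ : Nondeg σ) {E : SPoly p →ₗ[ℝ] M} (hE : SchwingerDyson σ E) (h1 : E 1 = 0) : E = 0 := by
  obtain ⟨H, hH⟩ := hσ
  have key : ∀ k, ∀ f ∈ homogDeg p k, E f = 0 := by
    intro k
    induction k using Nat.strong_induction_on with
    | _ k ih =>
      have step : ∀ v f, (∀ u, E (pderiv p u f) = 0) → E (gen p v * f) = 0 := by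
        intro v f hf
        rw [hH, Finset.sum_mul, map_sum]
        refine Finset.sum_eq_zero fun u _ => ?_
        rw [smul_mul_assoc, map_smul, ← hE, hf, smul_zero]
      rcases k with _ | k
      · intro f hf
        simp only [homogDeg, pow_zero, Submodule.mem_one] at hf
        obtain ⟨c, rfl⟩ := hf
        rw [Algebra.algebraMap_eq_smul_one, map_smul, h1, smul_zero]
      · suffices h : homogDeg p (k + 1) ≤ LinearMap.ker E from fun f hf => h hf
        refine homogDeg_succ_le p k fun v f hf => step v f fun u => ?_
        rcases k with _ | k
        · rw [pderiv_homogDeg_zero u hf, map_zero]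
        · exact ih k (by omega) _ (pderiv_mem p u k hf)
  have h2 : (⊤ : Submodule ℝ (SPoly p)) ≤ LinearMap.ker E := by
    rw [← iSup_homogDeg]
    exact iSup_le fun k f hf => key k f hf
  exact LinearMap.ext fun f => h2 trivial

end Uniqueness

/-! ### Superintegrals in standard coordinates -/

namespace LinCoords
variable {ι : Type*} [Fintype ι] [DecidableEq ι] {p : ι → ZMod 2} (C : LinCoords p)

theorem subst_gen (j : ι) : C.subst (gen p j) = ∑ k, C.M j k • gen (parC C.a C.b C.s) k :=
  sLift_gen _ _ _ _

/-- The change of coordinates mixes only coordinates of equal parity. -/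
theorem N_even (k : (Fin C.a ⊕ Fin C.b) ⊕ Fin C.s) (u : ι) (h : C.N k u ≠ 0) :
    p u = parC C.a C.b C.s k := by
  have h1 : Matrix.diagonal (fun j => sgn (p j)) * C.M =
      C.M * Matrix.diagonal fun k => sgn (parC C.a C.b C.s k) := by
    ext j k
    rw [Matrix.diagonal_mul, Matrix.mul_diagonal]
    by_cases hM : C.M j k = 0
    · simp [hM]
    · rw [C.even j k hM, mul_comm]
  have h2 : C.N * Matrix.diagonal (fun j => sgn (p j)) =
      Matrix.diagonal (fun k => sgn (parC C.a C.b C.s k)) * C.N := by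
    calc C.N * Matrix.diagonal (fun j => sgn (p j))
        = C.N * (Matrix.diagonal (fun j => sgn (p j)) * C.M) * C.N := by
          rw [Matrix.mul_assoc, Matrix.mul_assoc, C.mul_inv, Matrix.mul_one]
      _ = _ := by rw [h1, ← Matrix.mul_assoc, C.inv_mul, Matrix.one_mul]
  have h3 := congrFun (congrFun h2 k) u
  rw [Matrix.diagonal_mul, Matrix.mul_diagonal, mul_comm] at h3
  have h4 := mul_right_cancel₀ h h3
  rcases zmod2_cases (p u) with h5 | h5 <;>
    rcases zmod2_cases (parC C.a C.b C.s k) with h6 | h6 <;> rw [h5, h6] at h4 ⊢ <;>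
    norm_num [sgn] at h4

/-- Partial derivatives transform by the inverse matrix under a linear change of coordinates. -/
theorem subst_pderiv (u : ι) (f : SPoly p) :
    C.subst (pderiv p u f) = ∑ k, C.N k u • pderiv _ k (C.subst f) := by
  induction f using spoly_induction with
  | one => simp [pderiv_one]
  | mul j f hf =>
    rw [pderiv_gen_mul, map_add, map_smul, map_smul, map_mul, map_mul, subst_gen]
    have h1 : ∀ k, C.N k u • pderiv (parC C.a C.b C.s) k
        ((∑ l, C.M j l • gen _ l) * C.subst f) =
        (C.N k u * C.M j k) • C.subst f + sgn (p u * p j) •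
          ((∑ l, C.M j l • gen _ l) * (C.N k u • pderiv _ k (C.subst f))) := by
      intro k
      rw [Finset.sum_mul, map_sum, Finset.sum_mul]
      simp only [smul_mul_assoc, map_smul, pderiv_gen_mul, smul_add, Finset.sum_add_distrib]
      congr 1
      · rw [Finset.sum_eq_single k, if_pos rfl, one_smul, smul_smul]
        · intro l _ hl
          rw [if_neg hl.symm, zero_smul, smul_zero]
        · simp
      · rw [Finset.smul_sum, Finset.smul_sum]
        refine Finset.sum_congr rfl fun l _ => ?_
        by_cases hN : C.N k u = 0
        · simp [hN]
        by_cases hM : C.M j l = 0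
        · simp [hM]
        rw [C.N_even k u hN, C.even j l hM, mul_smul_comm]
        match_scalars
        ring
    rw [Finset.sum_congr rfl fun k _ => h1 k, Finset.sum_add_distrib, ← Finset.sum_smul,
      ← Finset.smul_sum, ← Finset.mul_sum, ← hf]
    congr 2
    have h2 := congrFun (congrFun C.mul_inv j) u
    rw [Matrix.mul_apply, Matrix.one_apply] at h2
    rw [Finset.sum_congr rfl fun k _ => mul_comm (C.N k u) _, h2]
    simp only [eq_comm]
  | add f g hf hg => simp only [map_add, hf, hg, smul_add, Finset.sum_add_distrib]
  | smul c f hf =>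
    rw [map_smul, map_smul, hf, Finset.smul_sum, map_smul]
    refine Finset.sum_congr rfl fun k _ => ?_
    rw [map_smul, smul_comm]

theorem subst_surjective : Function.Surjective C.subst := by
  intro g
  induction g using spoly_induction with
  | one => exact ⟨1, map_one _⟩
  | mul k g hg =>
    obtain ⟨f, rfl⟩ := hg
    refine ⟨(∑ j, C.N k j • gen p j) * f, ?_⟩
    rw [map_mul, map_sum]
    congr 1
    have h : ∀ j, C.subst (C.N k j • gen p j) = ∑ l, (C.N k j * C.M j l) • gen _ l := by
      intro j
      rw [map_smul, subst_gen, Finset.smul_sum]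
      simp only [smul_smul]
    rw [Finset.sum_congr rfl fun j _ => h j, Finset.sum_comm]
    simp only [← Finset.sum_smul, ← Matrix.mul_apply, C.inv_mul, Matrix.one_apply]
    simp
  | add f g hf hg =>
    obtain ⟨f, rfl⟩ := hf
    obtain ⟨g, rfl⟩ := hg
    exact ⟨f + g, map_add _ _ _⟩
  | smul c f hf =>
    obtain ⟨f, rfl⟩ := hf
    exact ⟨c • f, map_smul _ _ _⟩

/-- Right integration over one odd coordinate. -/
def rightInt (j : Fin C.s) : C.Fun →ₗ[ℝ] C.Fun :=
  -(pderiv _ (Sum.inr j) ∘ₗ (parityInv _).toLinearMap)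

theorem rightInt_apply (j : Fin C.s) (f : C.Fun) :
    C.rightInt j f = -pderiv _ (Sum.inr j) (parityInv _ f) := rfl

theorem foldl_rightInt (l : List (Fin C.s)) (g : C.Fun →ₗ[ℝ] C.Fun) (f : C.Fun) :
    l.foldl (fun g j => C.rightInt j g) (g f) =
      l.foldl (fun g j => C.rightInt j ∘ₗ g) g f := by
  induction l generalizing g with
  | nil => rfl
  | cons j l ih => exact ih (C.rightInt j ∘ₗ g)

theorem berezin_eq (f : C.Fun) : C.berezin f = C.body
    ((List.finRange C.s).foldl (fun g j => C.rightInt j g) f) := rfl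

/-- The Berezin integral as a linear map. -/
def berezinL : C.Fun →ₗ[ℝ] MvPolynomial (Fin C.a ⊕ Fin C.b) ℝ :=
  C.body.toLinearMap ∘ₗ
    (List.finRange C.s).foldl (fun g j => C.rightInt j ∘ₗ g) LinearMap.id

theorem berezinL_apply (f : C.Fun) : C.berezinL f = C.berezin f := by
  rw [berezin_eq, show f = LinearMap.id (R := ℝ) f from rfl, foldl_rightInt]
  rfl

/-- An operator that commutes with integration over each odd coordinate commutes with the
successive integration over all of them. -/
theorem rightInt_comm_even {D : C.Fun →ₗ[ℝ] C.Fun}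
    (hD : ∀ j f, C.rightInt j (D f) = D (C.rightInt j f)) (l : List (Fin C.s)) (f : C.Fun) :
    l.foldl (fun g j => C.rightInt j g) (D f) = D (l.foldl (fun g j => C.rightInt j g) f) := by
  induction l generalizing f with
  | nil => rfl
  | cons j l ih => rw [List.foldl_cons, hD, ih, List.foldl_cons]

theorem rightInt_pderiv (j : Fin C.s) (k : (Fin C.a ⊕ Fin C.b) ⊕ Fin C.s) (f : C.Fun) :
    C.rightInt j (pderiv _ k f) = pderiv _ k (C.rightInt j f) := by
  rw [rightInt_apply, rightInt_apply, map_neg, pderiv_pderiv_comm _ k]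
  have h := (isSDer_pderiv (parC C.a C.b C.s) k).parity f
  rw [J_spoly, J_spoly] at h
  rw [h, map_smul]
  congr 2
  rcases k with k | k <;> simp [parC]

/-- The Berezin integral of a derivative in an odd direction vanishes: the derivative is an
integration over the same coordinate, and the square of an odd derivative is zero. -/
theorem berezin_pderiv_odd (j : Fin C.s) (f : C.Fun) :
    C.berezin (pderiv _ (Sum.inr j) f) = 0 := by
  have h0 : ∀ f, C.rightInt j (pderiv _ (Sum.inr j) f) = 0 := by
    intro f
    rw [rightInt_pderiv, rightInt_apply, map_neg]
    have h2 := pderiv_pderiv_comm (parC C.a C.b C.s) (Sum.inr j) (Sum.inr j) (parityInv _ f)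
    rw [show parC C.a C.b C.s (Sum.inr j) = 1 from rfl, mul_one, sgn_one] at h2
    generalize pderiv _ (Sum.inr j) (pderiv _ (Sum.inr j) (parityInv _ f)) = y at h2 ⊢
    calc -y = -((1 / 2 : ℝ) • (y - (-1 : ℝ) • y)) := by congr 1; module
      _ = 0 := by rw [← h2, sub_self, smul_zero, neg_zero]
  have key : ∀ (l : List (Fin C.s)) f, j ∈ l →
      l.foldl (fun g j => C.rightInt j g) (pderiv _ (Sum.inr j) f) = 0 := by
    intro l
    induction l with
    | nil => simp
    | cons i l ih =>
      intro f hj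
      rw [List.foldl_cons]
      rcases List.mem_cons.1 hj with rfl | hj
      · rw [h0]
        exact (C.foldl_rightInt l 0 f).trans (by
          have : ∀ l : List (Fin C.s), l.foldl (fun g j => C.rightInt j ∘ₗ g)
              (0 : C.Fun →ₗ[ℝ] C.Fun) = 0 := by
            intro l
            induction l with
            | nil => rfl
            | cons i l ih => rw [List.foldl_cons, LinearMap.comp_zero, ih]
          rw [this]; rfl)
      · rw [rightInt_pderiv]
        exact ih _ hj
  rw [berezin_eq, key _ _ (List.mem_finRange j), map_zero]

theorem body_gen_inl (i : Fin C.a ⊕ Fin C.b) :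
    C.body (gen _ (Sum.inl i)) = MvPolynomial.X i := by
  simp [body]

theorem body_gen_inr (i : Fin C.s) : C.body (gen _ (Sum.inr i)) = 0 := by
  simp [body]

theorem body_pderiv (i : Fin C.a ⊕ Fin C.b) (f : C.Fun) :
    C.body (pderiv _ (Sum.inl i) f) = MvPolynomial.pderiv i (C.body f) := by
  induction f using spoly_induction with
  | one => simp [pderiv_one]
  | mul k f hf =>
    rw [pderiv_gen_mul, map_add, map_smul, map_smul, map_mul, map_mul, Derivation.leibniz, hf]
    rcases k with k | k
    · rw [body_gen_inl, MvPolynomial.pderiv_X]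
      simp [parC, Pi.single_apply, eq_comm, add_comm, mul_comm]
    · rw [body_gen_inr]
      simp
  | add f g hf hg => simp only [map_add, hf, hg]
  | smul c f hf => rw [map_smul, map_smul, map_smul, hf, Derivation.map_smul]

/-- The Berezin integral commutes with the derivatives in the even directions. -/
theorem berezin_pderiv_even (i : Fin C.a ⊕ Fin C.b) (f : C.Fun) :
    C.berezin (pderiv _ (Sum.inl i) f) = MvPolynomial.pderiv i (C.berezin f) := by
  rw [berezin_eq, C.rightInt_comm_even (D := pderiv _ (Sum.inl i))
    (fun j f => C.rightInt_pderiv j _ f), body_pderiv, ← berezin_eq]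

theorem berezin_mul_even (i : Fin C.a ⊕ Fin C.b) (f : C.Fun) :
    C.berezin (gen _ (Sum.inl i) * f) = MvPolynomial.X i * C.berezin f := by
  have h := C.rightInt_comm_even (D := LinearMap.mulLeft ℝ (gen _ (Sum.inl i))) (fun j f => by
    simp only [LinearMap.mulLeft_apply, rightInt_apply, map_mul, parityInv_gen]
    rw [show parC C.a C.b C.s (Sum.inl i) = 0 from rfl, sgn_zero, one_smul, pderiv_gen_mul,
      if_neg (by simp), zero_smul, zero_add, show parC C.a C.b C.s (Sum.inl i) = 0 from rfl,
      mul_zero, sgn_zero, one_smul]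
    exact (mul_neg (gen _ (Sum.inl i)) (pderiv _ (Sum.inr j) (parityInv _ f))).symm) (List.finRange C.s) f
  rw [LinearMap.mulLeft_apply, LinearMap.mulLeft_apply] at h
  rw [berezin_eq, h, map_mul, body_gen_inl, ← berezin_eq]

/-- The span of the odd coordinates. -/
def oddSpan : Submodule ℝ C.Fun := Submodule.span ℝ (Set.range C.ξ)

theorem ξ_mul_ξ (i j : Fin C.s) : C.ξ i * C.ξ j = (-1 : ℝ) • (C.ξ j * C.ξ i) := by
  have h := gen_mul_gen (parC C.a C.b C.s) (Sum.inr i) (Sum.inr j)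
  rw [show parC C.a C.b C.s (Sum.inr i) = 1 from rfl, show parC C.a C.b C.s (Sum.inr j) = 1 from rfl,
    mul_one, sgn_one] at h
  exact h

theorem ξ_mul_self (i : Fin C.s) : C.ξ i * C.ξ i = 0 := by
  have h := C.ξ_mul_ξ i i
  generalize C.ξ i * C.ξ i = y at h ⊢
  calc y = (1 / 2 : ℝ) • (y - (-1 : ℝ) • y) := by module
    _ = 0 := by rw [← h, sub_self, smul_zero]

theorem ξ_mul_prod {i : Fin C.s} {l : List (Fin C.s)} (h : i ∈ l) :
    C.ξ i * (l.map C.ξ).prod = 0 := by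
  induction l with
  | nil => simp at h
  | cons j l ih =>
    rw [List.map_cons, List.prod_cons, ← mul_assoc]
    rcases List.mem_cons.1 h with rfl | h
    · rw [ξ_mul_self, zero_mul]
    · rw [ξ_mul_ξ, smul_mul_assoc, mul_assoc, ih h, mul_zero, smul_zero]

theorem prod_ξ_eq_zero {l : List (Fin C.s)} (h : ¬ l.Nodup) : (l.map C.ξ).prod = 0 := by
  induction l with
  | nil => simp at h
  | cons i l ih =>
    rw [List.map_cons, List.prod_cons]
    by_cases hi : i ∈ l
    · exact C.ξ_mul_prod hi
    · rw [ih fun hl => h (List.nodup_cons.2 ⟨hi, hl⟩), mul_zero]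

/-- Products of more than `s` odd coordinates vanish. -/
theorem oddSpan_pow_eq_bot {k : ℕ} (hk : C.s < k) : C.oddSpan ^ k = ⊥ := by
  rw [oddSpan, Submodule.span_pow, Submodule.span_eq_bot]
  intro x hx
  obtain ⟨f, rfl⟩ := Set.mem_pow.1 hx
  choose g hg using fun i => (f i).2
  have h : List.ofFn (fun i => ((f i : Set.range C.ξ) : C.Fun)) = (List.ofFn g).map C.ξ := by
    rw [List.map_ofFn]
    congr 1
    funext i
    exact (hg i).symm
  rw [h]
  refine C.prod_ξ_eq_zero fun hn => ?_
  have := List.Nodup.length_le_card hn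
  simp at this
  omega

end LinCoords
end DualConstruction

namespace DualConstruction
open SuperAlg (J)

/-! ### The Schwinger-Dyson equations for superintegrals -/

/-- The signs of the squares of the even coordinates. -/
def LinCoords.signature {ι : Type*} [Fintype ι] [DecidableEq ι] {p : ι → ZMod 2}
    (C : LinCoords p) : Fin C.a ⊕ Fin C.b → ℝ := Sum.elim (fun _ => 1) (fun _ => -1)

namespace GaussCoords
variable {ι : Type*} [Fintype ι] [DecidableEq ι] {p : ι → ZMod 2} {σ : SPoly p}
  (C : GaussCoords σ)

theorem oddPart_mem_par : C.oddPart ∈ par _ 0 := by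
  refine Submodule.sum_mem _ fun i _ => Submodule.sum_mem _ fun j _ => Submodule.smul_mem _ _ ?_
  have h : C.ξ i * C.ξ j ∈ par _ ((1 : ZMod 2) + 1) :=
    mul_mem_par (gen_mem_par (parC C.a C.b C.s) (Sum.inr i))
      (gen_mem_par (parC C.a C.b C.s) (Sum.inr j))
  rwa [show (1 : ZMod 2) + 1 = 0 from rfl] at h

theorem oddPart_mem_oddSpan : C.oddPart ∈ C.oddSpan ^ 2 := by
  refine Submodule.sum_mem _ fun i _ => Submodule.sum_mem _ fun j _ => Submodule.smul_mem _ _ ?_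
  rw [pow_two]
  exact Submodule.mul_mem_mul (Submodule.subset_span ⟨i, rfl⟩) (Submodule.subset_span ⟨j, rfl⟩)

/-- The odd part of the quadratic function is nilpotent: its powers have too many odd factors. -/
theorem oddPart_pow_eq_zero : C.oddPart ^ (C.s + 1) = 0 := by
  have h := Submodule.pow_mem_pow _ C.oddPart_mem_oddSpan (C.s + 1)
  rw [← pow_mul, C.oddSpan_pow_eq_bot (by omega)] at h
  simpa using h

/-- The usual rule for derivatives of powers, as the odd part is an even element. -/
theorem pderiv_oddPart_pow (j : Fin C.s) (k : ℕ) :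
    pderiv _ (Sum.inr j) (C.oddPart ^ (k + 1)) =
      ((k : ℝ) + 1) • (pderiv _ (Sum.inr j) C.oddPart * C.oddPart ^ k) := by
  have hO := C.oddPart_mem_par
  have hD := isSDer_pderiv (parC C.a C.b C.s) (Sum.inr j)
  induction k with
  | zero => simp
  | succ k ih =>
    rw [pow_succ', hD.leibniz, ih, Jp_of_mem _ hO, mul_zero, sgn_zero, one_smul, mul_smul_comm,
      ← mul_assoc, mul_comm_of_mem hO (hD.mem hO), zero_mul, sgn_zero, one_smul, mul_assoc,
      ← pow_succ']
    push_cast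
    module

theorem pderiv_even_oddPart (i : Fin C.a ⊕ Fin C.b) :
    pderiv _ (Sum.inl i) C.oddPart = 0 := by
  simp only [oddPart, map_sum, map_smul, LinCoords.ξ, pderiv_gen_mul, pderiv_gen]
  simp

theorem pderiv_even_expOdd (i : Fin C.a ⊕ Fin C.b) :
    pderiv _ (Sum.inl i) C.expOdd = 0 := by
  have hD := isSDer_pderiv (parC C.a C.b C.s) (Sum.inl i)
  have h : ∀ k, pderiv _ (Sum.inl i) ((-C.oddPart) ^ k) = 0 := by
    intro k
    induction k with
    | zero => rw [pow_zero, pderiv_one]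
    | succ k ih =>
      rw [pow_succ', hD.leibniz, ih, map_neg, C.pderiv_even_oddPart, neg_zero, zero_mul,
        mul_zero, add_zero]
  rw [expOdd, map_sum]
  exact Finset.sum_eq_zero fun k _ => by rw [map_smul, h, smul_zero]

theorem neg_oddPart_pow (k : ℕ) : (-C.oddPart) ^ k = ((-1 : ℝ) ^ k) • C.oddPart ^ k := by
  rw [← smul_pow, ← neg_one_smul ℝ C.oddPart]

/-- The derivative of the exponential of the odd part; the truncated series is exact, because the
next power vanishes. -/
theorem pderiv_odd_expOdd (j : Fin C.s) : pderiv _ (Sum.inr j) C.expOdd =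
    (-1 : ℝ) • (pderiv _ (Sum.inr j) C.oddPart * C.expOdd) := by
  have h1 : pderiv _ (Sum.inr j) C.oddPart * C.oddPart ^ C.s = 0 := by
    have h := C.pderiv_oddPart_pow j C.s
    rw [C.oddPart_pow_eq_zero, map_zero] at h
    exact (smul_eq_zero_iff_right (by positivity)).1 h.symm
  simp only [expOdd, neg_oddPart_pow, map_sum, map_smul]
  rw [Finset.sum_range_succ', Finset.mul_sum, Finset.sum_range_succ, pow_zero, pow_zero,
    pderiv_one, smul_zero, smul_zero, add_zero, mul_smul_comm, mul_smul_comm, h1, smul_zero,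
    smul_zero, add_zero, Finset.smul_sum]
  refine Finset.sum_congr rfl fun k _ => ?_
  rw [pderiv_oddPart_pow, mul_smul_comm, mul_smul_comm, smul_smul, smul_smul, smul_smul,
    smul_smul]
  congr 1
  rw [Nat.factorial_succ]
  push_cast
  have : (k.factorial : ℝ) ≠ 0 := by positivity
  field_simp
  ring

/-- The Berezin integral against `e^{-σ}` of the odd coordinates. -/
def oddInt : SPoly p →ₗ[ℝ] MvPolynomial (Fin C.a ⊕ Fin C.b) ℝ :=
  C.berezinL ∘ₗ LinearMap.mulRight ℝ C.expOdd ∘ₗ C.subst.toLinearMap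

theorem oddInt_apply (f : SPoly p) : C.oddInt f = C.berezin (C.subst f * C.expOdd) :=
  C.berezinL_apply _

theorem pderiv_sq (k i : Fin C.a ⊕ Fin C.b) :
    pderiv (parC C.a C.b C.s) (Sum.inl k) (gen _ (Sum.inl i) ^ 2) =
      if k = i then (2 : ℝ) • gen _ (Sum.inl i) else 0 := by
  rw [pow_two, pderiv_gen_mul, pderiv_gen]
  by_cases h : k = i
  · subst h
    rw [if_pos rfl, if_pos rfl, if_pos rfl, show parC C.a C.b C.s (Sum.inl k) = 0 from rfl,
      mul_zero, sgn_zero, mul_one]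
    module
  · have h' : (Sum.inl k : (Fin C.a ⊕ Fin C.b) ⊕ Fin C.s) ≠ Sum.inl i := by simpa using h
    rw [if_neg h, if_neg h', if_neg h', mul_zero, smul_zero, zero_smul, add_zero]

theorem pderiv_odd_sq (k : Fin C.s) (i : Fin C.a ⊕ Fin C.b) :
    pderiv (parC C.a C.b C.s) (Sum.inr k) (gen _ (Sum.inl i) ^ 2) = 0 := by
  rw [pow_two, pderiv_gen_mul, pderiv_gen, if_neg (by simp), if_neg (by simp), mul_zero,
    smul_zero, zero_smul, add_zero]

theorem pderiv_even_subst (k : Fin C.a ⊕ Fin C.b) :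
    pderiv _ (Sum.inl k) (C.subst σ) = C.signature k • gen _ (Sum.inl k) := by
  rw [C.sigma_eq, map_add, show pderiv _ (Sum.inl k) (∑ i, ∑ j, C.c i j • (C.ξ i * C.ξ j)) = 0
    from C.pderiv_even_oddPart k, add_zero, map_smul, map_sub, map_sum, map_sum]
  simp only [LinCoords.x, LinCoords.x', pderiv_sq]
  rcases k with k | k
  · rw [Finset.sum_eq_single k (fun i _ hi => if_neg fun h => hi (Sum.inl.inj h).symm) (by simp),
      if_pos rfl, Finset.sum_eq_zero (fun i _ => if_neg (by simp)), sub_zero, smul_smul]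
    norm_num [LinCoords.signature]
  · rw [Finset.sum_eq_single k (fun i _ hi => if_neg fun h => hi (Sum.inr.inj h).symm) (by simp),
      if_pos rfl, Finset.sum_eq_zero (fun i _ => if_neg (by simp))]
    simp only [LinCoords.signature, Sum.elim_inr]
    module

theorem pderiv_odd_subst (k : Fin C.s) :
    pderiv _ (Sum.inr k) (C.subst σ) = pderiv _ (Sum.inr k) C.oddPart := by
  rw [C.sigma_eq, map_add, map_smul, map_sub, map_sum, map_sum]
  simp only [LinCoords.x, LinCoords.x', pderiv_odd_sq, Finset.sum_const_zero, sub_zero,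
    smul_zero, zero_add]
  rfl

/-- A functional on polynomials obeying the Gaussian integration by parts rule gives, after
Berezin integration, a solution of the Schwinger-Dyson equations. -/
theorem schwingerDyson {W : MvPolynomial (Fin C.a ⊕ Fin C.b) ℝ →ₗ[ℝ] ℝ}
    (hW : ∀ i f, W (MvPolynomial.pderiv i f) = C.signature i * W (MvPolynomial.X i * f)) :
    SchwingerDyson σ (W ∘ₗ C.oddInt) := by
  have key : ∀ (k : (Fin C.a ⊕ Fin C.b) ⊕ Fin C.s) (g : C.Fun),
      W (C.berezin (pderiv _ k g * C.expOdd)) =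
        W (C.berezin (pderiv _ k (C.subst σ) * g * C.expOdd)) := by
    intro k g
    rcases k with k | k
    · have h := (isSDer_pderiv (parC C.a C.b C.s) (Sum.inl k)).leibniz g C.expOdd
      rw [C.pderiv_even_expOdd, mul_zero, add_zero] at h
      rw [← h, C.berezin_pderiv_even, hW, C.pderiv_even_subst, smul_mul_assoc, smul_mul_assoc,
        ← C.berezinL_apply (_ • _), map_smul, map_smul, smul_eq_mul, C.berezinL_apply, mul_assoc,
        C.toLinCoords.berezin_mul_even]
    · have h := (isSDer_pderiv (parC C.a C.b C.s) (Sum.inr k)).leibniz g C.expOdd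
      have h1 : Jp (parC C.a C.b C.s (Sum.inr k)) g * pderiv _ (Sum.inr k) C.oddPart =
          pderiv _ (Sum.inr k) C.oddPart * g := by
        have hO := (isSDer_pderiv (parC C.a C.b C.s) (Sum.inr k)).mem C.oddPart_mem_par
        refine homog_induction (Q := fun g => Jp (parC C.a C.b C.s (Sum.inr k)) g *
          pderiv _ (Sum.inr k) C.oddPart = pderiv _ (Sum.inr k) C.oddPart * g)
          (fun a b ha hb => ?_) (fun x a ha => ?_) g
        · rw [map_add, add_mul, mul_add, ha, hb]
        · rw [Jp_of_mem _ ha, smul_mul_assoc, mul_comm_of_mem hO ha, add_zero]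
      have h2 := C.berezin_pderiv_odd k (g * C.expOdd)
      rw [h, C.pderiv_odd_expOdd, mul_smul_comm, ← mul_assoc, h1, ← C.berezinL_apply, map_add,
        map_smul, C.berezinL_apply, C.berezinL_apply] at h2
      rw [C.pderiv_odd_subst]
      congr 1
      generalize C.berezin (pderiv _ (Sum.inr k) g * C.expOdd) = A at *
      generalize C.berezin (pderiv _ (Sum.inr k) C.oddPart * g * C.expOdd) = A' at *
      rw [neg_one_smul] at h2
      exact eq_of_sub_eq_zero (by rw [sub_eq_add_neg]; exact h2)
  intro u f
  simp only [← C.berezinL_apply] at key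
  simp only [LinearMap.comp_apply, oddInt, LinearMap.mulRight_apply, AlgHom.toLinearMap_apply,
    map_mul, C.subst_pderiv, Finset.sum_mul, map_sum, smul_mul_assoc, map_smul, key]

end GaussCoords
end DualConstruction

namespace DualConstruction
open MeasureTheory

/-! ### Gaussian moments and Wick rotation -/

/-- The moments of the standard Gaussian (`s = 1`), and of its Wick rotation (`s = -1`). -/
def mom (s : ℝ) : ℕ → ℝ
  | 0 => 1
  | 1 => 0
  | (k + 2) => s * (k + 1) * mom s k

/-- The normalized Gaussian integral of polynomials, with second moments `s`. -/
def wick {κ : Type*} [Fintype κ] (s : κ → ℝ) : MvPolynomial κ ℝ →ₗ[ℝ] ℝ :=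
  (MvPolynomial.basisMonomials κ ℝ).constr ℝ fun d => ∏ i, mom (s i) (d i)

section Wick
variable {κ : Type*} [Fintype κ] (s : κ → ℝ)

theorem wick_monomial (d : κ →₀ ℕ) (c : ℝ) :
    wick s (MvPolynomial.monomial d c) = c * ∏ i, mom (s i) (d i) := by
  have h : MvPolynomial.monomial d c = c • MvPolynomial.basisMonomials κ ℝ d := by
    simp [MvPolynomial.smul_monomial]
  rw [h, map_smul, wick, Module.Basis.constr_basis, smul_eq_mul]

theorem wick_one : wick s 1 = 1 := by
  have h := wick_monomial s 0 1
  simpa [mom] using h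

/-- Integration by parts for the Gaussian functional, on monomials the recursion of the moments. -/
theorem wick_pderiv (hs : ∀ i, s i * s i = 1) (i : κ) (f : MvPolynomial κ ℝ) :
    wick s (MvPolynomial.pderiv i f) = s i * wick s (MvPolynomial.X i * f) := by
  classical
  induction f using MvPolynomial.induction_on' with
  | add f g hf hg => rw [map_add, map_add, hf, hg, mul_add, map_add, mul_add]
  | monomial d c =>
    rw [MvPolynomial.pderiv_monomial, MvPolynomial.X, MvPolynomial.monomial_mul, wick_monomial,
      wick_monomial, one_mul, ← Finset.mul_prod_erase _ _ (Finset.mem_univ i),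
      ← Finset.mul_prod_erase _ _ (Finset.mem_univ i)]
    have h1 : ∏ j ∈ Finset.univ.erase i, mom (s j) ((d - Finsupp.single i 1 : κ →₀ ℕ) j) =
        ∏ j ∈ Finset.univ.erase i, mom (s j) (d j) := Finset.prod_congr rfl fun j hj => by
      rw [Finsupp.tsub_apply, Finsupp.single_eq_of_ne (Finset.ne_of_mem_erase hj), Nat.sub_zero]
    have h2 : ∏ j ∈ Finset.univ.erase i, mom (s j) ((Finsupp.single i 1 + d : κ →₀ ℕ) j) =
        ∏ j ∈ Finset.univ.erase i, mom (s j) (d j) := Finset.prod_congr rfl fun j hj => by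
      rw [Finsupp.add_apply, Finsupp.single_eq_of_ne (Finset.ne_of_mem_erase hj), zero_add]
    rw [h1, h2, Finsupp.tsub_apply, Finsupp.add_apply, Finsupp.single_eq_same]
    rcases h : d i with _ | k
    · simp [mom]
    · rw [Nat.add_sub_cancel, show 1 + (k + 1) = k + 2 by ring, mom]
      push_cast
      linear_combination (-(c * (k + 1) * mom (s i) k *
        ∏ j ∈ Finset.univ.erase i, mom (s j) (d j))) * hs i

end Wick

theorem integrable_pow_mul_gaussian (k : ℕ) :
    Integrable fun x : ℝ => x ^ k * Real.exp (-(1 / 2) * x ^ 2) := by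
  have h := integrable_rpow_mul_exp_neg_mul_sq (b := 1 / 2) (by norm_num) (s := k)
    (lt_of_lt_of_le (by norm_num) (Nat.cast_nonneg k))
  simpa only [Real.rpow_natCast] using h

/-- The moments of the Gaussian, by integrating the derivative of `x ^ (k + 1) * exp (-x ^ 2 / 2)`.
-/
theorem integral_pow_mul_gaussian : ∀ k : ℕ,
    ∫ x : ℝ, x ^ k * Real.exp (-(1 / 2) * x ^ 2) = √(2 * Real.pi) * mom 1 k
  | 0 => by
    simp only [pow_zero, one_mul, integral_gaussian, mom, mul_one]
    congr 1
    ring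
  | 1 => by
    have h := integral_eq_zero_of_hasDerivAt_of_integrable
      (f := fun x : ℝ => -Real.exp (-(1 / 2) * x ^ 2))
      (f' := fun x : ℝ => x ^ 1 * Real.exp (-(1 / 2) * x ^ 2)) (fun x => by
        have h1 := (((hasDerivAt_pow 2 x).const_mul (-(1 / 2))).exp).neg
        refine h1.congr_deriv ?_
        simp only [pow_one, Nat.cast_ofNat, Nat.add_one_sub_one]
        ring) (integrable_pow_mul_gaussian 1) (by
        simpa using (integrable_pow_mul_gaussian 0).neg)
    rw [h, mom, mul_zero]
  | (k + 2) => by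
    have h := integral_eq_zero_of_hasDerivAt_of_integrable
      (f := fun x : ℝ => x ^ (k + 1) * Real.exp (-(1 / 2) * x ^ 2))
      (f' := fun x : ℝ => ((k : ℝ) + 1) * (x ^ k * Real.exp (-(1 / 2) * x ^ 2)) -
        x ^ (k + 2) * Real.exp (-(1 / 2) * x ^ 2)) (fun x => by
        have h1 := (hasDerivAt_pow (k + 1) x).mul
          (((hasDerivAt_pow 2 x).const_mul (-(1 / 2))).exp)
        refine h1.congr_deriv ?_
        push_cast
        ring) (((integrable_pow_mul_gaussian k).const_mul _).sub
        (integrable_pow_mul_gaussian (k + 2))) (integrable_pow_mul_gaussian (k + 1))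
    rw [integral_sub ((integrable_pow_mul_gaussian k).const_mul _)
      (integrable_pow_mul_gaussian (k + 2)), integral_const_mul,
      integral_pow_mul_gaussian k] at h
    rw [mom]
    linarith

theorem pow_mul_gaussian_scale {c : ℝ} (hc : 0 < c) (k : ℕ) :
    (fun x : ℝ => x ^ k * Real.exp (-(1 / 2) * (c * x) ^ 2)) = fun x => (c ^ k)⁻¹ *
      (fun y : ℝ => y ^ k * Real.exp (-(1 / 2) * y ^ 2)) (c * x) := by
  funext x
  simp only [mul_pow]
  field_simp

theorem integrable_pow_mul_gaussian_scale {c : ℝ} (hc : 0 < c) (k : ℕ) :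
    Integrable fun x : ℝ => x ^ k * Real.exp (-(1 / 2) * (c * x) ^ 2) := by
  rw [pow_mul_gaussian_scale hc]
  exact ((integrable_pow_mul_gaussian k).comp_mul_left' hc.ne').const_mul _

theorem integral_pow_mul_gaussian_scale {c : ℝ} (hc : 0 < c) (k : ℕ) :
    ∫ x : ℝ, x ^ k * Real.exp (-(1 / 2) * (c * x) ^ 2) =
      √(2 * Real.pi) * mom 1 k * (c ^ (k + 1))⁻¹ := by
  rw [pow_mul_gaussian_scale hc, integral_const_mul, Measure.integral_comp_mul_left
    (fun y : ℝ => y ^ k * Real.exp (-(1 / 2) * y ^ 2)), integral_pow_mul_gaussian, abs_of_pos (inv_pos.2 hc), smul_eq_mul, pow_succ]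
  field_simp

/-- Rotating the contour multiplies the `k`-th moment by `i^{-k}`. -/
theorem mom_neg_one : ∀ k : ℕ,
    (mom 1 k : ℂ) * (Complex.I ^ (k + 1))⁻¹ = Complex.I⁻¹ * (mom (-1) k : ℂ)
  | 0 => by simp [mom]
  | 1 => by simp [mom]
  | (k + 2) => by
    have h := mom_neg_one k
    rw [mom, mom, show k + 2 + 1 = (k + 1) + 2 by ring, pow_add, Complex.I_sq]
    push_cast
    rw [mul_inv, inv_neg, inv_one]
    linear_combination (-((k : ℂ) + 1)) * h

namespace LinCoords
variable {ι : Type*} [Fintype ι] [DecidableEq ι] {p : ι → ZMod 2} (C : LinCoords p)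

theorem signature_sq (i) : C.signature i * C.signature i = 1 := by
  rcases i with i | i <;> simp [signature]

/-- The value of `∫ exp(-½(∑ xᵢ² - ∑ x'ᵢ²)) dx dx'` after Wick rotation. -/
def wickConst : ℂ := ∏ i : Fin C.a ⊕ Fin C.b,
  (√(2 * Real.pi) : ℂ) * Sum.elim (fun _ => 1) (fun _ => Complex.I⁻¹) i

theorem wickConst_ne_zero : C.wickConst ≠ 0 := by
  refine Finset.prod_ne_zero_iff.2 fun i _ => mul_ne_zero ?_ ?_
  · have : √(2 * Real.pi) ≠ 0 := by positivity
    exact_mod_cast this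
  · rcases i with i | i <;> simp

theorem gaussian_weight (v : Fin C.a ⊕ Fin C.b → ℝ) (t : ℝ) :
    Real.exp (-(1 / 2) * (∑ i, v (Sum.inl i) ^ 2 + ∑ i, (t * v (Sum.inr i)) ^ 2)) =
      ∏ i, Real.exp (-(1 / 2) *
        ((Sum.elim (fun _ => 1) (fun _ => t) i : ℝ) * v i) ^ 2) := by
  rw [← Real.exp_sum, Fintype.sum_sum_type]
  simp only [Sum.elim_inl, Sum.elim_inr, one_mul, mul_add, Finset.mul_sum]

theorem gaussian_integrand (d : Fin C.a ⊕ Fin C.b →₀ ℕ) (c t : ℝ) :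
    (fun v : Fin C.a ⊕ Fin C.b → ℝ => MvPolynomial.eval v (MvPolynomial.monomial d c) *
    Real.exp (-(1 / 2) * (∑ i, v (Sum.inl i) ^ 2 + ∑ i, (t * v (Sum.inr i)) ^ 2))) =
      fun v => c * ∏ i, (fun (i : Fin C.a ⊕ Fin C.b) (x : ℝ) => x ^ d i * Real.exp (-(1 / 2) *
        ((Sum.elim (fun _ => 1) (fun _ => t) i : ℝ) * x) ^ 2)) i (v i) := by
  funext v
  rw [gaussian_weight, MvPolynomial.eval_monomial, Finsupp.prod_fintype _ _ (by simp), mul_assoc,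
    ← Finset.prod_mul_distrib]

theorem elim_pos {t : ℝ} (ht : 0 < t) (i : Fin C.a ⊕ Fin C.b) :
    0 < (Sum.elim (fun _ => 1) (fun _ => t) i : ℝ) := by
  rcases i with i | i <;> simp [ht]

theorem gaussian_integrable (f : MvPolynomial (Fin C.a ⊕ Fin C.b) ℝ) {t : ℝ} (ht : 0 < t) :
    Integrable fun v : Fin C.a ⊕ Fin C.b → ℝ => MvPolynomial.eval v f *
    Real.exp (-(1 / 2) * (∑ i, v (Sum.inl i) ^ 2 + ∑ i, (t * v (Sum.inr i)) ^ 2)) := by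
  induction f using MvPolynomial.induction_on' with
  | add f g hf hg => simp only [map_add, add_mul]; exact hf.add hg
  | monomial d c =>
    rw [gaussian_integrand]
    exact (Integrable.fintype_prod fun i =>
      integrable_pow_mul_gaussian_scale (C.elim_pos ht i) (d i)).const_mul c

theorem gaussian_add (f g : MvPolynomial (Fin C.a ⊕ Fin C.b) ℝ) {t : ℝ} (ht : 0 < t) :
    C.gaussian (f + g) t = C.gaussian f t + C.gaussian g t := by
  rw [gaussian, gaussian, gaussian, ← integral_add (C.gaussian_integrable f ht)
    (C.gaussian_integrable g ht)]
  simp only [map_add, add_mul]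

theorem gaussian_monomial (d : Fin C.a ⊕ Fin C.b →₀ ℕ) (c : ℝ) {t : ℝ} (ht : 0 < t) :
    C.gaussian (MvPolynomial.monomial d c) t = c * ∏ i, (√(2 * Real.pi) * mom 1 (d i) *
      ((Sum.elim (fun _ => 1) (fun _ => t) i : ℝ) ^ (d i + 1))⁻¹) := by
  rw [gaussian, gaussian_integrand, integral_const_mul, integral_fintype_prod_volume_eq_prod
    (fun (i : Fin C.a ⊕ Fin C.b) (x : ℝ) => x ^ d i * Real.exp (-(1 / 2) *
        ((Sum.elim (fun _ => 1) (fun _ => t) i : ℝ) * x) ^ 2))]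
  congr 1
  exact Finset.prod_congr rfl fun i _ => integral_pow_mul_gaussian_scale (C.elim_pos ht i) _

/-- The Wick rotated Gaussian integral of a polynomial exists: for positive `t`, a monomial is
integrated to a constant times a negative power of `t`, which is continued to the punctured plane.
-/
theorem isWickIntegral (f : MvPolynomial (Fin C.a ⊕ Fin C.b) ℝ) :
    C.IsWickIntegral f (C.wickConst * wick C.signature f) := by
  induction f using MvPolynomial.induction_on' with
  | add f g hf hg =>
    obtain ⟨F, hF, hF1, hF2⟩ := hf
    obtain ⟨G, hG, hG1, hG2⟩ := hg
    refine ⟨fun t => F t + G t, hF.add hG, fun t ht => ?_, ?_⟩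
    · change F t + G t = _
      rw [hF1 t ht, hG1 t ht, C.gaussian_add f g ht]
      push_cast
      rfl
    · change F Complex.I + G Complex.I = _
      rw [hF2, hG2, map_add]
      push_cast
      ring
  | monomial d c =>
    refine ⟨fun t => c * ∏ i, ((√(2 * Real.pi) : ℂ) * mom 1 (d i) *
      ((Sum.elim (fun _ => 1) (fun _ => t) i : ℂ) ^ (d i + 1))⁻¹), ?_, fun t ht => ?_, ?_⟩
    · refine DifferentiableOn.const_mul (DifferentiableOn.fun_finsetProd fun i _ => ?_) _
      refine DifferentiableOn.const_mul (DifferentiableOn.inv ?_ ?_) _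
      · rcases i with i | i
        · exact (differentiableOn_const 1).pow _
        · exact differentiableOn_id.pow _
      · intro t ht
        rcases i with i | i
        · simp
        · exact pow_ne_zero _ ht
    · rw [C.gaussian_monomial d c ht]
      push_cast
      congr 1
      refine Finset.prod_congr rfl fun i _ => ?_
      rcases i with i | i <;> simp
    · rw [wick_monomial, wickConst]
      push_cast
      rw [mul_left_comm, ← Finset.prod_mul_distrib]
      congr 1
      refine Finset.prod_congr rfl fun i _ => ?_
      rcases i with i | i
      · simp [signature]
      · simp only [Sum.elim_inr, signature]
        rw [mul_assoc, mom_neg_one, mul_assoc]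

/-- The analytic continuation is unique, by the identity theorem on the connected punctured plane.
-/
theorem IsWickIntegral.unique {f : MvPolynomial (Fin C.a ⊕ Fin C.b) ℝ} {z z' : ℂ}
    (h : C.IsWickIntegral f z) (h' : C.IsWickIntegral f z') : z = z' := by
  obtain ⟨F, hF, hF1, rfl⟩ := h
  obtain ⟨G, hG, hG1, rfl⟩ := h'
  have ho : IsOpen ({0}ᶜ : Set ℂ) := isOpen_compl_singleton
  refine (hF.analyticOnNhd ho).eqOn_of_preconnected_of_frequently_eq (hG.analyticOnNhd ho)
    (isConnected_compl_singleton_of_one_lt_rank (by simp) 0).isPreconnected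
    (z₀ := 1) (by simp) ?_ (by simp)
  -- The two continuations agree on the positive reals, which accumulate at `1`.
  have ht : Filter.Tendsto (fun t : ℝ => (t : ℂ)) (nhdsWithin 1 {1}ᶜ) (nhdsWithin 1 {1}ᶜ) := by
    refine tendsto_nhdsWithin_of_tendsto_nhds_of_eventually_within _ ?_ ?_
    · exact (Complex.continuous_ofReal.tendsto' 1 1 (by simp)).mono_left nhdsWithin_le_nhds
    · filter_upwards [self_mem_nhdsWithin] with t ht
      simpa using ht
  refine ht.frequently ?_
  have : ∀ᶠ t : ℝ in nhdsWithin 1 {1}ᶜ, F t = G t := by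
    filter_upwards [mem_nhdsWithin_of_mem_nhds (lt_mem_nhds (zero_lt_one' ℝ))] with t ht
    rw [hF1 t ht, hG1 t ht]
  exact this.frequently

end LinCoords
end DualConstruction

namespace DualConstruction
open SuperAlg (J)

/-! ### The top product of odd coordinates -/

namespace LinCoords
variable {ι : Type*} [Fintype ι] [DecidableEq ι] {p : ι → ZMod 2} (C : LinCoords p)

theorem prod_ξ_mem_par (l : List (Fin C.s)) : ∃ x, (l.map C.ξ).prod ∈ par C.Fun x := by
  induction l with
  | nil => exact ⟨0, one_mem_par⟩
  | cons j l ih =>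
    obtain ⟨x, hx⟩ := ih
    rw [List.map_cons, List.prod_cons]
    exact ⟨_, mul_mem_par (gen_mem_par _ _) hx⟩

theorem pderiv_prod_ξ {j : Fin C.s} {l : List (Fin C.s)} (h : j ∉ l) :
    pderiv _ (Sum.inr j) (l.map C.ξ).prod = 0 := by
  induction l with
  | nil => exact pderiv_one _ _
  | cons i l ih =>
    rw [List.mem_cons, not_or] at h
    rw [List.map_cons, List.prod_cons, ξ, pderiv_gen_mul, ih h.2, mul_zero, smul_zero, add_zero,
      if_neg (by simpa using h.1), zero_smul]

/-- The Berezin integral of the product of all odd coordinates is not zero. -/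
theorem foldl_rightInt_prod_ξ {l : List (Fin C.s)} (hl : l.Nodup) : ∀ c : ℝ, c ≠ 0 →
    ∃ c' : ℝ, c' ≠ 0 ∧ l.foldl (fun g j => C.rightInt j g) (c • (l.map C.ξ).prod) = c' • 1 := by
  induction l with
  | nil => exact fun c hc => ⟨c, hc, rfl⟩
  | cons j l ih =>
    intro c hc
    obtain ⟨x, hx⟩ := C.prod_ξ_mem_par (j :: l)
    obtain ⟨hj, hl⟩ := List.nodup_cons.1 hl
    obtain ⟨c', hc', h⟩ := ih hl (-(c * sgn x)) (neg_ne_zero.2 (mul_ne_zero hc (sgn_ne_zero x)))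
    refine ⟨c', hc', ?_⟩
    rw [List.foldl_cons, ← h]
    congr 1
    rw [map_smul, rightInt_apply, ← J_spoly, mem_par.1 hx, map_smul, List.map_cons,
      List.prod_cons, ξ, pderiv_gen_mul, C.pderiv_prod_ξ hj, mul_zero, smul_zero, add_zero,
      if_pos rfl, one_smul, smul_neg, smul_smul]
    exact (neg_smul _ _).symm

/-- The Berezin integral of the product of all odd coordinates does not vanish. -/
theorem berezin_top : ∃ c : ℝ, c ≠ 0 ∧
    C.berezin ((List.finRange C.s).map C.ξ).prod = c • 1 := by
  obtain ⟨c, hc, h⟩ := C.foldl_rightInt_prod_ξ (List.nodup_finRange _) 1 one_ne_zero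
  refine ⟨c, hc, ?_⟩
  rw [berezin_eq, ← one_smul ℝ (List.map C.ξ (List.finRange C.s)).prod, h, map_smul, map_one]

theorem prod_ξ_mem_oddSpan (l : List (Fin C.s)) : (l.map C.ξ).prod ∈ C.oddSpan ^ l.length := by
  induction l with
  | nil => exact Submodule.one_le.1 le_rfl
  | cons j l ih =>
    rw [List.map_cons, List.prod_cons, List.length_cons, pow_succ']
    exact Submodule.mul_mem_mul (Submodule.subset_span ⟨j, rfl⟩) ih

end LinCoords

/-! ### Gaussian expectation values -/

namespace GaussCoords
variable {ι : Type*} [Fintype ι] [DecidableEq ι] {p : ι → ZMod 2} {σ : SPoly p}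
  (C : GaussCoords σ)

/-- The exponential of the odd part acts as `1` on the product of all odd coordinates, which is
annihilated by every odd coordinate. -/
theorem top_mul_expOdd : ((List.finRange C.s).map C.ξ).prod * C.expOdd =
    ((List.finRange C.s).map C.ξ).prod := by
  have h1 := C.prod_ξ_mem_oddSpan (List.finRange C.s)
  rw [List.length_finRange] at h1
  have h2 : ((List.finRange C.s).map C.ξ).prod * C.oddPart = 0 := by
    have h := Submodule.mul_mem_mul h1 C.oddPart_mem_oddSpan
    rw [← pow_add, C.oddSpan_pow_eq_bot (by omega)] at h
    simpa using h
  simp only [expOdd, neg_oddPart_pow, Finset.sum_range_succ']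
  rw [mul_add, Finset.mul_sum, Finset.sum_eq_zero, pow_zero, pow_zero, one_smul,
    Nat.factorial_zero, Nat.cast_one, inv_one, one_smul, mul_one, zero_add]
  intro k _
  rw [mul_smul_comm, mul_smul_comm, pow_succ' C.oddPart, ← mul_assoc, h2, zero_mul, smul_zero,
    smul_zero]

/-- The unnormalized Gaussian superintegral, up to a nonzero complex constant. -/
def integral : SPoly p →ₗ[ℝ] ℝ := wick C.signature ∘ₗ C.oddInt

theorem integral_schwingerDyson : SchwingerDyson σ C.integral :=
  C.schwingerDyson (wick_pderiv _ C.signature_sq)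

/-- The integral of `e^{-σ}` is nonzero: otherwise every integral would vanish by the
Schwinger-Dyson equations. -/
theorem integral_one_ne_zero (hσ : Nondeg σ) : C.integral 1 ≠ 0 := by
  intro h
  have h0 := C.integral_schwingerDyson.eq_zero hσ h
  obtain ⟨f, hf⟩ := C.subst_surjective ((List.finRange C.s).map C.ξ).prod
  obtain ⟨c, hc, hb⟩ := C.berezin_top
  have h1 : C.integral f = c := by
    rw [integral, LinearMap.comp_apply, oddInt_apply, hf, top_mul_expOdd, hb, map_smul, wick_one,
      smul_eq_mul, mul_one]
  rw [h0] at h1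
  exact hc h1.symm

/-- The superintegral equals `integral`, times the constant of the even Gaussian integral. -/
theorem isSuperIntegral (f : SPoly p) :
    C.IsSuperIntegral f (C.wickConst * C.integral f) := by
  rw [IsSuperIntegral, ← oddInt_apply]
  exact C.isWickIntegral _

end GaussCoords

section Expectation
variable {ι : Type*} [Fintype ι] [DecidableEq ι] {p : ι → ZMod 2} {σ : SPoly p}

/-- The mean values of all superpolynomials form a linear functional, which is normalized and
satisfies the Schwinger-Dyson equations. It is the same in all standard coordinates, since these
equations determine it. -/
theorem exists_expectation (hC : Nonempty (GaussCoords σ)) (hσ : Nondeg σ) :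
    ∃ E : SPoly p →ₗ[ℝ] ℝ, E 1 = 1 ∧ SchwingerDyson σ E ∧ ∀ f, IsExpectation σ f (E f) := by
  have hE : ∀ C : GaussCoords σ, ((C.integral 1)⁻¹ • C.integral) 1 = 1 ∧
      SchwingerDyson σ ((C.integral 1)⁻¹ • C.integral) := fun C =>
    ⟨inv_mul_cancel₀ (C.integral_one_ne_zero hσ), fun u f => by
      rw [LinearMap.smul_apply, LinearMap.smul_apply, C.integral_schwingerDyson]⟩
  obtain ⟨C₀⟩ := hC
  refine ⟨_, (hE C₀).1, (hE C₀).2, fun f => ⟨⟨C₀⟩, fun C => ⟨_, _, C.isSuperIntegral f,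
    C.isSuperIntegral 1, ?_, ?_⟩⟩⟩
  · exact mul_ne_zero C.wickConst_ne_zero
      (Complex.ofReal_ne_zero.2 (C.integral_one_ne_zero hσ))
  · have h := SchwingerDyson.eq_zero hσ (E := (C₀.integral 1)⁻¹ • C₀.integral -
      (C.integral 1)⁻¹ • C.integral) (fun u f => by
        rw [LinearMap.sub_apply, LinearMap.sub_apply, (hE C₀).2, (hE C).2])
      (by rw [LinearMap.sub_apply, (hE C₀).1, (hE C).1, sub_self])
    rw [sub_eq_zero.1 h, LinearMap.smul_apply, smul_eq_mul, mul_div_mul_left _ _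
      C.wickConst_ne_zero]
    push_cast
    rw [inv_mul_eq_div]

theorem IsExpectation.unique {f : SPoly p} {z z' : ℝ} (h : IsExpectation σ f z)
    (h' : IsExpectation σ f z') : z = z' := by
  obtain ⟨C⟩ := h.1
  obtain ⟨a, b, ha, hb, _, hz⟩ := h.2 C
  obtain ⟨a', b', ha', hb', _, hz'⟩ := h'.2 C
  rw [LinCoords.IsWickIntegral.unique _ ha' ha, LinCoords.IsWickIntegral.unique _ hb' hb,
    ← hz] at hz'
  exact_mod_cast hz'.symm

end Expectation
end DualConstruction

namespace DualConstruction

/-! ### Existence of standard coordinates -/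

/-- The polar form of the quadratic form of a symmetric matrix. -/
theorem associated_toQuadraticForm' {I : Type} [Fintype I] [DecidableEq I] {K : Matrix I I ℝ}
    (hK : K.IsSymm) :
    QuadraticMap.associated (R := ℝ) K.toQuadraticForm' = Matrix.toLinearMap₂' ℝ K := by
  refine LinearMap.ext fun x => LinearMap.ext fun y => ?_
  rw [Matrix.toQuadraticForm', QuadraticMap.associated_toQuadraticMap,
    Matrix.toLinearMap₂'_apply', Matrix.toLinearMap₂'_apply', Matrix.dotProduct_mulVec y,
    ← Matrix.mulVec_transpose, hK, dotProduct_comm (K.mulVec y) x, ← two_smul ℝ]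
  simp

/-- Sylvester's law: a nondegenerate symmetric real matrix is congruent to a diagonal one with
entries `±1`, the positive ones first. -/
theorem exists_diagonalization {I : Type} [Fintype I] [DecidableEq I] (K : Matrix I I ℝ)
    (hK : K.IsSymm) (hdet : K.SeparatingLeft) :
    ∃ (a b : ℕ) (M : Matrix I (Fin a ⊕ Fin b) ℝ) (N : Matrix (Fin a ⊕ Fin b) I ℝ),
      M * N = 1 ∧ N * M = 1 ∧
      M.transpose * K * M = Matrix.diagonal (Sum.elim (fun _ => 1) (fun _ => -1)) := by
  classical
  obtain ⟨w, hw, ⟨g⟩⟩ := QuadraticForm.equivalent_one_neg_one_weighted_sum_squared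
    K.toQuadraticForm' (by
      rw [associated_toQuadraticForm' hK]; exact Matrix.separatingLeft_toLinearMap₂'_iff.2 hdet)
  let e : {i // w i = 1} ⊕ {i // ¬ w i = 1} ≃ Fin _ ⊕ Fin _ :=
    Equiv.sumCongr (Fintype.equivFin {i // w i = 1}) (Fintype.equivFin {i // ¬ w i = 1})
  let f := (Equiv.sumCompl fun i => w i = 1).symm.trans e
  have hdiag : (LinearMap.toMatrix' g.symm.toLinearEquiv.toLinearMap).transpose * K *
      LinearMap.toMatrix' g.symm.toLinearEquiv.toLinearMap = Matrix.diagonal w := by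
    have h1 : QuadraticMap.comp K.toQuadraticForm' g.symm.toLinearEquiv.toLinearMap =
        (Matrix.diagonal w).toQuadraticForm' := by
      ext x
      rw [QuadraticMap.comp_apply]
      refine (g.symm.map_app x).trans ?_
      rw [QuadraticMap.weightedSumSquares_apply]
      simp only [Matrix.toQuadraticForm', LinearMap.BilinMap.toQuadraticMap_apply,
        Matrix.toLinearMap₂'_apply', Matrix.mulVec_diagonal, dotProduct, smul_eq_mul]
      exact Finset.sum_congr rfl fun i _ => by ring
    have h2 := congrArg QuadraticForm.toMatrix' h1
    rwa [QuadraticForm.toMatrix'_comp, QuadraticForm.toMatrix', QuadraticForm.toMatrix',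
      associated_toQuadraticForm' hK, associated_toQuadraticForm' (Matrix.diagonal_transpose w),
      LinearMap.toMatrix'_toLinearMap₂', LinearMap.toMatrix'_toLinearMap₂'] at h2
  have hgg : LinearMap.toMatrix' g.symm.toLinearEquiv.toLinearMap *
      LinearMap.toMatrix' g.toLinearEquiv.toLinearMap = 1 := by
    rw [← LinearMap.toMatrix'_comp, ← LinearMap.toMatrix'_id]
    congr 1
    exact LinearMap.ext fun x => g.toLinearEquiv.symm_apply_apply x
  have hgg' : LinearMap.toMatrix' g.toLinearEquiv.toLinearMap *
      LinearMap.toMatrix' g.symm.toLinearEquiv.toLinearMap = 1 := by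
    rw [← LinearMap.toMatrix'_comp, ← LinearMap.toMatrix'_id]
    congr 1
    exact LinearMap.ext fun x => g.toLinearEquiv.apply_symm_apply x
  generalize LinearMap.toMatrix' g.symm.toLinearEquiv.toLinearMap = M at hdiag hgg hgg'
  generalize LinearMap.toMatrix' g.toLinearEquiv.toLinearMap = N at hgg hgg'
  refine ⟨_, _, M.submatrix id f.symm, N.submatrix f.symm id, ?_, ?_, ?_⟩
  · rw [Matrix.submatrix_mul_equiv, hgg, Matrix.submatrix_id_id]
  · rw [← Matrix.submatrix_mul _ _ _ _ _ Function.bijective_id, hgg',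
      Matrix.submatrix_one_equiv]
  · clear g
    rw [Matrix.transpose_submatrix, ← Matrix.submatrix_id_id K,
      ← Matrix.submatrix_mul _ _ _ _ _ Function.bijective_id,
      ← Matrix.submatrix_mul _ _ _ _ _ Function.bijective_id, hdiag, Matrix.submatrix_diagonal_equiv]
    congr 1
    funext k
    rcases k with k | k
    · exact (((Fintype.equivFin {i // w i = 1}).symm k).2 :)
    · exact ((hw _).resolve_right ((Fintype.equivFin {i // ¬ w i = 1}).symm k).2 :)

section Quadratic
variable {ι : Type} [Fintype ι] [DecidableEq ι] {p : ι → ZMod 2}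

/-- The quadratic function with the matrix `K`. -/
def quadratic (p : ι → ZMod 2) (K : Matrix ι ι ℝ) : SPoly p :=
  (1 / 2 : ℝ) • ∑ u, ∑ v, K u v • (gen p u * gen p v)

/-- `K` is the matrix of an even supersymmetric bilinear form. -/
structure IsSupersymm (p : ι → ZMod 2) (K : Matrix ι ι ℝ) : Prop where
  even : ∀ u v, K u v ≠ 0 → p u = p v
  symm : ∀ u v, K u v = sgn (p u) * K v u

theorem IsSupersymm.pderiv_quadratic {K : Matrix ι ι ℝ} (hK : IsSupersymm p K) (u : ι) :
    pderiv p u (quadratic p K) = ∑ v, K u v • gen p v := by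
  have h : ∀ a b, K a b • pderiv p u (gen p a * gen p b) =
      (if u = a then K a b • gen p b else 0) + if u = b then K b a • gen p a else 0 := by
    intro a b
    rw [pderiv_gen_mul, pderiv_gen, smul_add]
    congr 1
    · split_ifs <;> simp
    · by_cases hub : u = b
      · subst hub
        rw [if_pos rfl, if_pos rfl, mul_one, smul_smul]
        by_cases h0 : K u a = 0
        · rw [hK.symm a u, h0]
          simp
        · rw [hK.symm a u, hK.even u a h0, mul_right_comm]
          congr 1
          rcases zmod2_cases (p a) with h | h <;> simp [h]
      · rw [if_neg hub, if_neg hub, mul_zero, smul_zero, smul_zero]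
  simp only [quadratic, map_smul, map_sum, h, Finset.sum_add_distrib]
  rw [Finset.sum_comm]
  simp only [Finset.sum_ite_eq, Finset.mem_univ, if_true]
  module

/-- An inverse of the Gram matrix expresses every coordinate in the derivatives of the quadratic
function. -/
theorem IsSupersymm.nondeg {K H : Matrix ι ι ℝ} (hK : IsSupersymm p K) (hH : H * K = 1) :
    Nondeg (quadratic p K) := by
  refine ⟨H, fun v => ?_⟩
  simp only [hK.pderiv_quadratic, Finset.smul_sum, smul_smul]
  rw [Finset.sum_comm]
  simp only [← Finset.sum_smul]
  have h : ∀ w, ∑ u, H v u * K u w = if v = w then 1 else 0 := fun w => by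
    rw [← Matrix.mul_apply, hH, Matrix.one_apply]
  simp [h]

theorem LinCoords.subst_quadratic (C : LinCoords p) (K : Matrix ι ι ℝ) :
    C.subst (quadratic p K) = quadratic _ (C.M.transpose * K * C.M) := by
  simp only [quadratic, map_smul, map_sum, map_mul, C.subst_gen, Finset.sum_mul_sum,
    smul_mul_smul_comm, Matrix.mul_apply, Finset.sum_smul]
  congr 1
  simp only [Finset.smul_sum, smul_smul, Matrix.transpose_apply, Finset.sum_mul, Finset.sum_smul]
  calc _ = ∑ u, ∑ k, ∑ v, ∑ l, (K u v * (C.M u k * C.M v l)) • (gen (parC C.a C.b C.s) k *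
          gen (parC C.a C.b C.s) l) := Finset.sum_congr rfl fun u _ => Finset.sum_comm
    _ = _ := Finset.sum_comm
    _ = ∑ k, ∑ u, ∑ l, ∑ v, (K u v * (C.M u k * C.M v l)) • (gen (parC C.a C.b C.s) k *
          gen (parC C.a C.b C.s) l) :=
      Finset.sum_congr rfl fun k _ => Finset.sum_congr rfl fun u _ => Finset.sum_comm
    _ = _ := Finset.sum_congr rfl fun k _ => Finset.sum_comm
    _ = _ := Finset.sum_congr rfl fun k _ => Finset.sum_congr rfl fun l _ => by
      rw [Finset.sum_comm]
      exact Finset.sum_congr rfl fun v _ => Finset.sum_congr rfl fun u _ => by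
        congr 1; ring

/-- The even block is diagonalized by Sylvester's law of inertia; the odd coordinates are kept. -/
theorem IsSupersymm.nonempty_gaussCoords {K H : Matrix ι ι ℝ} (hK : IsSupersymm p K)
    (hH : H * K = 1) : Nonempty (GaussCoords (quadratic p K)) := by
  classical
  let K₀ : Matrix {u // p u = 0} {u // p u = 0} ℝ := K.submatrix Subtype.val Subtype.val
  have hinv : K₀ * H.submatrix Subtype.val Subtype.val = 1 := by
    ext u v
    have h1 : (K * H) u.1 v.1 = (1 : Matrix ι ι ℝ) u.1 v.1 := by
      rw [mul_eq_one_comm.1 hH]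
    rw [Matrix.mul_apply, ← Fintype.sum_subtype_add_sum_subtype (fun u => p u = 0)
      (fun c => K u.1 c * H c v.1)] at h1
    rw [Finset.sum_eq_zero (s := (Finset.univ : Finset {u // ¬ p u = 0})), add_zero] at h1
    · rw [Matrix.mul_apply]
      refine h1.trans ?_
      simp only [Matrix.one_apply, Subtype.ext_iff]
    · intro c _
      by_cases h0 : K u.1 c.1 = 0
      · rw [h0, zero_mul]
      · exact absurd ((hK.even _ _ h0).symm.trans u.2) c.2
  obtain ⟨a, b, M₀, N₀, h1, h2, h3⟩ := exists_diagonalization K₀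
    (Matrix.IsSymm.ext fun u v => by
      change K v.1 u.1 = K u.1 v.1
      rw [hK.symm, v.2, sgn_zero, one_mul]) (by
    rw [Matrix.separatingLeft_iff_forall_vecMul_eq_zero]
    intro x hx
    rw [← Matrix.vecMul_one x, ← hinv, ← Matrix.vecMul_vecMul, hx, Matrix.zero_vecMul])
  let f : ι ≃ {u // p u = 0} ⊕ {u // ¬ p u = 0} := (Equiv.sumCompl fun u => p u = 0).symm
  let g : (Fin a ⊕ Fin b) ⊕ Fin (Fintype.card {u // ¬ p u = 0}) ≃
      (Fin a ⊕ Fin b) ⊕ {u // ¬ p u = 0} :=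
    Equiv.sumCongr (Equiv.refl _) (Fintype.equivFin {u // ¬ p u = 0}).symm
  let C : LinCoords p :=
    { a := a, b := b, s := Fintype.card {u // ¬ p u = 0}
      M := (Matrix.fromBlocks M₀ 0 0 1).submatrix f g
      N := (Matrix.fromBlocks N₀ 0 0 1).submatrix g f
      mul_inv := by
        rw [Matrix.submatrix_mul_equiv, Matrix.fromBlocks_multiply]
        simp [h1]
      inv_mul := by
        rw [Matrix.submatrix_mul_equiv, Matrix.fromBlocks_multiply]
        simp [h2]
      even := by
        intro j k hjk
        obtain ⟨j, rfl⟩ := f.symm.surjective j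
        rw [Matrix.submatrix_apply, Equiv.apply_symm_apply] at hjk
        rcases j with j | j <;> rcases k with k | k
        · exact j.2
        · exact absurd rfl hjk
        · exact absurd rfl hjk
        · exact (zmod2_cases (p j.1)).resolve_left j.2 }
  have hM : ∀ u i, C.M (f.symm u) i = Matrix.fromBlocks M₀ 0 0 1 u (g i) := fun u i => by
    change Matrix.fromBlocks M₀ 0 0 1 (f (f.symm u)) (g i) = _
    rw [Equiv.apply_symm_apply]
  let K' := C.M.transpose * K * C.M
  have hee : ∀ i j, K' (Sum.inl i) (Sum.inl j) = C.signature i * if i = j then 1 else 0 := by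
    intro i j
    have h4 : K' (Sum.inl i) (Sum.inl j) = (M₀.transpose * K₀ * M₀) i j := by
      simp only [K', Matrix.mul_apply, Matrix.transpose_apply, ← f.symm.sum_comp, hM,
        Fintype.sum_sum_type]
      simp [g, f, K₀]
    rw [h4, h3, Matrix.diagonal_apply, mul_ite, mul_one, mul_zero]
    rfl
  have hmix : ∀ i j, parC C.a C.b C.s i ≠ parC C.a C.b C.s j → K' i j = 0 := by
    intro i j hij
    simp only [K', Matrix.mul_apply, Matrix.transpose_apply]
    refine Finset.sum_eq_zero fun v _ => ?_
    by_cases hv : C.M v j = 0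
    · rw [hv, mul_zero]
    rw [Finset.sum_eq_zero, zero_mul]
    intro u _
    by_cases hu : C.M u i = 0
    · rw [hu, zero_mul]
    by_cases hK0 : K u v = 0
    · rw [hK0, mul_zero]
    exact absurd ((C.even u i hu).symm.trans ((hK.even u v hK0).trans (C.even v j hv))) hij
  have heo : ∀ i j, K' (Sum.inl i) (Sum.inr j) = 0 := fun i j =>
    hmix _ _ (by simp [parC])
  have hoe : ∀ i j, K' (Sum.inr i) (Sum.inl j) = 0 := fun i j =>
    hmix _ _ (by simp [parC])
  refine ⟨{ C with c := fun i j => 1 / 2 * K' (Sum.inr i) (Sum.inr j), sigma_eq := ?_ }⟩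
  rw [C.subst_quadratic K, quadratic]
  change (1 / 2 : ℝ) • ∑ u, ∑ v, K' u v • _ = _
  simp only [Fintype.sum_sum_type (α₁ := Fin C.a ⊕ Fin C.b), hee, heo, hoe, zero_smul,
    Finset.sum_const_zero, add_zero, zero_add, smul_add]
  congr 1
  · congr 1
    simp only [mul_ite, mul_one, mul_zero, ite_smul, zero_smul, Finset.sum_ite_eq, Finset.mem_univ,
      if_true, Fintype.sum_sum_type, LinCoords.signature, Sum.elim_inl, Sum.elim_inr, one_smul,
      ← pow_two]
    rw [sub_eq_add_neg, ← Finset.sum_neg_distrib]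
    congr 1
  · simp only [Finset.smul_sum, smul_smul]
    rfl

end Quadratic
end DualConstruction

namespace DualConstruction
open SuperAlg (J)

/-! ### The unital extension of a Frobenius algebra -/

namespace FrobeniusDGA
variable {A : Type*} [NonUnitalRing A] [Module ℝ A]
  {𝒜 : ZMod 2 → Submodule ℝ A} [DirectSum.Decomposition 𝒜]

variable (𝒜) in
/-- The parity involution of a `ℤ/2`-graded vector space. -/
def inv : A →ₗ[ℝ] A :=
  ∑ i, sgn i • ((𝒜 i).subtype ∘ₗ (DirectSum.component ℝ (ZMod 2) (fun i => 𝒜 i) i) ∘ₗ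
    (DirectSum.decomposeLinearEquiv 𝒜).toLinearMap)

theorem inv_of_mem {i : ZMod 2} {a : A} (ha : a ∈ 𝒜 i) : inv 𝒜 a = sgn i • a := by
  have h : ∀ j, (((𝒜 j).subtype ∘ₗ (DirectSum.component ℝ (ZMod 2) (fun i => 𝒜 i) j) ∘ₗ
      (DirectSum.decomposeLinearEquiv 𝒜).toLinearMap) a) =
      (DirectSum.decompose 𝒜 a j : A) := fun j => rfl
  simp only [inv, LinearMap.sum_apply, LinearMap.smul_apply, h]
  rw [Finset.sum_eq_single i]
  · rw [DirectSum.decompose_of_mem_same 𝒜 ha]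
  · intro j _ hj
    rw [DirectSum.decompose_of_mem_ne 𝒜 ha hj.symm, smul_zero]
  · simp

theorem graded_induction {Q : A → Prop} (add : ∀ a b, Q a → Q b → Q (a + b))
    (h : ∀ i, ∀ a ∈ 𝒜 i, Q a) (a : A) : Q a := by
  induction a using DirectSum.Decomposition.inductionOn 𝒜 with
  | zero => exact h 0 0 (Submodule.zero_mem _)
  | homogeneous m => exact h _ _ m.2
  | add a b ha hb => exact add a b ha hb

theorem inv_inv (a : A) : inv 𝒜 (inv 𝒜 a) = a := by
  induction a using graded_induction (𝒜 := 𝒜) with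
  | add a b ha hb => rw [map_add, map_add, ha, hb]
  | h i a ha => rw [inv_of_mem ha, map_smul, inv_of_mem ha, sgn_smul_self_smul]

theorem mem_of_inv {i : ZMod 2} {a : A} (h : inv 𝒜 a = sgn i • a) : a ∈ 𝒜 i := by
  have h1 : a = (1 / 2 : ℝ) • (a + sgn i • inv 𝒜 a) := by
    rw [h, sgn_smul_self_smul]
    module
  rw [h1]
  refine Submodule.smul_mem _ _ ?_
  clear h h1
  induction a using graded_induction (𝒜 := 𝒜) with
  | add a b ha hb =>
    have := Submodule.add_mem _ ha hb
    rw [map_add, smul_add]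
    convert this using 1
    abel
  | h j a ha =>
    rw [inv_of_mem ha, sgn_smul_sgn_smul]
    by_cases hij : j = i
    · subst hij
      exact Submodule.add_mem _ ha (Submodule.smul_mem _ _ ha)
    · have : i + j = 1 := by
        clear ha; revert i j; decide
      rw [this, sgn_one, neg_one_smul, add_neg_cancel]
      exact Submodule.zero_mem _

section
variable [IsScalarTower ℝ A A] [SMulCommClass ℝ A A] (F : FrobeniusDGA 𝒜)
include F in
theorem inv_mul (a b : A) : inv 𝒜 (a * b) = inv 𝒜 a * inv 𝒜 b := by
  induction a using graded_induction (𝒜 := 𝒜) with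
  | add a a' ha ha' => simp only [add_mul, map_add, ha, ha']
  | h i a ha =>
    induction b using graded_induction (𝒜 := 𝒜) with
    | add b b' hb hb' => simp only [mul_add, map_add, hb, hb']
    | h j b hb =>
      rw [inv_of_mem ha, inv_of_mem hb, inv_of_mem (F.mul_mem ha hb), smul_mul_smul_comm, sgn_add]

end

variable (F : FrobeniusDGA 𝒜)

theorem form_inv (a b : A) : F.form (inv 𝒜 a) (inv 𝒜 b) = -F.form a b := by
  induction a using graded_induction (𝒜 := 𝒜) with
  | add a a' ha ha' => simp only [map_add, LinearMap.add_apply, ha, ha', neg_add]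
  | h i a ha =>
    induction b using graded_induction (𝒜 := 𝒜) with
    | add b b' hb hb' => simp only [map_add, hb, hb', neg_add]
    | h j b hb =>
      rw [inv_of_mem ha, inv_of_mem hb, map_smul, map_smul, LinearMap.smul_apply]
      by_cases hij : i = j
      · subst hij
        rw [F.form_odd ha hb]
        simp
      · have : j + i = 1 := by
          clear ha hb; revert i j; decide
        rw [smul_smul, ← sgn_add, this, sgn_one, neg_one_smul]

theorem inv_d (a : A) : inv 𝒜 (F.d a) = -F.d (inv 𝒜 a) := by
  induction a using graded_induction (𝒜 := 𝒜) with
  | add a a' ha ha' => simp only [map_add, ha, ha', neg_add]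
  | h i a ha =>
    rw [inv_of_mem ha, inv_of_mem (F.d_mem ha), map_smul, sgn_add, sgn_one, mul_neg_one, neg_smul]

theorem d_mul' [IsScalarTower ℝ A A] (a b : A) : F.d (a * b) = F.d a * b + inv 𝒜 a * F.d b := by
  induction a using graded_induction (𝒜 := 𝒜) with
  | add a a' ha ha' => simp only [map_add, add_mul, ha, ha']; abel
  | h i a ha => rw [inv_of_mem ha, F.d_mul ha, smul_mul_assoc]

theorem form_d' (a b : A) : F.form (F.d a) b + F.form (inv 𝒜 a) (F.d b) = 0 := by
  induction a using graded_induction (𝒜 := 𝒜) with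
  | add a a' ha ha' =>
    simp only [map_add, LinearMap.add_apply]
    linear_combination ha + ha'
  | h i a ha =>
    rw [inv_of_mem ha, map_smul, LinearMap.smul_apply, smul_eq_mul]
    exact F.form_d ha b

/-- The range of `d` is isotropic. -/
theorem form_d_d (a b : A) : F.form (F.d a) (F.d b) = 0 := by
  have h := F.form_d' a (F.d b)
  rwa [F.d_d, map_zero, add_zero] at h

/-- The augmentation ideal `A ⊕ ℝθ` of the unital extension, with `a b = ab + ⟨a,b⟩ θ`. -/
def Ideal (_ : FrobeniusDGA 𝒜) : Type _ := A × ℝ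

instance : AddCommGroup F.Ideal := inferInstanceAs (AddCommGroup (A × ℝ))
instance : Module ℝ F.Ideal := inferInstanceAs (Module ℝ (A × ℝ))

instance : NonUnitalRing F.Ideal :=
  { (inferInstance : AddCommGroup F.Ideal) with
    mul := fun x y => (x.1 * y.1, F.form x.1 y.1)
    left_distrib := fun x y z => Prod.ext (mul_add x.1 y.1 z.1) (map_add (F.form x.1) y.1 z.1)
    right_distrib := fun x y z => Prod.ext (add_mul x.1 y.1 z.1) (by
      change F.form (x.1 + y.1) z.1 = _
      rw [map_add]; rfl)
    zero_mul := fun x => Prod.ext (zero_mul x.1) (by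
      change F.form 0 x.1 = 0
      rw [map_zero]; rfl)
    mul_zero := fun x => Prod.ext (mul_zero x.1) (map_zero (F.form x.1))
    mul_assoc := fun x y z => Prod.ext (mul_assoc x.1 y.1 z.1) (F.form_assoc x.1 y.1 z.1) }

variable [IsScalarTower ℝ A A] [SMulCommClass ℝ A A]

instance : IsScalarTower ℝ F.Ideal F.Ideal where
  smul_assoc c x y := Prod.ext (smul_mul_assoc c x.1 y.1) (by
    change F.form (c • x.1) y.1 = c * F.form x.1 y.1
    rw [map_smul]; rfl)

instance : SMulCommClass ℝ F.Ideal F.Ideal where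
  smul_comm c x y := Prod.ext (mul_smul_comm c x.1 y.1).symm
    (map_smul (F.form x.1) c y.1).symm

/-- The unital extension `ℝ ⊕ A ⊕ ℝθ` of the algebra `A`, with `a b = ab + ⟨a,b⟩ θ`. -/
abbrev Ext : Type _ := Unitization ℝ F.Ideal

/-- The element `r + a + t θ` of the extension. -/
def elt (r : ℝ) (a : A) (t : ℝ) : F.Ext := Unitization.mk (r, ((a, t) : A × ℝ))

theorem ext_cases (x : F.Ext) : ∃ r a t, x = F.elt r a t := ⟨x.fst, x.snd.1, x.snd.2, rfl⟩

theorem elt_mul_elt (r r' : ℝ) (a a' : A) (t t' : ℝ) : F.elt r a t * F.elt r' a' t' =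
    F.elt (r * r') (r • a' + r' • a + a * a') (r * t' + r' * t + F.form a a') := rfl

theorem elt_add_elt (r r' : ℝ) (a a' : A) (t t' : ℝ) : F.elt r a t + F.elt r' a' t' =
    F.elt (r + r') (a + a') (t + t') := rfl

theorem smul_elt (c r : ℝ) (a : A) (t : ℝ) : c • F.elt r a t =
    F.elt (c * r) (c • a) (c * t) := rfl

theorem elt_inj {r r' : ℝ} {a a' : A} {t t' : ℝ} :
    F.elt r a t = F.elt r' a' t' ↔ r = r' ∧ a = a' ∧ t = t' := by
  constructor
  · intro h
    exact ⟨congrArg (fun x : F.Ext => x.fst) h, congrArg (fun x : F.Ext => x.snd.1) h,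
      congrArg (fun x : F.Ext => x.snd.2) h⟩
  · rintro ⟨rfl, rfl, rfl⟩
    rfl

theorem one_eq_elt : (1 : F.Ext) = F.elt 1 0 0 := rfl

/-- A linear map of the extension in components. -/
def extMap (α : ℝ) (φ : A →ₗ[ℝ] A) (β : ℝ) : F.Ext →ₗ[ℝ] F.Ext where
  toFun x := F.elt (α * x.fst) (φ x.snd.1) (β * x.snd.2)
  map_add' x y := by
    obtain ⟨r, a, t, rfl⟩ := F.ext_cases x
    obtain ⟨r', a', t', rfl⟩ := F.ext_cases y
    change F.elt (α * (r + r')) (φ (a + a')) (β * (t + t')) = F.elt _ _ _ + F.elt _ _ _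
    rw [mul_add, mul_add, map_add, elt_add_elt]
    rfl
  map_smul' c x := by
    obtain ⟨r, a, t, rfl⟩ := F.ext_cases x
    change F.elt (α * (c * r)) (φ (c • a)) (β * (c * t)) = c • F.elt (α * r) (φ a) (β * t)
    rw [map_smul, smul_elt]
    congr 1 <;> ring

theorem extMap_elt (α : ℝ) (φ : A →ₗ[ℝ] A) (β r : ℝ) (a : A) (t : ℝ) :
    F.extMap α φ β (F.elt r a t) = F.elt (α * r) (φ a) (β * t) := rfl

/-- Supercommutativity of the unital extension. The trace coordinate has odd parity, and the
hypotheses say that the two elements are homogeneous of parities `i` and `j`. -/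
theorem supercomm {i j : ZMod 2} {r r' : ℝ} {a a' : A} {t t' : ℝ}
    (h : F.elt (1 * r) (inv 𝒜 a) (-1 * t) = sgn i • F.elt r a t)
    (h' : F.elt (1 * r') (inv 𝒜 a') (-1 * t') = sgn j • F.elt r' a' t') :
    F.elt r a t * F.elt r' a' t' = sgn (i * j) • (F.elt r' a' t' * F.elt r a t) := by
  rw [smul_elt, elt_inj] at h h'
  obtain ⟨h1, h2, h3⟩ := h
  obtain ⟨h1', h2', h3'⟩ := h'
  have ha := mem_of_inv h2
  have ha' := mem_of_inv h2'
  rw [elt_mul_elt, elt_mul_elt, smul_elt, elt_inj, F.mul_comm ha ha', F.form_symm ha ha']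
  rcases zmod2_cases i with rfl | rfl <;> rcases zmod2_cases j with rfl | rfl <;>
    simp only [mul_zero, mul_one, sgn_zero, sgn_one, one_mul] at h1 h1' h3 h3' ⊢
  · exact ⟨by ring, by module, by ring⟩
  · exact ⟨by ring, by module, by ring⟩
  · exact ⟨by ring, by module, by ring⟩
  · have hr : r = 0 := by linarith
    have hr' : r' = 0 := by linarith
    subst hr hr'
    refine ⟨by ring, by module, by ring⟩

instance : SuperAlg F.Ext where
  J := AlgHom.ofLinearMap (F.extMap 1 (inv 𝒜) (-1)) (by
      rw [one_eq_elt, extMap_elt]; simp) (fun x y => by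
    obtain ⟨r, a, t, rfl⟩ := F.ext_cases x
    obtain ⟨r', a', t', rfl⟩ := F.ext_cases y
    rw [extMap_elt, extMap_elt, elt_mul_elt, elt_mul_elt, extMap_elt, elt_inj]
    refine ⟨by ring, ?_, ?_⟩
    · rw [map_add, map_add, map_smul, map_smul, F.inv_mul, one_mul, one_mul]
    · rw [form_inv]; ring)
  J_J x := by
    obtain ⟨r, a, t, rfl⟩ := F.ext_cases x
    change F.extMap 1 (inv 𝒜) (-1) (F.extMap 1 (inv 𝒜) (-1) _) = _
    rw [extMap_elt, extMap_elt, inv_inv]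
    simp
  comm {i j x y} hx hy := by
    obtain ⟨r, a, t, rfl⟩ := F.ext_cases x
    obtain ⟨r', a', t', rfl⟩ := F.ext_cases y
    exact F.supercomm hx hy

theorem J_elt (r : ℝ) (a : A) (t : ℝ) : J (F.elt r a t) = F.elt (1 * r) (inv 𝒜 a) (-1 * t) := rfl

/-- The inclusion of `A` in its extension; it is not multiplicative. -/
def incl : A →ₗ[ℝ] F.Ext where
  toFun a := F.elt 0 a 0
  map_add' a b := by rw [elt_add_elt, add_zero]
  map_smul' c a := by rw [smul_elt, mul_zero]; rfl

theorem incl_mem {i : ZMod 2} {a : A} (ha : a ∈ 𝒜 i) : F.incl a ∈ par F.Ext i := by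
  change F.elt (1 * 0) (inv 𝒜 a) (-1 * 0) = sgn i • F.elt 0 a 0
  rw [inv_of_mem ha, smul_elt, mul_zero, mul_zero, mul_zero]

/-- The coefficient of `θ`. -/
def trace : F.Ext →ₗ[ℝ] ℝ where
  toFun x := x.snd.2
  map_add' _ _ := rfl
  map_smul' _ _ := rfl

/-- The augmentation of the extension. -/
def aug : F.Ext →ₗ[ℝ] ℝ where
  toFun x := x.fst
  map_add' _ _ := rfl
  map_smul' _ _ := rfl

/-- The component in `A`. -/
def toA : F.Ext →ₗ[ℝ] A where
  toFun x := x.snd.1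
  map_add' _ _ := rfl
  map_smul' _ _ := rfl

theorem trace_elt (r : ℝ) (a : A) (t : ℝ) : F.trace (F.elt r a t) = t := rfl
theorem aug_elt (r : ℝ) (a : A) (t : ℝ) : F.aug (F.elt r a t) = r := rfl
theorem incl_apply (a : A) : F.incl a = F.elt 0 a 0 := rfl

theorem trace_incl_mul_incl (a b : A) : F.trace (F.incl a * F.incl b) = F.form a b := by
  rw [incl_apply, incl_apply, elt_mul_elt, trace_elt]
  ring

/-- The projection to `A`, followed by an endomorphism of `A`. -/
def extEnd (φ : A →ₗ[ℝ] A) : F.Ext →ₗ[ℝ] F.Ext := F.incl ∘ₗ φ ∘ₗ F.toA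

theorem extEnd_elt (φ : A →ₗ[ℝ] A) (r : ℝ) (a : A) (t : ℝ) :
    F.extEnd φ (F.elt r a t) = F.elt 0 (φ a) 0 := rfl

theorem isSDer_extEnd_d : IsSDer 1 (F.extEnd F.d) where
  leibniz x y := by
    obtain ⟨r, a, t, rfl⟩ := F.ext_cases x
    obtain ⟨r', a', t', rfl⟩ := F.ext_cases y
    rw [Jp_one, J_elt, elt_mul_elt, extEnd_elt, extEnd_elt, extEnd_elt, elt_mul_elt, elt_mul_elt,
      elt_add_elt, elt_inj]
    refine ⟨by ring, ?_, ?_⟩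
    · rw [map_add, map_add, map_smul, map_smul, F.d_mul']
      module
    · linear_combination -(F.form_d' a a')
  parity x := by
    obtain ⟨r, a, t, rfl⟩ := F.ext_cases x
    rw [J_elt, extEnd_elt, extEnd_elt, J_elt, smul_elt, elt_inj, F.inv_d, sgn_one, neg_one_smul]
    simp

end FrobeniusDGA
end DualConstruction

namespace DualConstruction
open SuperAlg (J)

/-! ### The superfields of a gauge -/

section OrderedProducts

theorem sum_Iio_last {M : Type*} [AddCommMonoid M] {N : ℕ} (f : Fin (N + 1) → M) :
    ∑ i ∈ Finset.Iio (Fin.last N), f i = ∑ i : Fin N, f i.castSucc := by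
  rw [Fin.Iio_last_eq_map, Finset.sum_map]
  rfl

variable {B S : Type*} [Ring B] [Algebra ℝ B] [SuperAlg B] [Ring S] [Algebra ℝ S] [SuperAlg S]

theorem ofFn_prod_mem {R : Type*} [Ring R] [Algebra ℝ R] [SuperAlg R] {N : ℕ} {s : Fin N → R}
    {P : Fin N → ZMod 2} (h : ∀ i, s i ∈ par R (P i)) :
    (List.ofFn s).prod ∈ par R (∑ i, P i) := by
  induction N with
  | zero => simpa using one_mem_par
  | succ N ih =>
    rw [List.ofFn_succ, List.prod_cons, Fin.sum_univ_succ]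
    exact mul_mem_par (h 0) (ih fun i => h i.succ)

/-- The product of decomposable tensors: the sign is collected from moving `b j` to the left past
all `s i` with `i < j`. -/
theorem ofFn_prod_tm {N : ℕ} {b : Fin N → B} {s : Fin N → S} {P q : Fin N → ZMod 2}
    (hs : ∀ i, s i ∈ par S (P i)) (hb : ∀ i, b i ∈ par B (q i)) :
    (List.ofFn fun i => tm (b i) (s i)).prod =
      sgn (∑ j, ∑ i ∈ Finset.Iio j, P i * q j) • tm (List.ofFn b).prod (List.ofFn s).prod := by
  induction N with
  | zero => simp [tm_one_one]
  | succ N ih =>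
    rw [List.ofFn_succ', List.ofFn_succ', List.ofFn_succ', List.concat_eq_append,
      List.concat_eq_append, List.concat_eq_append, List.prod_append, List.prod_append,
      List.prod_append, List.prod_singleton, List.prod_singleton, List.prod_singleton,
      ih (fun i => hs i.castSucc) (fun i => hb i.castSucc), smul_mul_assoc,
      tm_mul_tm _ (ofFn_prod_mem fun i : Fin N => hs i.castSucc) (hb _), sgn_smul_sgn_smul,
      Fin.sum_univ_castSucc, sum_Iio_last, Finset.sum_mul]
    simp only [Fin.sum_Iio_castSucc]

end OrderedProducts

namespace FrobeniusDGA
variable {A : Type*} [NonUnitalRing A] [Module ℝ A] [IsScalarTower ℝ A A] [SMulCommClass ℝ A A]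
  {𝒜 : ZMod 2 → Submodule ℝ A} [DirectSum.Decomposition 𝒜] (F : FrobeniusDGA 𝒜)
  {L : Submodule ℝ A} {r : ℕ} {q : Fin r → ZMod 2} {n m : ℕ}

theorem IsGauge.form_eq_zero {F : FrobeniusDGA 𝒜} (hL : F.IsGauge L) {a b : A} (ha : a ∈ L)
    (hb : b ∈ L) : F.form a b = 0 := hL.isotropic.2 a ha b hb

/-- The coordinates of the projection to `L` along `d A`. -/
def gaugeCoord (hL : F.IsGauge L) (e : Module.Basis (Fin r) ℝ L) (a : Fin r) : A →ₗ[ℝ] ℝ :=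
  e.coord a ∘ₗ L.projectionOnto (LinearMap.range F.d) hL.isCompl

theorem gaugeCoord_d (hL : F.IsGauge L) (e : Module.Basis (Fin r) ℝ L) (a : Fin r) (x : A) :
    F.gaugeCoord hL e a (F.d x) = 0 := by
  rw [gaugeCoord, LinearMap.comp_apply,
    (Submodule.projectionOnto_apply_eq_zero_iff hL.isCompl).2 ⟨x, rfl⟩, map_zero]

theorem gaugeCoord_coe (hL : F.IsGauge L) (e : Module.Basis (Fin r) ℝ L) (a : Fin r) (l : L) :
    F.gaugeCoord hL e a l = e.coord a l := by
  rw [gaugeCoord, LinearMap.comp_apply, Submodule.projectionOnto_apply_left]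

theorem gaugeCoord_basis (hL : F.IsGauge L) (e : Module.Basis (Fin r) ℝ L) (a b : Fin r) :
    F.gaugeCoord hL e a (e b) = if a = b then 1 else 0 := by
  rw [gaugeCoord_coe, Module.Basis.coord_apply, Module.Basis.repr_self, Finsupp.single_apply]
  simp only [eq_comm]

/-- Every element is the sum of its projection to `L` and a boundary. -/
theorem exists_gauge_decomp (hL : F.IsGauge L) (e : Module.Basis (Fin r) ℝ L) (x : A) :
    ∃ y, x = ∑ c, F.gaugeCoord hL e c x • (e c : A) + F.d y := by
  obtain ⟨y, hy⟩ := Submodule.sub_projection_mem hL.isCompl x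
  refine ⟨y, ?_⟩
  have h : ∑ c, F.gaugeCoord hL e c x • (e c : A) =
      L.projection (LinearMap.range F.d) hL.isCompl x := by
    rw [← Submodule.coe_projectionOnto_apply]
    conv_rhs => rw [← e.sum_repr (L.projectionOnto (LinearMap.range F.d) hL.isCompl x)]
    rw [Submodule.coe_sum]
    rfl
  rw [h, hy]
  abel

theorem gaugeCoord_inv (hL : F.IsGauge L) (e : Module.Basis (Fin r) ℝ L)
    (he : ∀ a, (e a : A) ∈ 𝒜 (q a)) (a : Fin r) (x : A) :
    F.gaugeCoord hL e a (inv 𝒜 x) = sgn (q a) * F.gaugeCoord hL e a x := by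
  obtain ⟨y, hy⟩ := F.exists_gauge_decomp hL e x
  conv_lhs => rw [hy]
  simp only [map_add, map_sum, map_smul, inv_of_mem (he _), F.inv_d, map_neg, gaugeCoord_d,
    gaugeCoord_basis]
  simp
  ring

/-- The gauge data of a gauge with a homogeneous basis. -/
def gauge (hL : F.IsGauge L) (e : Module.Basis (Fin r) ℝ L) (he : ∀ a, (e a : A) ∈ 𝒜 (q a)) :
    GaugeData F.Ext q where
  e a := F.incl (e a)
  e_mem a := F.incl_mem (he a)
  τ := F.trace
  τ_odd x := by
    obtain ⟨r, a, t, rfl⟩ := F.ext_cases x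
    rw [J_elt, trace_elt, trace_elt, sgn_one]
  ε := F.aug
  ε_even x := by
    obtain ⟨r, a, t, rfl⟩ := F.ext_cases x
    rw [J_elt, aug_elt, aug_elt, sgn_zero]
  ε_mul x y := rfl
  ε_e a := rfl
  d := F.extEnd F.d
  d_der := F.isSDer_extEnd_d
  τ_d x := rfl
  ε_d x := rfl
  π a := F.gaugeCoord hL e a ∘ₗ F.toA
  π_par a x := by
    obtain ⟨r, x, t, rfl⟩ := F.ext_cases x
    exact F.gaugeCoord_inv hL e he a x
  π_d a x := F.gaugeCoord_d hL e a (F.toA x)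
  π_e a b := F.gaugeCoord_basis hL e a b
  lagrangian x x' := by
    obtain ⟨r, a, t, rfl⟩ := F.ext_cases x
    obtain ⟨r', a', t', rfl⟩ := F.ext_cases x'
    rw [show ∑ c, (F.gaugeCoord hL e c ∘ₗ F.toA) (F.elt r a t) • F.incl (e c : A) =
        F.incl (∑ c, F.gaugeCoord hL e c a • (e c : A)) by
          rw [map_sum]; exact Finset.sum_congr rfl fun c _ => (map_smul F.incl _ _).symm,
      show ∑ c, (F.gaugeCoord hL e c ∘ₗ F.toA) (F.elt r' a' t') • F.incl (e c : A) =
        F.incl (∑ c, F.gaugeCoord hL e c a' • (e c : A)) by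
          rw [map_sum]; exact Finset.sum_congr rfl fun c _ => (map_smul F.incl _ _).symm]
    simp only [incl_apply, elt_mul_elt, trace_elt, aug_elt]
    obtain ⟨y, hy⟩ := F.exists_gauge_decomp hL e a
    obtain ⟨y', hy'⟩ := F.exists_gauge_decomp hL e a'
    have hp : ∀ x, ∑ c, F.gaugeCoord hL e c x • (e c : A) ∈ L := fun x =>
      Submodule.sum_mem _ fun c _ => Submodule.smul_mem _ _ (e c).2
    have h1 := hL.form_eq_zero (hp a) (hp a')
    have h2 := F.form_d_d y y'
    generalize ∑ c, F.gaugeCoord hL e c a • (e c : A) = l at *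
    generalize ∑ c, F.gaugeCoord hL e c a' • (e c : A) = l' at *
    rw [hy, hy']
    simp only [map_add, LinearMap.add_apply, h1, h2]
    ring

section Basis
variable (hL : F.IsGauge L) (e : Module.Basis (Fin r) ℝ L) (he : ∀ a, (e a : A) ∈ 𝒜 (q a))

theorem trace_elt_mul_prod (a : A) (t : ℝ) (b : A) (l : List A) :
    F.trace (F.elt 0 a t * ((b :: l).map F.incl).prod) = F.iterForm a (b :: l) := by
  induction l generalizing a t b with
  | nil =>
    rw [List.map_cons, List.map_nil, List.prod_cons, List.prod_nil, mul_one, incl_apply,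
      elt_mul_elt, trace_elt, iterForm]
    ring
  | cons c l ih =>
    rw [List.map_cons, List.prod_cons, ← mul_assoc, incl_apply, elt_mul_elt, iterForm, zero_smul,
      zero_smul, zero_add, zero_add, mul_zero, ih]

/-- The cyclic tensor is the trace of the product in the unital extension. -/
theorem trace_prod {N : ℕ} (hN : 2 ≤ N) (a : Fin N → A) :
    F.trace (List.ofFn fun i => F.incl (a i)).prod = F.mTilde a := by
  obtain ⟨N, rfl⟩ := Nat.exists_eq_add_of_le' hN
  rw [show (List.ofFn fun i => F.incl (a i)) = (List.ofFn a).map F.incl by rw [List.map_ofFn]; rfl,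
    mTilde]
  simp only [List.ofFn_succ]
  rw [List.map_cons, List.prod_cons, incl_apply, trace_elt_mul_prod]

/-- On monomials, the trace of the value at the generic point is `Ψ`. -/
theorem psi_monomial {N : ℕ} (hN : 2 ≤ N) (w : Fin N → Coord n m) :
    (F.gauge hL e he).psi (monomial (parV n m) w) = F.Psi (fun a => (e a : A)) q w := by
  rw [GaugeData.psi_apply, monomial, map_list_prod, List.map_ofFn]
  have h1 : (⇑(F.gauge hL e he).ev ∘ fun i => gen (parV n m) (w i)) = fun i => ∑ a,
      tm ((F.gauge hL e he).e a) (gen (parLV n m q) (a, w i)) := by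
    funext i
    rw [Function.comp_apply, GaugeData.ev_gen, GaugeData.X]
  rw [h1, ← MultilinearMap.mkPiAlgebraFin_apply (R := ℝ), MultilinearMap.map_sum, map_sum, Psi]
  refine Finset.sum_congr rfl fun a _ => ?_
  rw [MultilinearMap.mkPiAlgebraFin_apply,
    ofFn_prod_tm (fun i => gen_mem_par (parLV n m q) (a i, w i))
      (fun i => (F.gauge hL e he).e_mem (a i)), map_smul, slice_tm, smul_smul, monomial]
  congr 2
  · simp only [parLV, add_mul]
  · exact F.trace_prod hN fun i => (e (a i) : A)

/-- The matrix of the quadratic function `σ`. -/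
def gramMatrix (n m : ℕ) (q : Fin r → ZMod 2) (e : Fin r → A) :
    Matrix (Fin r × Coord n m) (Fin r × Coord n m) ℝ := fun u v =>
  sgn (parV n m u.2 * (1 + q u.1)) * (F.form (e u.1) (F.d (e v.1)) * formV u.2 v.2)

theorem formV_eq_zero {i j : Coord n m} (h : parV n m i ≠ parV n m j) : formV i j = 0 := by
  rcases i with (i | i) | i <;> rcases j with (j | j) | j <;>
    first | rfl | exact absurd rfl h

theorem formV_symm (i j : Coord n m) : formV i j = -sgn (parV n m i) * formV j i := by
  rcases i with (i | i) | i <;> rcases j with (j | j) | j <;>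
    simp [formV, eq_comm]

theorem form_e_d_e_eq_zero {e : Fin r → A} (he : ∀ a, e a ∈ 𝒜 (q a)) {a b : Fin r}
    (h : q a ≠ q b) : F.form (e a) (F.d (e b)) = 0 := by
  have h1 : q b + 1 = q a := by
    generalize q a = x at h ⊢
    generalize q b = y at h ⊢
    revert x y; decide
  exact F.form_odd (he a) (h1 ▸ F.d_mem (he b))

/-- The form of `σ̃` used for Gaussian integration. -/
theorem sigma_eq_quadratic {e : Fin r → A} (he : ∀ a, e a ∈ 𝒜 (q a)) :
    F.sigma e q = quadratic (parLV n m q) (F.gramMatrix n m q e) := by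
  rw [sigma, quadratic]
  congr 1
  refine Finset.sum_congr rfl fun u _ => Finset.sum_congr rfl fun v _ => ?_
  rw [dualCoord, dualCoord, smul_mul_smul_comm, smul_smul]
  congr 1
  rw [formLV, gramMatrix]
  by_cases h1 : q u.1 = q v.1
  · by_cases h2 : parV n m u.2 = parV n m v.2
    · simp only [parLV, ← h1, ← h2]
      generalize q u.1 = x
      generalize parV n m u.2 = y
      generalize F.form (e u.1) (F.d (e v.1)) = c
      rcases zmod2_cases x with rfl | rfl <;> rcases zmod2_cases y with rfl | rfl <;>
        simp [show (1 : ZMod 2) + 1 = 0 from rfl]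
    · rw [formV_eq_zero h2]; simp
  · rw [F.form_e_d_e_eq_zero he h1]; simp

theorem gramMatrix_supersymm {e : Fin r → A} (he : ∀ a, e a ∈ 𝒜 (q a)) :
    IsSupersymm (parLV n m q) (F.gramMatrix n m q e) where
  even u v h := by
    rw [gramMatrix] at h
    by_cases h1 : q u.1 = q v.1
    · by_cases h2 : parV n m u.2 = parV n m v.2
      · simp only [parLV, h1, h2]
      · exact absurd (by rw [formV_eq_zero h2]; simp) h
    · exact absurd (by rw [F.form_e_d_e_eq_zero he h1]; simp) h
  symm u v := by
    rw [gramMatrix, gramMatrix, formV_symm v.2 u.2]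
    by_cases h1 : q u.1 = q v.1
    · by_cases h2 : parV n m u.2 = parV n m v.2
      · have h3 : F.form (e v.1) (F.d (e u.1)) = -sgn (q u.1) * F.form (e u.1) (F.d (e v.1)) := by
          have h4 := F.form_symm (he v.1) (F.d_mem (he u.1))
          have h5 := F.form_d (he u.1) (e v.1)
          rw [← h1] at h4
          have h6 : sgn (q u.1 * (q u.1 + 1)) = 1 := by
            rcases zmod2_cases (q u.1) with h | h <;>
              simp [h, show (1 : ZMod 2) + 1 = 0 from rfl]
          rw [h6] at h4
          linear_combination h4 + h5
        rw [h3]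
        simp only [parLV, ← h1, ← h2]
        generalize q u.1 = x
        generalize parV n m u.2 = y
        generalize F.form (e u.1) (F.d (e v.1)) = c
        rcases zmod2_cases x with rfl | rfl <;> rcases zmod2_cases y with rfl | rfl <;>
          simp [show (1 : ZMod 2) + 1 = 0 from rfl]
      · rw [formV_eq_zero h2]; simp
    · rw [F.form_e_d_e_eq_zero he h1, F.form_e_d_e_eq_zero he (Ne.symm h1)]; simp

theorem slice_X_d_X (i j : Coord n m) :
    slice F.trace ((F.gauge hL e he).X i * lmap (F.extEnd F.d) ((F.gauge hL e he).X j)) =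
      ∑ a, ∑ b, (sgn (parV n m i * (1 + q a)) * F.form (e a : A) (F.d (e b))) •
        (gen (parLV n m q) (a, i) * gen (parLV n m q) (b, j)) := by
  simp only [GaugeData.X, map_sum, Finset.sum_mul_sum]
  refine Finset.sum_congr rfl fun a _ => Finset.sum_congr rfl fun b _ => ?_
  have hd : F.extEnd F.d ((F.gauge hL e he).e b) ∈ par F.Ext (q b + 1) :=
    F.incl_mem (F.d_mem (he b))
  rw [tmap_tm, LinearMap.id_apply, tm_mul_tm' _ (gen_mem_par _ _) hd]
  congr 1
  have h1 : F.trace ((F.gauge hL e he).e a * F.extEnd F.d ((F.gauge hL e he).e b)) =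
      F.form (e a : A) (F.d (e b)) := F.trace_incl_mul_incl _ _
  rw [h1]
  by_cases hab : q a = q b
  · rw [parLV, ← hab]
    congr 2
    change (q a + parV n m i) * (q a + 1) = _
    generalize q a = x
    generalize parV n m i = y
    revert x y; decide
  · rw [F.form_e_d_e_eq_zero he hab, mul_zero, mul_zero]

/-- The quadratic function of the differential is `σ`. -/
theorem quad_d_eq_sigma :
    (F.gauge hL e he).quad (F.gauge hL e he).d 1 n m = F.sigma (fun a => (e a : A)) q := by
  rw [F.sigma_eq_quadratic he, GaugeData.quad, quadratic]
  congr 1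
  have h1 : ∑ u : Fin r × Coord n m, ∑ v, F.gramMatrix n m q (fun a => (e a : A)) u v •
      (gen (parLV n m q) u * gen (parLV n m q) v) = ∑ i : Coord n m, ∑ j, formV i j •
        slice F.trace ((F.gauge hL e he).X i * lmap (F.extEnd F.d) ((F.gauge hL e he).X j)) := by
    simp only [slice_X_d_X, Finset.smul_sum, smul_smul]
    rw [Fintype.sum_prod_type_right]
    refine Finset.sum_congr rfl fun i _ => ?_
    simp only [Fintype.sum_prod_type_right]
    rw [Finset.sum_comm]
    refine Finset.sum_congr rfl fun j _ => Finset.sum_congr rfl fun a _ =>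
      Finset.sum_congr rfl fun b _ => ?_
    congr 1
    rw [gramMatrix]
    ring
  rw [h1]
  change (∑ i : Fin n, (slice F.trace (_ * lmap (F.extEnd F.d) _) - _) - _) = _
  simp only [Fintype.sum_sum_type, formV, ite_smul, one_smul, zero_smul, Finset.sum_const_zero,
    Finset.sum_ite_eq, Finset.mem_univ, if_true, add_zero, zero_add, sgn_one,
    Finset.sum_sub_distrib, ← Finset.smul_sum]
  have h2 : ∀ a b c : SPoly (parLV n m q), a - b - (-1 : ℝ) • c = a + (-1 : ℝ) • b + c :=
    fun a b c => by module
  exact h2 _ _ _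

end Basis

/-- The form `⟨a, d b⟩` is nondegenerate on a gauge: an element of `L` orthogonal to `d A` is
orthogonal to `A`, as `L` is isotropic. -/
theorem exists_form_e_d_e_inv (hL : F.IsGauge L) (e : Module.Basis (Fin r) ℝ L) :
    ∃ D : Matrix (Fin r) (Fin r) ℝ,
    D * (Matrix.of fun a b => F.form (e a : A) (F.d (e b))) = 1 := by
  refine ⟨_, Matrix.nonsing_inv_mul _ ((Matrix.isUnit_iff_isUnit_det _).1
    (Matrix.vecMul_injective_iff_isUnit.1 ?_))⟩
  rw [← Matrix.coe_vecMulLinear, injective_iff_map_eq_zero]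
  intro x hx
  -- The vector `l` of `L` with coordinates `x` is orthogonal to `L` and to `d L = d A`.
  set l : L := ∑ a, x a • e a with hl
  have h1 : ∀ b, F.form l (F.d (e b)) = 0 := by
    intro b
    have h2 := congrFun hx b
    rw [Pi.zero_apply] at h2
    rw [hl, Submodule.coe_sum, map_sum, LinearMap.sum_apply, ← h2]
    change _ = ∑ a, x a * F.form (e a : A) (F.d (e b))
    refine Finset.sum_congr rfl fun a _ => ?_
    rw [Submodule.coe_smul, map_smul]
    rfl
  have h2 : (l : A) = 0 := F.form_nondegenerate _ fun y => by
    obtain ⟨z, hz⟩ := F.exists_gauge_decomp hL e y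
    obtain ⟨z', hz'⟩ := F.exists_gauge_decomp hL e z
    rw [hz, map_add, hL.form_eq_zero l.2 (Submodule.sum_mem _ fun c _ =>
      Submodule.smul_mem _ _ (e c).2), hz', map_add, F.d_d, map_sum, add_zero, map_sum, zero_add]
    exact Finset.sum_eq_zero fun c _ => by rw [map_smul, map_smul, h1, smul_zero]
  funext a
  have h3 := e.repr_sum_self x
  rw [← hl, Subtype.ext h2 (a2 := (0 : L)), map_zero] at h3
  exact (congrFun h3 a).symm

theorem sum_formV_mul_formV (i j : Coord n m) :
    ∑ k, formV k i * formV k j = if i = j then 1 else 0 := by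
  rcases i with (i | i) | i <;> rcases j with (j | j) | j <;>
    simp [Fintype.sum_sum_type, formV, eq_comm] <;> split_ifs <;> simp

/-- The quadratic function `σ̃` is nondegenerate on `L ⊗ V`, its Gram matrix being a product of
nondegenerate ones. -/
theorem exists_gramMatrix_inv (hL : F.IsGauge L) (e : Module.Basis (Fin r) ℝ L) :
    ∃ H : Matrix (Fin r × Coord n m) (Fin r × Coord n m) ℝ,
    H * F.gramMatrix n m q (fun a => (e a : A)) = 1 := by
  obtain ⟨D, hD⟩ := F.exists_form_e_d_e_inv hL e
  refine ⟨Matrix.of fun u w => D u.1 w.1 * formV w.2 u.2 * sgn (parV n m w.2 * (1 + q w.1)), ?_⟩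
  ext u v
  have h : ∀ w : Fin r × Coord n m, D u.1 w.1 * formV w.2 u.2 * sgn (parV n m w.2 * (1 + q w.1)) *
      F.gramMatrix n m q (fun a => (e a : A)) w v =
      (D u.1 w.1 * F.form (e w.1 : A) (F.d (e v.1))) * (formV w.2 u.2 * formV w.2 v.2) := by
    intro w
    rw [gramMatrix]
    linear_combination (D u.1 w.1 * formV w.2 u.2 * F.form (e w.1 : A) (F.d (e v.1)) *
      formV w.2 v.2) * sgn_mul_sgn_self (parV n m w.2 * (1 + q w.1))
  have hD' := congrFun (congrFun hD u.1) v.1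
  rw [Matrix.mul_apply, Matrix.one_apply] at hD'
  simp only [Matrix.mul_apply, Matrix.of_apply, h, Fintype.sum_prod_type]
  rw [← Finset.sum_mul_sum, sum_formV_mul_formV]
  refine (congrArg (· * _) hD').trans ?_
  rw [Matrix.one_apply]
  by_cases h1 : u.1 = v.1 <;> by_cases h2 : u.2 = v.2 <;> simp [h1, h2, Prod.ext_iff]

end FrobeniusDGA
end DualConstruction

namespace DualConstruction
open SuperAlg (J)

/-! ### Independence of the homogeneous basis -/

section MapRight
variable {B S S' : Type*} [Ring B] [Algebra ℝ B] [SuperAlg B] [Ring S] [Algebra ℝ S] [SuperAlg S]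
  [Ring S'] [Algebra ℝ S'] [SuperAlg S']

/-- The algebra map `id ⊗ χ` of a parity-preserving algebra map `χ`. -/
def mapRight (B : Type*) [Ring B] [Algebra ℝ B] [SuperAlg B] (χ : S →ₐ[ℝ] S')
    (hχ : ∀ s, J (χ s) = χ (J s)) : STensor B S →ₐ[ℝ] STensor B S' :=
  AlgHom.ofLinearMap (tmap LinearMap.id χ.toLinearMap) (by
    rw [← tm_one_one, tmap_tm, AlgHom.toLinearMap_apply, map_one χ, tm_one_one.symm]; rfl) (fun x y => by
    induction x using tensor_induction with
    | add x x' hx hx' => rw [add_mul, map_add, hx, hx', map_add, add_mul]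
    | tm β ς b hb s hs =>
      induction y using tensor_induction with
      | add y y' hy hy' => rw [mul_add, map_add, hy, hy', map_add, mul_add]
      | tm β' ς' b' hb' s' hs' =>
        have hs1 : χ s ∈ par S' ς := by rw [mem_par, hχ, mem_par.1 hs, map_smul]
        rw [tm_mul_tm b hs hb', map_smul, tmap_tm, tmap_tm, tmap_tm]
        simp only [LinearMap.id_apply, AlgHom.toLinearMap_apply, map_mul]
        rw [tm_mul_tm b hs1 hb'])

theorem mapRight_tm (χ : S →ₐ[ℝ] S') (hχ : ∀ s, J (χ s) = χ (J s)) (b : B) (s : S) :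
    mapRight B χ hχ (tm b s) = tm b (χ s) := rfl

theorem slice_mapRight (χ : S →ₐ[ℝ] S') (hχ : ∀ s, J (χ s) = χ (J s)) (π : B →ₗ[ℝ] ℝ)
    (x : STensor B S) : slice π (mapRight B χ hχ x) = χ (slice π x) := by
  induction x using tensor_induction with
  | add x y hx hy => simp only [map_add, hx, hy]
  | tm β ς b hb s hs => rw [mapRight_tm, slice_tm, slice_tm, map_smul]

theorem lmap_mapRight (χ : S →ₐ[ℝ] S') (hχ : ∀ s, J (χ s) = χ (J s)) (φ : B →ₗ[ℝ] B)
    (x : STensor B S) : lmap φ (mapRight B χ hχ x) = mapRight B χ hχ (lmap φ x) := by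
  induction x using tensor_induction with
  | add x y hx hy => simp only [map_add, hx, hy]
  | tm β ς b hb s hs => rfl

end MapRight

section LinearChange
variable {ι ι' : Type*} [Fintype ι] [DecidableEq ι] [Fintype ι'] [DecidableEq ι']
  {p : ι → ZMod 2} {p' : ι' → ZMod 2}

/-- Linear substitutions transport the Schwinger-Dyson equations. -/
theorem SchwingerDyson.comp {σ : SPoly p} {σ' : SPoly p'} {χ : SPoly p →ₐ[ℝ] SPoly p'}
    {M : Matrix ι ι' ℝ} {N : Matrix ι' ι ℝ} (hMN : M * N = 1) (hχ : ∀ s, J (χ s) = χ (J s))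
    (hM : ∀ u, χ (gen p u) = ∑ v, M u v • gen p' v) (hσ : χ σ = σ')
    {E : SPoly p' →ₗ[ℝ] ℝ} (hE : SchwingerDyson σ' E) :
    SchwingerDyson σ (E ∘ₗ χ.toLinearMap) := by
  have hX : ∀ u, χ (gen p u) ∈ par _ (p u) := fun u => by
    rw [mem_par, hχ, mem_par.1 (gen_mem_par p u), map_smul]
  have h0 : χ = evalAt (fun u => χ (gen p u)) hX :=
    spoly_algHom_ext p fun u => (evalAt_gen hX u).symm
  have h1 : ∀ v f, pderiv p' v (χ f) = ∑ u, M u v • χ (pderiv p u f) := by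
    intro v f
    have h := (isSDer_pderiv p' v).chain hX f
    rw [← h0] at h
    rw [h]
    refine Finset.sum_congr rfl fun u _ => ?_
    rw [hM, map_sum, Finset.sum_eq_single v (fun v' _ hv => by
      rw [map_smul, pderiv_gen, if_neg hv.symm, smul_zero]) (by simp), map_smul, pderiv_gen,
      if_pos rfl, smul_mul_assoc, one_mul]
  have h2 : ∀ u f, χ (pderiv p u f) = ∑ v, N v u • pderiv p' v (χ f) := by
    intro u f
    simp only [h1, Finset.smul_sum, smul_smul]
    rw [Finset.sum_comm]
    simp only [← Finset.sum_smul]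
    have h3 : ∀ w, ∑ v, N v u * M w v = if w = u then 1 else 0 := fun w => by
      rw [← Matrix.one_apply, ← hMN, Matrix.mul_apply]
      exact Finset.sum_congr rfl fun v _ => mul_comm _ _
    simp [h3]
  intro u f
  simp only [LinearMap.comp_apply, AlgHom.toLinearMap_apply, map_mul, h2, hσ, Finset.sum_mul,
    map_sum, smul_mul_assoc, map_smul]
  exact Finset.sum_congr rfl fun v _ => by rw [hE]

end LinearChange

namespace GaugeData
open FrobeniusDGA (parLV)
variable {B : Type*} [Ring B] [Algebra ℝ B] [SuperAlg B] {r r' : ℕ} {q : Fin r → ZMod 2}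
  {q' : Fin r' → ZMod 2} (G : GaugeData B q) (G' : GaugeData B q') {n m : ℕ}

/-- The parities of corresponding basis vectors agree. -/
theorem par_eq_of_ne_zero {T : Matrix (Fin r) (Fin r') ℝ}
    (hT : ∀ b, G'.e b = ∑ a, T a b • G.e a) {a : Fin r} {b : Fin r'} (h : T a b ≠ 0) :
    q a = q' b := by
  have h1 := G.π_par a (G'.e b)
  have h2 : G.π a (G'.e b) = T a b := by
    rw [hT]
    simp [G.π_e]
  rw [mem_par.1 (G'.e_mem b), map_smul, h2, smul_eq_mul] at h1
  have h3 := mul_right_cancel₀ h h1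
  generalize q a = x at h3 ⊢
  generalize q' b = y at h3 ⊢
  rcases zmod2_cases x with rfl | rfl <;> rcases zmod2_cases y with rfl | rfl <;>
    first | rfl | (norm_num [sgn_zero, sgn_one] at h3)

/-- The change of coordinates on `L ⊗ V` between two bases. -/
theorem exists_change {T : Matrix (Fin r) (Fin r') ℝ} (hT : ∀ b, G'.e b = ∑ a, T a b • G.e a)
    (n m : ℕ) : ∃ χ : SPoly (parLV n m q) →ₐ[ℝ] SPoly (parLV n m q'),
      (∀ s, J (χ s) = χ (J s)) ∧
      ∀ u, χ (gen _ u) = ∑ v : Fin r' × Coord n m,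
        (if u.2 = v.2 then T u.1 v.1 else 0) • gen _ v := by
  have hX : ∀ u : Fin r × Coord n m, (∑ v : Fin r' × Coord n m,
      (if u.2 = v.2 then T u.1 v.1 else 0) • gen (parLV n m q') v) ∈ par _ (parLV n m q u) := by
    intro u
    refine Submodule.sum_mem _ fun v _ => ?_
    by_cases h : u.2 = v.2
    · by_cases h0 : T u.1 v.1 = 0
      · rw [if_pos h, h0, zero_smul]; exact Submodule.zero_mem _
      · rw [parLV, G.par_eq_of_ne_zero G' hT h0, h]
        exact Submodule.smul_mem _ _ (gen_mem_par _ v)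
    · rw [if_neg h, zero_smul]; exact Submodule.zero_mem _
  exact ⟨evalAt _ hX, J_evalAt hX, evalAt_gen hX⟩

section
variable {G G'}
  {χ : SPoly (parLV n m q) →ₐ[ℝ] SPoly (parLV n m q')} (hχ : ∀ s, J (χ s) = χ (J s))
  {T : Matrix (Fin r) (Fin r') ℝ} (hT : ∀ b, G'.e b = ∑ a, T a b • G.e a)
  (hM : ∀ u, χ (gen _ u) = ∑ v : Fin r' × Coord n m,
        (if u.2 = v.2 then T u.1 v.1 else 0) • gen _ v)
include hχ hT hM

theorem mapRight_X (w : Coord n m) : mapRight B χ hχ (G.X w) = G'.X w := by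
  have h1 : ∀ a, χ (gen _ (a, w)) = ∑ b, T a b • gen (parLV n m q') (b, w) := by
    intro a
    rw [hM, Fintype.sum_prod_type]
    refine Finset.sum_congr rfl fun b _ => ?_
    simp [ite_smul]
  have h2 : ∀ (b : B) (f : Fin r' → SPoly (parLV n m q')),
      tm b (∑ i, f i) = ∑ i, tm b (f i) := fun b f =>
    map_sum (AddMonoidHom.mk' (fun s => tm b s) fun s s' => tm_add b s s') _ _
  have h3 : ∀ (s : SPoly (parLV n m q')) (f : Fin r → B),
      tm (∑ i, f i) s = ∑ i, tm (f i) s := fun s f =>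
    map_sum (AddMonoidHom.mk' (fun b => tm b s) fun b b' => add_tm b b' s) _ _
  simp only [X, map_sum, mapRight_tm, h1, h2, hT, h3, tm_smul, smul_tm]
  exact Finset.sum_comm

/-- A linear change of the basis of the gauge, inducing `χ` on functions, transports `Ψ`. -/
theorem map_psi (hτ : G.τ = G'.τ) (f : Ham n m) : χ (G.psi f) = G'.psi f := by
  have h1 : mapRight B χ hχ (G.ev f) = G'.ev f :=
    map_evalAt G.X_mem _ G'.X_mem (mapRight_X hχ hT hM) f
  rw [psi_apply, psi_apply, ← slice_mapRight χ hχ, h1, hτ]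

theorem map_quad (hτ : G.τ = G'.τ) (φ : B →ₗ[ℝ] B) (ε : ZMod 2) :
    χ (G.quad φ ε n m) = G'.quad φ ε n m := by
  simp only [quad, map_smul, map_sub, map_sum, ← slice_mapRight χ hχ, map_mul,
    ← lmap_mapRight χ hχ, mapRight_X hχ hT hM, hτ]

end
end GaugeData

namespace FrobeniusDGA
variable {A : Type*} [NonUnitalRing A] [Module ℝ A] [IsScalarTower ℝ A A] [SMulCommClass ℝ A A]
  {𝒜 : ZMod 2 → Submodule ℝ A} [DirectSum.Decomposition 𝒜] (F : FrobeniusDGA 𝒜)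
  {L : Submodule ℝ A} {r r' : ℕ} {q : Fin r → ZMod 2} {q' : Fin r' → ZMod 2}

section
variable (hL : F.IsGauge L) (e : Module.Basis (Fin r) ℝ L) (he : ∀ a, (e a : A) ∈ 𝒜 (q a))

theorem nondeg_quad (n m : ℕ) :
    Nondeg ((F.gauge hL e he).quad (F.gauge hL e he).d 1 n m) := by
  obtain ⟨H, hH⟩ := F.exists_gramMatrix_inv (n := n) (m := m) (q := q) hL e
  rw [F.quad_d_eq_sigma, F.sigma_eq_quadratic he]
  exact (F.gramMatrix_supersymm he).nondeg hH

/-- The Gaussian expectation values over `L ⊗ V`. -/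
theorem exists_gauge_expectation (n m : ℕ) : ∃ E : SPoly (parLV n m q) →ₗ[ℝ] ℝ, E 1 = 1 ∧
    SchwingerDyson ((F.gauge hL e he).quad (F.gauge hL e he).d 1 n m) E ∧
    ∀ f, IsExpectation (F.sigma (fun a => (e a : A)) q) f (E f) := by
  obtain ⟨H, hH⟩ := F.exists_gramMatrix_inv (n := n) (m := m) (q := q) hL e
  have h := F.nondeg_quad hL e he n m
  rw [F.quad_d_eq_sigma, F.sigma_eq_quadratic he] at *
  exact exists_expectation ((F.gramMatrix_supersymm he).nonempty_gaussCoords hH) h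

end

/-- Expectation values of products of the functions `Ψ` do not depend on the basis. -/
theorem expectation_change (hL : F.IsGauge L) (e : Module.Basis (Fin r) ℝ L)
    (he : ∀ a, (e a : A) ∈ 𝒜 (q a)) (e' : Module.Basis (Fin r') ℝ L)
    (he' : ∀ a, (e' a : A) ∈ 𝒜 (q' a)) {n m : ℕ} {E : SPoly (parLV n m q) →ₗ[ℝ] ℝ}
    {E' : SPoly (parLV n m q') →ₗ[ℝ] ℝ} (h1 : E 1 = 1) (h1' : E' 1 = 1)
    (hE : SchwingerDyson ((F.gauge hL e he).quad (F.gauge hL e he).d 1 n m) E)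
    (hE' : SchwingerDyson ((F.gauge hL e' he').quad (F.gauge hL e' he').d 1 n m) E')
    {l : ℕ} (f : Fin l → Ham n m) :
    E (List.ofFn fun i => (F.gauge hL e he).psi (f i)).prod =
      E' (List.ofFn fun i => (F.gauge hL e' he').psi (f i)).prod := by
  have hT : ∀ b, (F.gauge hL e' he').e b =
      ∑ a, e.toMatrix e' a b • (F.gauge hL e he).e a := by
    intro b
    change F.incl _ = ∑ a, _ • F.incl _
    rw [← e.sum_toMatrix_smul_self e' b, Submodule.coe_sum, map_sum]
    exact Finset.sum_congr rfl fun a _ => by rw [Submodule.coe_smul, map_smul]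
  obtain ⟨χ, hχ, hM⟩ := (F.gauge hL e he).exists_change (F.gauge hL e' he') hT n m
  let M : Matrix (Fin r × Coord n m) (Fin r' × Coord n m) ℝ := fun u v =>
    if u.2 = v.2 then e.toMatrix e' u.1 v.1 else 0
  let N : Matrix (Fin r' × Coord n m) (Fin r × Coord n m) ℝ := fun v u =>
    if v.2 = u.2 then e'.toMatrix e v.1 u.1 else 0
  have hMN : M * N = 1 := by
    ext u v
    have h3 := congrFun (congrFun (e.toMatrix_mul_toMatrix_flip e') u.1) v.1
    rw [Matrix.mul_apply] at h3
    rw [Matrix.mul_apply, Fintype.sum_prod_type]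
    have h5 : ∀ b, ∑ w, M u (b, w) * N (b, w) v =
        if u.2 = v.2 then e.toMatrix e' u.1 b * e'.toMatrix e b v.1 else 0 := by
      intro b
      rw [Finset.sum_eq_single u.2 (fun w _ hw => by
        change (if u.2 = w then _ else _) * _ = _
        rw [if_neg hw.symm, zero_mul]) (by simp)]
      change (if u.2 = u.2 then _ else _) * (if u.2 = v.2 then _ else _) = _
      rw [if_pos rfl, mul_ite, mul_zero]
    simp only [h5]
    rw [Matrix.one_apply] at h3 ⊢
    by_cases hw : u.2 = v.2
    · simp only [if_pos hw, h3]
      by_cases h1 : u.1 = v.1 <;> simp [h1, hw, Prod.ext_iff]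
    · simp only [if_neg hw, Finset.sum_const_zero]
      rw [if_neg fun h => hw (by rw [h])]
  have h2 : SchwingerDyson ((F.gauge hL e he).quad (F.gauge hL e he).d 1 n m)
      (E' ∘ₗ χ.toLinearMap) :=
    SchwingerDyson.comp hMN hχ hM (GaugeData.map_quad hχ hT hM rfl _ 1) hE'
  have h4 := SchwingerDyson.eq_zero (F.nondeg_quad hL e he n m) (E := E - E' ∘ₗ χ.toLinearMap)
    (fun u f => by rw [LinearMap.sub_apply, LinearMap.sub_apply, hE, h2]) (by
      rw [LinearMap.sub_apply, LinearMap.comp_apply, AlgHom.toLinearMap_apply, map_one χ, h1, h1',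
        sub_self])
  rw [sub_eq_zero.1 h4, LinearMap.comp_apply, AlgHom.toLinearMap_apply, map_list_prod,
    List.map_ofFn]
  congr 3
  funext i
  exact GaugeData.map_psi hχ hT hM rfl (f i)

/-- Graded subspaces have homogeneous bases. -/
theorem exists_homogeneous_basis [FiniteDimensional ℝ A] (hL : F.IsGauge L) :
    ∃ (r : ℕ) (e : Module.Basis (Fin r) ℝ L) (q : Fin r → ZMod 2), ∀ a, (e a : A) ∈ 𝒜 (q a) := by
  let L' : ZMod 2 → Submodule ℝ L := fun i => (𝒜 i).comap L.subtype
  have hc : IsCompl (L' 0) (L' 1) := by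
    constructor
    · rw [Submodule.disjoint_def]
      intro x h0 h1
      have h := (inv_of_mem (𝒜 := 𝒜) (show (x : A) ∈ 𝒜 0 from h0)).symm.trans
        (inv_of_mem (𝒜 := 𝒜) (show (x : A) ∈ 𝒜 1 from h1))
      rw [sgn_zero, sgn_one] at h
      ext
      have h2 : (x : A) = (1 / 2 : ℝ) • ((1 : ℝ) • (x : A) - (-1 : ℝ) • (x : A)) := by module
      rw [h2, h, sub_self, smul_zero]
      rfl
    · rw [codisjoint_iff, eq_top_iff]
      intro x _
      let y : ZMod 2 → L := fun i => ⟨_, hL.isotropic.1 x x.2 i⟩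
      have hx : x = y 0 + y 1 := by
        ext
        change (x : A) = (DirectSum.decompose 𝒜 (x : A) 0 : A) + DirectSum.decompose 𝒜 (x : A) 1
        generalize (x : A) = a
        induction a using graded_induction (𝒜 := 𝒜) with
        | add a b ha hb =>
          rw [DirectSum.decompose_add, DirectSum.add_apply, DirectSum.add_apply,
            Submodule.coe_add, Submodule.coe_add]
          nth_rw 1 [ha, hb]
          abel
        | h i a ha =>
          rcases zmod2_cases i with rfl | rfl
          · rw [DirectSum.decompose_of_mem_same 𝒜 ha,
              DirectSum.decompose_of_mem_ne 𝒜 ha (by decide), add_zero]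
          · rw [DirectSum.decompose_of_mem_same 𝒜 ha,
              DirectSum.decompose_of_mem_ne 𝒜 ha (by decide), zero_add]
      rw [hx]
      exact Submodule.add_mem_sup (DirectSum.decompose 𝒜 (x : A) 0).2
        (DirectSum.decompose 𝒜 (x : A) 1).2
  let b := ((Module.finBasis ℝ (L' 0)).prod (Module.finBasis ℝ (L' 1))).map
    (Submodule.prodEquivOfIsCompl _ _ hc)
  refine ⟨_, b.reindex finSumFinEquiv, Sum.elim (fun _ => 0) (fun _ => 1) ∘ finSumFinEquiv.symm,
    fun a => ?_⟩
  obtain ⟨a, rfl⟩ := finSumFinEquiv.surjective a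
  rw [Module.Basis.reindex_apply, Equiv.symm_apply_apply, Function.comp_apply,
    Equiv.symm_apply_apply]
  rcases a with a | a
  · have h : ((Module.finBasis ℝ (L' 0) a : L) : A) ∈ 𝒜 0 := (Module.finBasis ℝ (L' 0) a).2
    rwa [show b (Sum.inl a) = (Module.finBasis ℝ (L' 0) a : L) by simp [b]]
  · have h : ((Module.finBasis ℝ (L' 1) a : L) : A) ∈ 𝒜 1 := (Module.finBasis ℝ (L' 1) a).2
    rwa [show b (Sum.inr a) = (Module.finBasis ℝ (L' 1) a : L) by simp [b]]

end FrobeniusDGA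
end DualConstruction

namespace DualConstruction
open SuperAlg (J)

/-! ### Ordered products of odd and even elements -/

section OrderedProducts
variable {R : Type*} [Ring R] [Algebra ℝ R] [SuperAlg R]

theorem sum_Iio_succ {M : Type*} [AddCommMonoid M] {N : ℕ} (f : Fin (N + 1) → M) (j : Fin N) :
    ∑ i ∈ Finset.Iio j.succ, f i = f 0 + ∑ i ∈ Finset.Iio j, f i.succ := by
  have h : Finset.Iio j.succ = insert 0 ((Finset.Iio j).map (Fin.succEmb N)) := by
    ext i
    refine Fin.cases ?_ (fun i => ?_) i
    · simp
    · simp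
  rw [h, Finset.sum_insert (by simp), Finset.sum_map]
  rfl

theorem sum_Iio_zero {M : Type*} [AddCommMonoid M] {N : ℕ} (f : Fin (N + 1) → M) :
    ∑ i ∈ Finset.Iio 0, f i = 0 := by
  rw [show Finset.Iio (0 : Fin (N + 1)) = ∅ by ext; simp, Finset.sum_empty]

theorem update_zero_succ {M : Type*} {N : ℕ} (f : Fin (N + 1) → M) (x : M) :
    (fun i : Fin N => Function.update f 0 x i.succ) = fun i => f i.succ := by
  funext i
  rw [Function.update_of_ne (Fin.succ_ne_zero i)]

theorem update_succ_succ {M : Type*} {N : ℕ} (f : Fin (N + 1) → M) (j : Fin N) (x : M) :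
    (fun i : Fin N => Function.update f j.succ x i.succ) =
      Function.update (fun i => f i.succ) j x := by
  funext i
  by_cases h : i = j
  · subst h
    rw [Function.update_self, Function.update_self]
  · rw [Function.update_of_ne h, Function.update_of_ne fun h' => h (Fin.succ_injective _ h')]

/-- Moving one factor of an ordered product to the front. -/
theorem ofFn_prod_update {N : ℕ} {ψ : Fin N → R} {π : Fin N → ZMod 2}
    (hψ : ∀ i, ψ i ∈ par R (π i)) (j : Fin N) {ξ : ZMod 2} {x : R} (hx : x ∈ par R ξ) :
    (List.ofFn (Function.update ψ j x)).prod = sgn (ξ * ∑ k ∈ Finset.Iio j, π k) •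
      (x * (List.ofFn (Function.update ψ j 1)).prod) := by
  induction N with
  | zero => exact j.elim0
  | succ N ih =>
    rw [List.ofFn_succ, List.ofFn_succ, List.prod_cons, List.prod_cons]
    refine Fin.cases ?_ (fun j => ?_) j
    · rw [update_zero_succ, update_zero_succ, Function.update_self, Function.update_self,
        sum_Iio_zero, mul_zero, sgn_zero, one_smul, one_mul]
    · rw [update_succ_succ, update_succ_succ, ih (fun i => hψ i.succ),
        Function.update_of_ne (Fin.succ_ne_zero j).symm,
        Function.update_of_ne (Fin.succ_ne_zero j).symm, mul_smul_comm, ← mul_assoc, ← mul_assoc,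
        mul_comm_of_mem (hψ 0) hx, smul_mul_assoc, sgn_smul_sgn_smul, sum_Iio_succ]
      congr 2
      ring

/-- The Leibniz rule for ordered products. -/
theorem IsSDer.ofFn_prod {δ : ZMod 2} {D : R →ₗ[ℝ] R} (hD : IsSDer δ D) {N : ℕ} {ψ : Fin N → R}
    {π : Fin N → ZMod 2} (hψ : ∀ i, ψ i ∈ par R (π i)) :
    D (List.ofFn ψ).prod = ∑ j, sgn (δ * ∑ k ∈ Finset.Iio j, π k) •
      (List.ofFn (Function.update ψ j (D (ψ j)))).prod := by
  induction N with
  | zero => simp [hD.map_one]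
  | succ N ih =>
    rw [List.ofFn_succ, List.prod_cons, hD.leibniz, ih fun i => hψ i.succ, Fin.sum_univ_succ,
      List.ofFn_succ, List.prod_cons, update_zero_succ, Function.update_self, sum_Iio_zero,
      mul_zero, sgn_zero, one_smul, Finset.mul_sum]
    congr 1
    refine Finset.sum_congr rfl fun j _ => ?_
    rw [List.ofFn_succ, List.prod_cons, update_succ_succ,
      Function.update_of_ne (Fin.succ_ne_zero j).symm, Jp_of_mem _ (hψ 0), smul_mul_assoc,
      mul_smul_comm, sgn_smul_sgn_smul, sum_Iio_succ, mul_add]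

/-- The sum over all ways to apply one of the `D i` to the product of the other `ψ k` becomes a
sum over pairs. -/
theorem sum_der_prod {N : ℕ} {ψ : Fin N → R} {P : Fin N → ZMod 2} {D : Fin N → R →ₗ[ℝ] R}
    (hD : ∀ i, IsSDer (P i) (D i)) (hψ : ∀ i, ψ i ∈ par R (P i + 1)) :
    ∑ i, sgn ((P i + 1) * ∑ k ∈ Finset.Iio i, (P k + 1)) •
        D i (List.ofFn (Function.update ψ i 1)).prod =
      ∑ i, ∑ j ∈ Finset.Ioi i,
        sgn ((P i + 1) * ∑ k ∈ Finset.Iio i, (P k + 1) +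
          (P j + 1) * ∑ k ∈ Finset.Iio j, (P k + 1) + (P i + 1) * (P j + 1)) •
        ((D i (ψ j) + sgn ((P i + 1) * (P j + 1)) • D j (ψ i)) *
          (List.ofFn (Function.update (Function.update ψ i 1) j 1)).prod) := by
  let F : Fin N → Fin N → R := fun i j => sgn ((P i + 1) * ∑ k ∈ Finset.Iio i, (P k + 1) +
    (P j + 1) * ∑ k ∈ Finset.Iio j, Function.update (fun k => P k + 1) i 0 k) •
      (D i (ψ j) * (List.ofFn (Function.update (Function.update ψ i 1) j 1)).prod)
  have h1 : ∀ i, sgn ((P i + 1) * ∑ k ∈ Finset.Iio i, (P k + 1)) •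
      D i (List.ofFn (Function.update ψ i 1)).prod = ∑ j ∈ {i}ᶜ, F i j := by
    intro i
    have hψ' : ∀ k, Function.update ψ i 1 k ∈ par R (Function.update (fun k => P k + 1) i 0 k) := by
      intro k
      by_cases h : k = i
      · subst h; simpa using one_mem_par
      · simpa [h] using hψ k
    rw [(hD i).ofFn_prod hψ', Finset.smul_sum, ← Finset.sum_compl_add_sum {i},
      Finset.sum_singleton, Function.update_self, (hD i).map_one, Function.update_idem]
    have h0 : (List.ofFn (Function.update ψ i 0)).prod = 0 :=
      List.prod_eq_zero (List.mem_ofFn.2 ⟨i, Function.update_self _ _ _⟩)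
    rw [h0, smul_zero, smul_zero, add_zero]
    refine Finset.sum_congr rfl fun j hj => ?_
    have hji : j ≠ i := by simpa using hj
    rw [Function.update_of_ne hji, ofFn_prod_update hψ' j ((hD i).mem (hψ j)), sgn_smul_sgn_smul,
      sgn_smul_sgn_smul]
    congr 2
    linear_combination (P i * ∑ k ∈ Finset.Iio j, Function.update (fun k => P k + 1) i 0 k) *
      two_eq_zero
  have h2 : ∀ {i j : Fin N}, i < j →
      ∑ k ∈ Finset.Iio j, Function.update (fun k => P k + 1) i 0 k =
        ∑ k ∈ Finset.Iio j, (P k + 1) + (P i + 1) := by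
    intro i j hij
    rw [Finset.sum_update_of_mem (Finset.mem_Iio.2 hij), zero_add,
      ← Finset.sum_sdiff (Finset.singleton_subset_iff.2 (Finset.mem_Iio.2 hij)),
      Finset.sum_singleton]
    linear_combination -(P i + 1) * two_eq_zero
  have h3 : ∀ {i j : Fin N}, i < j →
      ∑ k ∈ Finset.Iio i, Function.update (fun k => P k + 1) j 0 k =
        ∑ k ∈ Finset.Iio i, (P k + 1) := by
    intro i j hij
    exact Finset.sum_update_of_notMem (by simpa using hij.le) _ _
  have h4 := Finset.sum_sum_Ioi_add_eq_sum_sum_off_diag fun i j => F j i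
  simp only [h1]
  rw [← h4]
  refine Finset.sum_congr rfl fun i _ => Finset.sum_congr rfl fun j hj => ?_
  have hij := Finset.mem_Ioi.1 hj
  simp only [F]
  rw [h2 hij, h3 hij, Function.update_comm hij.ne', add_mul (D i (ψ j)), smul_add, smul_mul_assoc,
    sgn_smul_sgn_smul]
  congr 3
  · ring
  · linear_combination (-(P i + 1) * (P j + 1)) * two_eq_zero

end OrderedProducts

end DualConstruction

namespace DualConstruction
open SuperAlg (J)

/-! ### Signs of ordered products -/

section Signs
variable {N : ℕ}

/-- The exponent `∑_{i<j} Pᵢ cⱼ` of the sign in a product of operators of parities `P` which shift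
parity by `c`. -/
def crossSum (P c : Fin N → ZMod 2) : ZMod 2 := ∑ j, ∑ i ∈ Finset.Iio j, P i * c j

theorem crossSum_add_left (P P' c : Fin N → ZMod 2) :
    crossSum (P + P') c = crossSum P c + crossSum P' c := by
  simp [crossSum, add_mul, Finset.sum_add_distrib]

theorem crossSum_add_right (P c c' : Fin N → ZMod 2) :
    crossSum P (c + c') = crossSum P c + crossSum P c' := by
  simp [crossSum, mul_add, Finset.sum_add_distrib]

theorem crossSum_single_right (P : Fin N → ZMod 2) (j : Fin N) (y : ZMod 2) :
    crossSum P (Pi.single j y) = (∑ i ∈ Finset.Iio j, P i) * y := by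
  rw [crossSum, Finset.sum_eq_single j]
  · simp [Finset.sum_mul]
  · intro k _ hk
    simp [hk]
  · simp

theorem crossSum_single_one (i : Fin N) (x : ZMod 2) :
    crossSum (Pi.single i x) (fun _ => 1) = x * ((N : ZMod 2) + 1 + (i : ℕ)) := by
  have h : crossSum (Pi.single i x) (fun _ => 1) = ∑ j, if j ∈ Finset.Ioi i then x else 0 := by
    simp only [crossSum, mul_one, Finset.sum_pi_single', Finset.mem_Iio, Finset.mem_Ioi]
  have hN : (N : ZMod 2) = ((N - 1 - i : ℕ) : ZMod 2) + 1 + (i : ℕ) := by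
    have h1 := congrArg (Nat.cast (R := ZMod 2)) (show N = N - 1 - i + 1 + i by omega)
    simpa only [Nat.cast_add, Nat.cast_one] using h1
  rw [h, Finset.sum_ite_mem, Finset.univ_inter, Finset.sum_const, Fin.card_Ioi, nsmul_eq_mul, hN]
  linear_combination (-x * (1 + (i : ℕ))) * two_eq_zero

theorem crossSum_succ (P c : Fin (N + 1) → ZMod 2) :
    crossSum P c = P 0 * ∑ j : Fin N, c j.succ +
      crossSum (fun i => P i.succ) fun i => c i.succ := by
  simp only [crossSum, Fin.sum_univ_succ, sum_Iio_zero, zero_add, sum_Iio_succ,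
    Finset.sum_add_distrib, Finset.mul_sum]

end Signs

theorem prod_map_filter {M ι : Type*} [Monoid M] (L : List ι) (p : ι → Prop) [DecidablePred p]
    (f : ι → M) : ((L.filter fun k => p k).map f).prod =
      (L.map fun k => if p k then f k else 1).prod := by
  induction L with
  | nil => rfl
  | cons a L ih =>
    by_cases h : p a <;> simp [h, ih]

/-! ### The operators of left multiplication -/

section Column
variable {n m : ℕ} {R : Type*} [Ring R] [Algebra ℝ R] [SuperAlg R]

/-- The operator `(f₀, f₁) ↦ ((-1)^{|g|} ψ(g) f₁, ψ(g) f₀)` on pairs. For `ψ` odd these operators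
satisfy the relations of the exterior superalgebra. -/
def stepOp (ψ : Ham n m →ₗ[ℝ] R) : gTilde n m →ₗ[ℝ] Module.End ℝ (R × R) where
  toFun g := LinearMap.prod ((LinearMap.mulLeft ℝ (ψ (J g.1))).comp (LinearMap.snd ℝ R R))
    ((LinearMap.mulLeft ℝ (ψ g.1)).comp (LinearMap.fst ℝ R R))
  map_add' g h := LinearMap.ext fun v => by
    simp [add_mul]
  map_smul' c g := LinearMap.ext fun v => by
    simp

theorem stepOp_apply (ψ : Ham n m →ₗ[ℝ] R) (g : gTilde n m) (v : R × R) :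
    stepOp ψ g v = (ψ (J g.1) * v.2, ψ g.1 * v.1) := rfl

/-- `ψ` is odd. -/
abbrev IsOddMap (ψ : Ham n m →ₗ[ℝ] R) : Prop := ∀ x, ∀ f ∈ par (Ham n m) x, ψ f ∈ par R (x + 1)

/-- The operators of left multiplication anticommute in the super sense, the defining relation of
the exterior superalgebra: `ψ` shifts the parity, and the parity involution in the first component
produces the missing sign. -/
theorem stepOp_mul {ψ : Ham n m →ₗ[ℝ] R} (hψ : IsOddMap ψ) {g h : gTilde n m} {x y : ZMod 2}
    (hg : g.1 ∈ par (Ham n m) x) (hh : h.1 ∈ par (Ham n m) y) :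
    stepOp ψ g * stepOp ψ h = -(sgn (x * y)) • (stepOp ψ h * stepOp ψ g) := by
  have key := mul_comm_of_mem (hψ x _ hg) (hψ y _ hh)
  have hs : sgn ((x + 1) * (y + 1)) = -(sgn (x * y) * (sgn x * sgn y)) := by
    revert x y
    intro x y _ _ _
    rcases zmod2_cases x with rfl | rfl <;> rcases zmod2_cases y with rfl | rfl <;>
      simp [show (1 : ZMod 2) + 1 = 0 from rfl, sgn_zero, sgn_one]
  have hx := sgn_mul_sgn_self x
  have hy := sgn_mul_sgn_self y
  refine LinearMap.ext fun v => Prod.ext ?_ ?_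
  · simp only [Module.End.mul_apply, stepOp_apply, LinearMap.smul_apply, Prod.smul_fst]
    rw [mem_par.1 hg, mem_par.1 hh, map_smul ψ, map_smul ψ, ← mul_assoc, ← mul_assoc,
      smul_mul_assoc, smul_mul_assoc, key, smul_mul_assoc, smul_mul_assoc, smul_mul_assoc,
      smul_smul, smul_smul, hs]
    congr 1
    linear_combination (-(sgn (x * y) * sgn y)) * hx
  · simp only [Module.End.mul_apply, stepOp_apply, LinearMap.smul_apply, Prod.smul_snd]
    rw [mem_par.1 hg, mem_par.1 hh, map_smul ψ, map_smul ψ, ← mul_assoc, ← mul_assoc,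
      mul_smul_comm, mul_smul_comm, key, smul_mul_assoc, smul_mul_assoc, smul_mul_assoc,
      smul_smul, smul_smul, hs]
    congr 1
    linear_combination (-(sgn (x * y) * sgn x)) * hy

/-- The action of the exterior superalgebra on pairs. -/
def chainOp (ψ : Ham n m →ₗ[ℝ] R) (hψ : IsOddMap ψ) : Chain n m →ₐ[ℝ] Module.End ℝ (R × R) :=
  RingQuot.liftAlgHom ℝ ⟨TensorAlgebra.lift ℝ (stepOp ψ), by
    rintro _ _ ⟨g, h, x, y, hg, hh⟩
    rw [map_smul, map_mul, map_mul, TensorAlgebra.lift_ι_apply, TensorAlgebra.lift_ι_apply]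
    exact stepOp_mul hψ ((mem_par_iff_isHomog _).2 hg) ((mem_par_iff_isHomog _).2 hh)⟩

theorem chainOp_chainOf (ψ : Ham n m →ₗ[ℝ] R) (hψ : IsOddMap ψ) (g : gTilde n m) :
    chainOp ψ hψ (chainOf g) = stepOp ψ g := by
  simp [chainOp, chainOf]

/-- The linear extension of `g₁ ∧ ⋯ ∧ g_l ↦ (-1)^{∑_{i<j} |gᵢ|} ψ(g₁) ⋯ ψ(g_l)`. -/
def chainProd (ψ : Ham n m →ₗ[ℝ] R) (hψ : IsOddMap ψ) : Chain n m →ₗ[ℝ] R :=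
  (LinearMap.coprod LinearMap.id LinearMap.id).comp
    ((LinearMap.applyₗ ((1, 0) : R × R)).comp (chainOp ψ hψ).toLinearMap)

/-- The element `f` in the component `c` of a pair. -/
def atPar (c : ZMod 2) (f : R) : R × R := if c = 0 then (f, 0) else (0, f)

/-- The operator `Θ` is left multiplication by `s`, up to shifting components by `c` and the sign
for moving past the component. -/
def IsShift (Θ : Module.End ℝ (R × R)) (s : R) (P c : ZMod 2) : Prop :=
  ∀ x f, Θ (atPar x f) = sgn (P * x) • atPar (x + c) (s * f)

theorem isShift_one : IsShift (1 : Module.End ℝ (R × R)) 1 0 0 := by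
  intro x f
  simp [sgn_zero]

theorem isShift_stepOp (ψ : Ham n m →ₗ[ℝ] R) {g : gTilde n m} {x : ZMod 2}
    (hg : g.1 ∈ par (Ham n m) x) : IsShift (stepOp ψ g) (ψ g.1) x 1 := by
  intro y f
  rw [stepOp_apply, mem_par.1 hg, map_smul ψ]
  rcases zmod2_cases y with rfl | rfl
  · simp [atPar, sgn_zero]
  · simp [atPar, show (1 : ZMod 2) + 1 = 0 from rfl]

theorem smul_atPar (r : ℝ) (c : ZMod 2) (f : R) : atPar c (r • f) = r • atPar c f := by
  unfold atPar
  split_ifs <;> simp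

/-- Composing two shifts moves the first one past the component reached by the second, which is the
source of the sign. -/
theorem IsShift.mul {Θ Θ' : Module.End ℝ (R × R)} {s s' : R} {P c P' c' : ZMod 2}
    (h : IsShift Θ s P c) {r : ℝ} (h' : IsShift Θ' (r • s') P' c') :
    IsShift (Θ * Θ') ((sgn (P * c') * r) • (s * s')) (P + P') (c + c') := by
  intro x f
  rw [Module.End.mul_apply, h', smul_mul_assoc, smul_atPar, map_smul Θ, map_smul Θ, h,
    smul_mul_assoc, smul_atPar, smul_smul, smul_smul, smul_smul, mul_assoc, mul_add, add_mul,
    sgn_add, sgn_add, show x + c' + c = x + (c + c') by ring]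
  rw [mul_assoc s]
  congr 1
  ring

theorem IsShift.ofFn_prod {N : ℕ} {Θ : Fin N → Module.End ℝ (R × R)} {s : Fin N → R}
    {P c : Fin N → ZMod 2} (h : ∀ i, IsShift (Θ i) (s i) (P i) (c i)) :
    IsShift (List.ofFn Θ).prod (sgn (crossSum P c) • (List.ofFn s).prod) (∑ i, P i)
      (∑ i, c i) := by
  induction N with
  | zero => simpa [crossSum, sgn_zero] using isShift_one
  | succ N ih =>
    have := (h 0).mul (ih fun i => h i.succ)
    rw [List.ofFn_succ, List.ofFn_succ, List.prod_cons, List.prod_cons, Fin.sum_univ_succ,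
      Fin.sum_univ_succ, crossSum_succ, sgn_add]
    exact this

theorem chainProd_of_isShift {ψ : Ham n m →ₗ[ℝ] R} (hψ : IsOddMap ψ) {a : Chain n m} {s : R}
    {P c : ZMod 2} (h : IsShift (chainOp ψ hψ a) s P c) : chainProd ψ hψ a = s := by
  have h1 := h 0 1
  rw [mul_zero, sgn_zero, one_smul, mul_one, zero_add] at h1
  change (chainOp ψ hψ a (1, 0)).1 + (chainOp ψ hψ a (1, 0)).2 = s
  rw [show ((1, 0) : R × R) = atPar 0 1 by simp [atPar], h1]
  unfold atPar
  split_ifs <;> simp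

/-- The value on a wedge product; the sign is the cumulative sign of the shifts. -/
theorem chainProd_wedge {ψ : Ham n m →ₗ[ℝ] R} (hψ : IsOddMap ψ) {l : ℕ} {g : Fin l → gTilde n m}
    {P : Fin l → ZMod 2} (hg : IsHomogFamily g P) :
    chainProd ψ hψ (wedge g) =
      sgn (crossSum P fun _ => 1) • (List.ofFn fun i => ψ (g i).1).prod := by
  refine chainProd_of_isShift (P := ∑ i, P i) (c := ∑ i : Fin l, 1) hψ ?_
  rw [wedge, map_list_prod, List.map_ofFn]
  refine IsShift.ofFn_prod fun i => ?_
  rw [Function.comp_apply, chainOp_chainOf]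
  exact isShift_stepOp ψ (hg i)

theorem bracket_mem_par {f g : Ham n m} {x y : ZMod 2} (hf : f ∈ par (Ham n m) x)
    (hg : g ∈ par (Ham n m) y) : bracket f g ∈ par (Ham n m) (x + y) := by
  rw [bracket_eq_sum]
  refine Submodule.sum_mem _ fun w _ => ?_
  have h := mul_mem_par (hamField_mem hf w) ((isSDer_pderiv (parV n m) w).mem hg)
  rwa [show x + parV n m w + (parV n m w + y) = x + y by
    linear_combination (parV n m w) * two_eq_zero] at h

/-- The summand of the differential which brackets the factors `i` and `j`, rearranged so that the
bracket stands first and the places `i` and `j` are filled by units. -/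
theorem chainProd_bracket_mul {ψ : Ham n m →ₗ[ℝ] R} (hψ : IsOddMap ψ) {l : ℕ}
    {g : Fin l → gTilde n m} {P : Fin l → ZMod 2} (hg : IsHomogFamily g P) {i j : Fin l}
    (hij : i < j) :
    chainProd ψ hψ (chainOf (brG (g i) (g j)) *
        (((List.finRange l).filter fun k => k ≠ i ∧ k ≠ j).map fun k => chainOf (g k)).prod) =
      sgn (crossSum P (fun _ => 1) + ∑ k ∈ Finset.Iio i, P k + ∑ k ∈ Finset.Iio j, P k +
          P i * (i : ℕ) + P j * ((j : ℕ) + 1)) •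
        (ψ (bracket (g i).1 (g j).1) * (List.ofFn (Function.update (Function.update
          (fun k => ψ (g k).1) i 1) j 1)).prod) := by
  have h2 := IsShift.ofFn_prod (Θ := fun k => if k ≠ i ∧ k ≠ j then stepOp ψ (g k) else 1)
    (s := Function.update (Function.update (fun k => ψ (g k).1) i 1) j 1)
    (P := P + Pi.single i (P i) + Pi.single j (P j))
    (c := (fun _ => 1) + Pi.single i 1 + Pi.single j 1) (by
      intro k
      by_cases hi : k = i
      · subst hi
        simpa [hij.ne, ← two_mul, two_eq_zero, show (1 : ZMod 2) + 1 = 0 from rfl] using isShift_one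
      by_cases hj : k = j
      · subst hj
        simpa [hij.ne', ← two_mul, two_eq_zero, show (1 : ZMod 2) + 1 = 0 from rfl] using
          isShift_one
      simpa [hi, hj] using isShift_stepOp ψ (hg k))
  have h1 := isShift_stepOp ψ (g := brG (g i) (g j)) (bracket_mem_par (hg i) (hg j))
  have h3 := h1.mul h2
  have hc : ∑ k, ((fun _ => 1) + Pi.single i 1 + Pi.single j 1 : Fin l → ZMod 2) k = l := by
    simp [Finset.sum_add_distrib, add_assoc, show (1 : ZMod 2) + 1 = 0 from rfl]
  rw [hc, ← sgn_add] at h3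
  rw [chainProd_of_isShift hψ (a := chainOf (brG (g i) (g j)) *
        (((List.finRange l).filter fun k => k ≠ i ∧ k ≠ j).map fun k => chainOf (g k)).prod)
        (by
          rw [map_mul, chainOp_chainOf, prod_map_filter, ← List.ofFn_eq_map, map_list_prod,
            List.map_ofFn]
          have h4 : (⇑(chainOp ψ hψ) ∘ fun k => if k ≠ i ∧ k ≠ j then chainOf (g k) else 1) =
              fun k => if k ≠ i ∧ k ≠ j then stepOp ψ (g k) else 1 := by
            funext k
            simp only [Function.comp_apply]
            split_ifs
            · exact chainOp_chainOf ψ hψ _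
            · exact map_one _
          rw [h4]
          exact h3)]
  congr 2
  simp only [crossSum_add_left, crossSum_add_right, crossSum_single_right, crossSum_single_one,
    Pi.add_apply, Finset.sum_add_distrib, Finset.sum_pi_single', Finset.mem_Iio, lt_irrefl, hij,
    hij.not_gt, if_true, if_false, mul_one]
  linear_combination (P i * l + P j * l + P i) * two_eq_zero

/-- The product functional carries the Chevalley-Eilenberg differential to the sum over all ways
to apply one of the derivations `D i` to the product of the other factors. -/
theorem chainProd_ceDelta {ψ : Ham n m →ₗ[ℝ] R} (hψ : IsOddMap ψ) {l : ℕ}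
    {g : Fin l → gTilde n m} {P : Fin l → ZMod 2} (hg : IsHomogFamily g P)
    {D : Fin l → R →ₗ[ℝ] R} (hD : ∀ i, IsSDer (P i) (D i))
    (hDψ : ∀ i j, D i (ψ (g j).1) + sgn ((P i + 1) * (P j + 1)) • D j (ψ (g i).1) =
      sgn (P i) • ψ (bracket (g i).1 (g j).1)) :
    chainProd ψ hψ (ceDelta g P) = sgn (crossSum P fun _ => 1) •
      ∑ i, sgn ((P i + 1) * ∑ k ∈ Finset.Iio i, (P k + 1)) •
        D i (List.ofFn (Function.update (fun k => ψ (g k).1) i 1)).prod := by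
  have hcard : ∀ i : Fin l, ∑ k ∈ Finset.Iio i, (P k + 1) = ∑ k ∈ Finset.Iio i, P k + (i : ℕ) := by
    intro i
    simp [Finset.sum_add_distrib]
  rw [sum_der_prod hD fun k => hψ _ _ (hg k), ceDelta, map_sum, Finset.smul_sum]
  refine Finset.sum_congr rfl fun i _ => ?_
  rw [map_sum, Finset.smul_sum]
  refine Finset.sum_congr rfl fun j hj => ?_
  rw [map_smul, chainProd_bracket_mul hψ hg (Finset.mem_Ioi.1 hj), hDψ, smul_mul_assoc,
    sgn_smul_sgn_smul, sgn_smul_sgn_smul, sgn_smul_sgn_smul, hcard, hcard,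
    show (i : ℕ) + 1 + ((j : ℕ) + 1) - 1 = i + j + 1 by omega, Nat.cast_add, Nat.cast_add,
    Nat.cast_one]
  congr 2
  linear_combination (-P i) * two_eq_zero

/-- The product functional carries the action of `𝔬𝔰𝔭` to a derivation. -/
theorem chainProd_ospAct {ψ : Ham n m →ₗ[ℝ] R} (hψ : IsOddMap ψ) {l : ℕ}
    {g : Fin l → gTilde n m} {P : Fin l → ZMod 2} (hg : IsHomogFamily g P) {k : osp n m}
    {κ : ZMod 2} (hk : k.1 ∈ par (Ham n m) κ) {D : R →ₗ[ℝ] R} (hD : IsSDer κ D)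
    (hDψ : ∀ i, D (ψ (g i).1) = sgn κ • ψ (bracket k.1 (g i).1)) :
    chainProd ψ hψ (ospAct k κ g P) = sgn (crossSum P (fun _ => 1) + κ * l) •
      D (List.ofFn fun i => ψ (g i).1).prod := by
  rw [ospAct, map_sum, hD.ofFn_prod fun i => hψ _ _ (hg i), Finset.smul_sum]
  refine Finset.sum_congr rfl fun i _ => ?_
  have hg' : IsHomogFamily (Function.update g i (adOsp k (g i))) (P + Pi.single i κ) := by
    intro j
    by_cases h : j = i
    · subst h
      simpa [adOsp, add_comm] using (mem_par_iff_isHomog _).1 (bracket_mem_par hk (hg j))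
    · simpa [h] using hg j
  have hu : (fun j => ψ (Function.update g i (adOsp k (g i)) j).1) =
      Function.update (fun j => ψ (g j).1) i (ψ (bracket k.1 (g i).1)) := by
    funext j
    by_cases h : j = i
    · subst h
      simp [adOsp]
    · simp [h]
  have h0 : (List.ofFn (Function.update (fun j => ψ (g j).1) i
      (sgn κ • ψ (bracket k.1 (g i).1)))).prod = sgn κ • (List.ofFn (Function.update
        (fun j => ψ (g j).1) i (ψ (bracket k.1 (g i).1)))).prod := by
    have hb := hψ _ _ (bracket_mem_par hk (hg i))
    rw [ofFn_prod_update (fun j => hψ _ _ (hg j)) i hb,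
      ofFn_prod_update (fun j => hψ _ _ (hg j)) i (Submodule.smul_mem _ _ hb), smul_mul_assoc,
      smul_comm]
  rw [map_smul, chainProd_wedge hψ hg', hu, hDψ, h0, sgn_smul_sgn_smul, sgn_smul_sgn_smul,
    sgn_smul_sgn_smul, crossSum_add_left, crossSum_single_one, Finset.sum_add_distrib,
    Finset.sum_const, Fin.card_Iio, nsmul_eq_mul]
  congr 2
  ring

end Column

end DualConstruction

namespace DualConstruction
open SuperAlg (J)

/-! ### The exterior superalgebra is spanned by products of monomials -/

section Spanning
variable {n m : ℕ}

/-- Homogeneous superpolynomials are combinations of monomials. -/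
theorem homogDeg_le_span_monomial {ι : Type*} (p : ι → ZMod 2) (k : ℕ) :
    homogDeg p k ≤ Submodule.span ℝ (Set.range (monomial p (N := k))) := by
  induction k with
  | zero =>
    rw [homogDeg, pow_zero, Submodule.one_eq_span, Submodule.span_le]
    rintro _ rfl
    exact Submodule.subset_span ⟨Fin.elim0, by simp [monomial]⟩
  | succ k ih =>
    refine homogDeg_succ_le p k fun i f hf => ?_
    refine Submodule.span_induction (p := fun f _ => gen p i * f ∈ _) ?_ (by simp) ?_ ?_ (ih hf)
    · rintro _ ⟨w, rfl⟩
      exact Submodule.subset_span ⟨Fin.cons i w, by simp [monomial]⟩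
    · intro x y _ _ hx hy
      rw [mul_add]
      exact Submodule.add_mem _ hx hy
    · intro c x _ hx
      rw [mul_smul_comm]
      exact Submodule.smul_mem _ _ hx

open FrobeniusDGA (Mono)

theorem span_toG : Submodule.span ℝ (Set.range (Mono.toG (n := n) (m := m))) = ⊤ := by
  have h : gTilde n m ≤ (Submodule.span ℝ (Set.range (Mono.toG (n := n) (m := m)))).map
      (gTilde n m).subtype := by
    refine iSup_le fun k => (homogDeg_le_span_monomial _ _).trans (Submodule.span_le.2 ?_)
    rintro _ ⟨w, rfl⟩
    exact ⟨Mono.toG ⟨k + 3, by omega, w⟩, Submodule.subset_span ⟨_, rfl⟩, rfl⟩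
  refine eq_top_iff.2 fun g _ => ?_
  obtain ⟨g', hg', hgg⟩ := h g.2
  rwa [← Subtype.ext hgg]

/-- The inclusion of `𝔤̃` into the exterior superalgebra as a linear map. -/
def chainOfLinear (n m : ℕ) : gTilde n m →ₗ[ℝ] Chain n m :=
  (RingQuot.mkAlgHom ℝ (ExtRel n m)).toLinearMap ∘ₗ TensorAlgebra.ι ℝ

/-- Wedge products of monomials span, so that their values determine a relative cochain. -/
theorem span_wedge_toG : Submodule.span ℝ {c : Chain n m | ∃ (l : ℕ) (h : Fin l → Mono n m),
    c = wedge fun i => (h i).toG} = ⊤ := by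
  set W := Submodule.span ℝ {c : Chain n m | ∃ (l : ℕ) (h : Fin l → Mono n m),
    c = wedge fun i => (h i).toG} with hW
  have h1 : ∀ h : Mono n m, ∀ c ∈ W, chainOf h.toG * c ∈ W := by
    intro h c hc
    refine Submodule.span_induction (p := fun c _ => chainOf h.toG * c ∈ W) ?_ (by simp) ?_ ?_ hc
    · rintro _ ⟨l, w, rfl⟩
      exact Submodule.subset_span ⟨l + 1, Fin.cons h w, by simp [wedge]⟩
    · intro x y _ _ hx hy
      rw [mul_add]
      exact Submodule.add_mem _ hx hy
    · intro r x _ hx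
      rw [mul_smul_comm]
      exact Submodule.smul_mem _ _ hx
  have h2 : ∀ g : gTilde n m, ∀ c ∈ W, chainOf g * c ∈ W := by
    intro g c hc
    have hg : g ∈ Submodule.span ℝ (Set.range (Mono.toG (n := n) (m := m))) := by
      rw [span_toG]; trivial
    have hle : Submodule.span ℝ (Set.range (Mono.toG (n := n) (m := m))) ≤
        W.comap (LinearMap.mulRight ℝ c ∘ₗ chainOfLinear n m) := by
      rw [Submodule.span_le]
      rintro _ ⟨h, rfl⟩
      exact h1 h c hc
    exact hle hg
  have h3 : ∀ t : TensorAlgebra ℝ (gTilde n m), ∀ c ∈ W,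
      RingQuot.mkAlgHom ℝ (ExtRel n m) t * c ∈ W := by
    intro t
    induction t using TensorAlgebra.induction with
    | algebraMap r =>
      intro c hc
      rw [AlgHom.commutes, Algebra.algebraMap_eq_smul_one, smul_mul_assoc, one_mul]
      exact Submodule.smul_mem _ _ hc
    | ι g => exact h2 g
    | mul a b ha hb =>
      intro c hc
      rw [map_mul, mul_assoc]
      exact ha _ (hb _ hc)
    | add a b ha hb =>
      intro c hc
      rw [map_add, add_mul]
      exact Submodule.add_mem _ (ha _ hc) (hb _ hc)
  refine eq_top_iff.2 fun c _ => ?_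
  obtain ⟨t, rfl⟩ := RingQuot.mkAlgHom_surjective ℝ (ExtRel n m) c
  rw [← mul_one (RingQuot.mkAlgHom ℝ (ExtRel n m) t)]
  exact h3 t 1 (Submodule.subset_span ⟨0, Fin.elim0, by simp [wedge]⟩)

theorem monomial_mem_par {ι : Type*} (p : ι → ZMod 2) {N : ℕ} (w : Fin N → ι) :
    monomial p w ∈ par _ (∑ i, p (w i)) :=
  ofFn_prod_mem fun i => gen_mem_par p (w i)

theorem isHomogFamily_toG {l : ℕ} (h : Fin l → Mono n m) :
    IsHomogFamily (fun i => (h i).toG) fun i => (h i).par :=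
  fun i => (mem_par_iff_isHomog _).1 (monomial_mem_par _ (h i).letter)

end Spanning

/-! ### The dual construction is a relative cocycle -/

namespace GaugeData
open FrobeniusDGA (parLV)

variable {B : Type*} [Ring B] [Algebra ℝ B] [SuperAlg B] {r : ℕ} {q : Fin r → ZMod 2}
  (G : GaugeData B q) {n m : ℕ}

theorem isOddMap_psi : IsOddMap (G.psi (n := n) (m := m)) := fun _ _ hf => G.psi_mem hf

variable {E : SPoly (parLV n m q) →ₗ[ℝ] ℝ} (hE : SchwingerDyson (G.quad G.d 1 n m) E)

theorem chainProd_psi_ceDelta {l : ℕ} {g : Fin l → gTilde n m} {P : Fin l → ZMod 2}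
    (hg : IsHomogFamily g P) : chainProd G.psi G.isOddMap_psi (ceDelta g P) =
      sgn (crossSum P fun _ => 1) • ∑ i, sgn ((P i + 1) * ∑ k ∈ Finset.Iio i, (P k + 1)) •
        G.ham (P i) (g i).1 (List.ofFn (Function.update (fun k => G.psi (g k).1) i 1)).prod :=
  chainProd_ceDelta G.isOddMap_psi hg (fun i => G.isSDer_ham (hg i)) fun i j =>
    G.ham_psi_add (hg i) (hg j) (gTilde_le_hamTwo (g i).2) (gTilde_le_hamTwo (g j).2)

include hE in
/-- Mean values annihilate boundaries: the product of the `Ψ` is taken by the differential to a sum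
of derivatives along divergence-free vector fields preserving the weight. -/
theorem expectation_ceDelta {l : ℕ} {g : Fin l → gTilde n m} {P : Fin l → ZMod 2}
    (hg : IsHomogFamily g P) : E (chainProd G.psi G.isOddMap_psi (ceDelta g P)) = 0 := by
  rw [G.chainProd_psi_ceDelta hg, map_smul, map_sum, Finset.sum_eq_zero, smul_zero]
  intro i _
  rw [map_smul, G.expectation_ham hE (hg i) (gTilde_le_hamTwo (g i).2), smul_zero]

theorem chainProd_psi_ospAct {l : ℕ} {g : Fin l → gTilde n m} {P : Fin l → ZMod 2}
    (hg : IsHomogFamily g P) {k : osp n m} {κ : ZMod 2} (hk : k.1 ∈ par (Ham n m) κ) :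
    chainProd G.psi G.isOddMap_psi (ospAct k κ g P) = sgn (crossSum P (fun _ => 1) + κ * l) •
      G.ham κ k.1 (List.ofFn fun i => G.psi (g i).1).prod :=
  chainProd_ospAct G.isOddMap_psi hg hk (G.isSDer_ham hk) fun i => G.ham_psi_osp hk k.2 (g i).1

/-- The functional on relative chains given by the mean value of the product of the functions
`Ψ`. -/
def cochain (E : SPoly (parLV n m q) →ₗ[ℝ] ℝ) (hE : SchwingerDyson (G.quad G.d 1 n m) E) :
    RelCochain n m :=
  (ospImage n m).liftQ (E ∘ₗ chainProd G.psi G.isOddMap_psi) (by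
    rw [ospImage, Submodule.span_le]
    rintro _ ⟨k, κ, l, g, P, hk, hg, rfl⟩
    change E (chainProd G.psi G.isOddMap_psi (ospAct k κ g P)) = 0
    rw [G.chainProd_psi_ospAct hg ((mem_par_iff_isHomog _).2 hk), map_smul,
      G.expectation_ham hE ((mem_par_iff_isHomog _).2 hk) (osp_le_hamTwo k.2), smul_zero])

theorem cochain_toRel (c : Chain n m) :
    G.cochain E hE (toRel c) = E (chainProd G.psi G.isOddMap_psi c) := rfl

end GaugeData

namespace FrobeniusDGA

variable {A : Type*} [NonUnitalRing A] [Module ℝ A] [IsScalarTower ℝ A A] [SMulCommClass ℝ A A]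
  {𝒜 : ZMod 2 → Submodule ℝ A} [DirectSum.Decomposition 𝒜] (F : FrobeniusDGA 𝒜)
  {L : Submodule ℝ A} {n m r : ℕ} {q : Fin r → ZMod 2}

/-- The cochain built from one homogeneous basis of the gauge has the prescribed values for all of
them, by the independence of mean values of the basis. -/
theorem isDualFunctional_cochain (hL : F.IsGauge L) (e : Module.Basis (Fin r) ℝ L)
    (he : ∀ a, (e a : A) ∈ 𝒜 (q a)) {E : SPoly (parLV n m q) →ₗ[ℝ] ℝ} (h1 : E 1 = 1)
    (hE : SchwingerDyson ((F.gauge hL e he).quad (F.gauge hL e he).d 1 n m) E) :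
    F.IsDualFunctional L ((F.gauge hL e he).cochain E hE) := by
  intro r' e' q' he' l h
  obtain ⟨E', h1', hE', hE''⟩ := F.exists_gauge_expectation hL e' he' n m
  have hP : (List.ofFn fun i => F.Psi (fun a => (e' a : A)) q' (h i).letter).prod =
      (List.ofFn fun i => (F.gauge hL e' he').psi (h i).toG.1).prod := by
    refine congrArg (fun f => (List.ofFn f).prod) (funext fun i => ?_)
    exact (F.psi_monomial hL e' he' (by have := (h i).three_le; omega) (h i).letter).symm
  have hS : sgn (∑ j, ∑ i ∈ Finset.Iio j, (h i).par) *
      (F.gauge hL e he).cochain E hE (toRel (wedge fun i => (h i).toG)) =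
        E' (List.ofFn fun i => F.Psi (fun a => (e' a : A)) q' (h i).letter).prod := by
    rw [GaugeData.cochain_toRel, chainProd_wedge _ (isHomogFamily_toG h), map_smul, smul_eq_mul,
      ← mul_assoc, crossSum]
    simp only [mul_one]
    rw [sgn_mul_sgn_self, one_mul, hP]
    exact F.expectation_change hL e he e' he' h1 h1' hE hE' _
  rw [hS]
  exact hE'' _

/-- The mean values are uniquely determined, and monomial wedges span the complex. -/
theorem IsDualFunctional.unique [FiniteDimensional ℝ A] (hL : F.IsGauge L) {S S' : RelCochain n m}
    (h : F.IsDualFunctional L S) (h' : F.IsDualFunctional L S') : S = S' := by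
  obtain ⟨r, e, q, he⟩ := F.exists_homogeneous_basis hL
  refine Submodule.linearMap_qext _ (LinearMap.ext_on span_wedge_toG ?_)
  rintro _ ⟨l, w, rfl⟩
  exact mul_left_cancel₀ (sgn_ne_zero _) ((h r e q he l w).unique (h' r e q he l w))

theorem existsUnique_isDualFunctional [FiniteDimensional ℝ A] (hL : F.IsGauge L) :
    ∃! S : RelCochain n m, F.IsDualFunctional L S := by
  obtain ⟨r, e, q, he⟩ := F.exists_homogeneous_basis hL
  obtain ⟨E, h1, hE, -⟩ := F.exists_gauge_expectation hL e he n m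
  exact ⟨_, F.isDualFunctional_cochain hL e he h1 hE, fun S hS =>
    hS.unique F hL (F.isDualFunctional_cochain hL e he h1 hE)⟩

/-- The functional coincides with the cochain of a gauge, which is closed. -/
theorem IsDualFunctional.isCocycle [FiniteDimensional ℝ A] (hL : F.IsGauge L) {S : RelCochain n m}
    (h : F.IsDualFunctional L S) : IsCocycle S := by
  obtain ⟨r, e, q, he⟩ := F.exists_homogeneous_basis hL
  obtain ⟨E, h1, hE, -⟩ := F.exists_gauge_expectation hL e he n m
  rw [h.unique F hL (F.isDualFunctional_cochain hL e he h1 hE)]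
  intro l g P hg
  rw [GaugeData.cochain_toRel]
  exact GaugeData.expectation_ceDelta _ hE hg

end FrobeniusDGA

end DualConstruction

namespace DualConstruction
open SuperAlg (J)

/-! ### Polynomial paths -/

section Paths
variable {V W R : Type*} [AddCommGroup V] [Module ℝ V] [AddCommGroup W] [Module ℝ W] [Ring R]
  [Algebra ℝ R]

variable (V) in
/-- The pairs `(f, f')` of a polynomial path `f` in a vector space, which carries no topology, and
its derivative `f'`. -/
def polyPath : Submodule ℝ ((ℝ → V) × (ℝ → V)) :=
  Submodule.span ℝ {c | ∃ (k : ℕ) (v : V),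
    c = (fun t => t ^ k • v, fun t => ((k : ℝ) * t ^ (k - 1)) • v)}

theorem const_mem_polyPath (v : V) : ((fun _ => v, 0) : (ℝ → V) × (ℝ → V)) ∈ polyPath V :=
  Submodule.subset_span ⟨0, v, by ext <;> simp⟩

theorem affine_mem_polyPath (v w : V) :
    ((fun t => v + t • w, fun _ => w) : (ℝ → V) × (ℝ → V)) ∈ polyPath V := by
  have h : ((fun t => t • w, fun _ => w) : (ℝ → V) × (ℝ → V)) ∈ polyPath V :=
    Submodule.subset_span ⟨1, w, by ext <;> simp⟩
  have h1 := Submodule.add_mem _ (const_mem_polyPath v) h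
  rwa [show ((fun _ => v, 0) : (ℝ → V) × (ℝ → V)) + (fun t => t • w, fun _ => w) =
    (fun t => v + t • w, fun _ => w) from Prod.ext rfl (zero_add _)] at h1

theorem map_mem_polyPath {f f' : ℝ → V} (h : (f, f') ∈ polyPath V) (φ : V →ₗ[ℝ] W) :
    ((fun t => φ (f t), fun t => φ (f' t)) : (ℝ → W) × (ℝ → W)) ∈ polyPath W := by
  let Φ : ((ℝ → V) × (ℝ → V)) →ₗ[ℝ] ((ℝ → W) × (ℝ → W)) := (φ.compLeft ℝ).prodMap (φ.compLeft ℝ)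
  have hle : polyPath V ≤ (polyPath W).comap Φ := by
    refine Submodule.span_le.2 ?_
    rintro _ ⟨k, v, rfl⟩
    refine Submodule.subset_span ⟨k, φ v, Prod.ext (funext fun t => ?_) (funext fun t => ?_)⟩
    · exact map_smul φ _ _
    · exact map_smul φ _ _
  exact hle h

/-- The Leibniz rule for polynomial paths. -/
theorem mul_mem_polyPath {f f' g g' : ℝ → R} (hf : (f, f') ∈ polyPath R)
    (hg : (g, g') ∈ polyPath R) :
    ((fun t => f t * g t, fun t => f' t * g t + f t * g' t) : (ℝ → R) × (ℝ → R)) ∈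
      polyPath R := by
  let M : ((ℝ → R) × (ℝ → R)) →ₗ[ℝ] ((ℝ → R) × (ℝ → R)) →ₗ[ℝ] ((ℝ → R) × (ℝ → R)) :=
    LinearMap.mk₂ ℝ (fun c c' => (c.1 * c'.1, c.2 * c'.1 + c.1 * c'.2))
      (fun a b c => Prod.ext (by simp [add_mul]) (by simp [add_mul]; abel))
      (fun a b c => Prod.ext (by simp) (by simp))
      (fun a b c => Prod.ext (by simp [mul_add]) (by simp [mul_add]; abel))
      (fun a b c => Prod.ext (by simp) (by simp))
  have hle : Submodule.map₂ M (polyPath R) (polyPath R) ≤ polyPath R := by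
    rw [polyPath, Submodule.map₂_span_span, Submodule.span_le]
    rintro _ ⟨_, ⟨j, v, rfl⟩, _, ⟨k, w, rfl⟩, rfl⟩
    refine Submodule.subset_span ⟨j + k, v * w, Prod.ext (funext fun t => ?_)
      (funext fun t => ?_)⟩
    · change t ^ j • v * t ^ k • w = t ^ (j + k) • (v * w)
      rw [smul_mul_smul_comm, pow_add]
    · change ((j : ℝ) * t ^ (j - 1)) • v * t ^ k • w + t ^ j • v * ((k : ℝ) * t ^ (k - 1)) • w =
        (((j + k : ℕ) : ℝ) * t ^ (j + k - 1)) • (v * w)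
      rw [smul_mul_smul_comm, smul_mul_smul_comm, ← add_smul]
      congr 1
      rcases j with _ | j <;> rcases k with _ | k <;> simp; ring
  exact hle (Submodule.apply_mem_map₂ M hf hg)

theorem ofFn_prod_mem_polyPath {N : ℕ} {f f' : Fin N → ℝ → R}
    (h : ∀ i, (f i, f' i) ∈ polyPath R) :
    ((fun t => (List.ofFn fun i => f i t).prod, fun t => ∑ i,
      (List.ofFn (Function.update (fun i => f i t) i (f' i t))).prod) : (ℝ → R) × (ℝ → R)) ∈
        polyPath R := by
  induction N with
  | zero =>
    simp only [List.ofFn_zero, List.prod_nil, Finset.univ_eq_empty, Finset.sum_empty]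
    exact const_mem_polyPath 1
  | succ N ih =>
    have h1 := mul_mem_polyPath (h 0) (ih fun i => h i.succ)
    convert h1 using 3 with t t
    · rw [List.ofFn_succ, List.prod_cons]
    · rw [Fin.sum_univ_succ, List.ofFn_succ, List.prod_cons, Function.update_self,
        update_zero_succ, Finset.mul_sum]
      congr 1
      refine Finset.sum_congr rfl fun i _ => ?_
      rw [List.ofFn_succ, List.prod_cons, update_succ_succ,
        Function.update_of_ne (Fin.succ_ne_zero i).symm]

/-- For real-valued paths the second component is the derivative. -/
theorem hasDerivAt_of_mem_polyPath {f f' : ℝ → ℝ} (h : (f, f') ∈ polyPath ℝ) :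
    (∀ t, HasDerivAt f (f' t) t) ∧ Continuous f' := by
  suffices hs : ∀ c ∈ polyPath ℝ, (∀ t, HasDerivAt c.1 (c.2 t) t) ∧ Continuous c.2 from hs _ h
  intro c hc
  induction hc using Submodule.span_induction with
  | mem c hc =>
    obtain ⟨k, v, rfl⟩ := hc
    exact ⟨fun t => (hasDerivAt_pow k t).smul_const v, by simp only [smul_eq_mul]; fun_prop⟩
  | zero => exact ⟨fun t => hasDerivAt_const t 0, continuous_const⟩
  | add a b _ _ ha hb => exact ⟨fun t => (ha.1 t).add (hb.1 t), ha.2.add hb.2⟩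
  | smul r a _ ha => exact ⟨fun t => (ha.1 t).const_smul r, ha.2.const_smul r⟩

end Paths

/-! ### Deformations of a gauge -/

namespace GaugeData
open FrobeniusDGA (parLV)

variable {B : Type*} [Ring B] [Algebra ℝ B] [SuperAlg B] {r : ℕ} {q : Fin r → ZMod 2}

/-- An infinitesimal change of the Lagrangian subspace: an even, skew-adjoint operator from the
subspace to the range of `d`, extended by zero to the complement. -/
structure IsVariation (G : GaugeData B q) (ψ : B →ₗ[ℝ] B) : Prop where
  even : MapParity 0 ψ
  skew : ∀ a b, G.τ (ψ a * b) = -G.τ (a * ψ b)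
  P_apply : ∀ b, G.P (ψ b) = 0
  apply_P : ∀ b, ψ (G.P b) = ψ b
  ε_apply : ∀ b, G.ε (ψ b) = 0
  d_apply : ∀ b, G.d (ψ b) = 0
  apply_d : ∀ b, ψ (G.d b) = 0

variable {G : GaugeData B q} {ψ : B →ₗ[ℝ] B} (hψ : G.IsVariation ψ) {n m : ℕ}

namespace IsVariation

include hψ in
theorem apply_apply (b : B) : ψ (ψ b) = 0 := by
  rw [← hψ.apply_P, hψ.P_apply, map_zero]

include hψ in
theorem π_apply (a : Fin r) (b : B) : G.π a (ψ b) = 0 := by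
  have h := congrArg (G.π a) (hψ.P_apply b)
  simpa [GaugeData.P_apply, G.π_e] using h

/-- The gauge with Lagrangian subspace `(1 + t ψ) L`. -/
def deform (t : ℝ) : GaugeData B q :=
  { G with
    e := fun a => G.e a + t • ψ (G.e a)
    e_mem := fun a => Submodule.add_mem _ (G.e_mem a) (Submodule.smul_mem _ _ (by
      simpa using hψ.even.mem (G.e_mem a)))
    ε_e := fun a => by rw [map_add, map_smul, G.ε_e, hψ.ε_apply, smul_zero, add_zero]
    π_e := fun a b => by rw [map_add, map_smul, hψ.π_apply, G.π_e, smul_zero, add_zero]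
    lagrangian := fun a b => by
      have h : ∀ b, ∑ c, G.π c b • (G.e c + t • ψ (G.e c)) =
          ∑ c, G.π c b • G.e c + t • ψ b := by
        intro b
        rw [← hψ.apply_P b, GaugeData.P_apply, map_sum, Finset.smul_sum, ← Finset.sum_add_distrib]
        refine Finset.sum_congr rfl fun c _ => ?_
        rw [map_smul, smul_add, smul_comm]
      rw [h, h, ← G.lagrangian a b, add_mul, mul_add, map_add, map_add, smul_mul_assoc,
        mul_smul_comm, map_smul, map_smul, hψ.skew]
      simp only [smul_eq_mul]
      ring }

theorem deform_X (t : ℝ) (w : Coord n m) :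
    ((hψ.deform t).X w : STensor B (SPoly (parLV n m q))) = G.X w + t • lmap ψ (G.X w) := by
  rw [X, X, map_sum, Finset.smul_sum, ← Finset.sum_add_distrib]
  refine Finset.sum_congr rfl fun a _ => ?_
  rw [tmap_tm, LinearMap.id_apply, ← smul_tm, ← add_tm]
  rfl

theorem lmap_lmap_eq_zero {S : Type*} [Ring S] [Algebra ℝ S] [SuperAlg S] {φ φ' : B →ₗ[ℝ] B}
    (h : ∀ b, φ (φ' b) = 0) (x : STensor B S) : lmap φ (lmap φ' x) = 0 := by
  induction x using tensor_induction with
  | add x y hx hy => rw [map_add, map_add, hx, hy, add_zero]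
  | tm β ς b hb s hs => simp [h]

include hψ in
theorem slice_lmap_mul (x y : G.Field n m) :
    slice G.τ (lmap ψ x * y) = -slice G.τ (x * lmap ψ y) := by
  have h := slice_mul_lmap (S := SPoly (parLV n m q)) hψ.even
    (fun a b => by rw [Jp_zero]; exact hψ.skew a b) x y
  rwa [Jp_zero] at h

theorem lmap_deform_X {φ : B →ₗ[ℝ] B} (h : ∀ b, φ (ψ b) = 0) (t : ℝ) (w : Coord n m) :
    lmap φ ((hψ.deform t).X w : STensor B (SPoly (parLV n m q))) = lmap φ (G.X w) := by
  rw [deform_X, map_add, map_smul, lmap_lmap_eq_zero h, smul_zero, add_zero]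

/-- Quadratic functions of operators that compose with `ψ` to zero are invariant. -/
theorem deform_quad {φ : B →ₗ[ℝ] B} (ε : ZMod 2) (h : ∀ b, φ (ψ b) = 0) (h' : ∀ b, ψ (φ b) = 0)
    (t : ℝ) : (hψ.deform t).quad φ ε n m = G.quad φ ε n m := by
  have h1 : ∀ i j : Coord n m, slice (hψ.deform t).τ ((hψ.deform t).X i *
      lmap φ ((hψ.deform t).X j : STensor B (SPoly (parLV n m q)))) =
        slice G.τ (G.X i * lmap φ (G.X j)) := by
    intro i j
    rw [hψ.lmap_deform_X h, deform_X, add_mul, smul_mul_assoc, map_add, map_smul]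
    have h2 := hψ.slice_lmap_mul (n := n) (m := m) (G.X i) (lmap φ (G.X j))
    rw [lmap_lmap_eq_zero h', mul_zero, map_zero, neg_zero] at h2
    have h3 : slice (hψ.deform t).τ (lmap ψ (G.X i) * lmap φ (G.X j) : G.Field n m) = 0 := h2
    rw [h3, smul_zero, add_zero]
    rfl
  simp only [quad, h1]

/-- The variation of `Ψ`. -/
def psiVar (t : ℝ) (f : Ham n m) : SPoly (parLV n m q) :=
  slice G.τ (∑ w, lmap ψ (G.X w) * (hψ.deform t).ev (pderiv (parV n m) w f))

/-- The function `Ψ(f)` of the deformed gauge depends polynomially on `t`, with derivative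
`psiVar`. -/
theorem psi_mem_polyPath (f : Ham n m) :
    ((fun t => (hψ.deform t).psi f, fun t => hψ.psiVar t f) :
      (ℝ → SPoly (parLV n m q)) × (ℝ → SPoly (parLV n m q))) ∈ polyPath _ := by
  suffices h : ((fun t => (hψ.deform t).ev f, fun t => ∑ w, lmap ψ (G.X w) *
      (hψ.deform t).ev (pderiv (parV n m) w f)) : (ℝ → G.Field n m) × (ℝ → G.Field n m)) ∈
        polyPath (G.Field n m) from map_mem_polyPath h (slice G.τ)
  induction f using spoly_induction with
  | one =>
    simp only [map_one, pderiv_one, map_zero, mul_zero, Finset.sum_const_zero]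
    exact const_mem_polyPath 1
  | mul i f hf =>
    have hX : ((fun t => ((hψ.deform t).X i : G.Field n m), fun _ => lmap ψ (G.X i)) :
        (ℝ → G.Field n m) × (ℝ → G.Field n m)) ∈ polyPath _ := by
      simp only [deform_X]
      exact affine_mem_polyPath _ _
    convert mul_mem_polyPath hX hf using 3 with t t
    · rw [map_mul, ev_gen]
    · simp only [pderiv_gen_mul, map_add, map_smul, map_mul, mul_add, Finset.sum_add_distrib]
      congr 1
      · simp
      · rw [Finset.mul_sum]
        refine Finset.sum_congr rfl fun w _ => ?_
        have hw : lmap ψ (G.X w) ∈ par (G.Field n m) (parV n m w) := by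
          simpa using lmap_mem hψ.even (G.X_mem (n := n) (m := m) w)
        rw [ev_gen, mul_smul_comm, ← mul_assoc, ← mul_assoc,
          mul_comm_of_mem hw ((hψ.deform t).X_mem i), smul_mul_assoc, sgn_smul_self_smul]
  | add f g hf hg =>
    convert Submodule.add_mem _ hf hg using 3 with t t
    · exact map_add _ _ _
    · simp only [map_add, mul_add, Finset.sum_add_distrib]
      rfl
  | smul c f hf =>
    convert Submodule.smul_mem _ c hf using 3 with t t
    · exact map_smul _ _ _
    · simp only [map_smul, mul_smul_comm, ← Finset.smul_sum]
      rfl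

/-- Quadratic Hamiltonians act on the generic point linearly, so that `Ψ` of them does not
change. -/
theorem psiVar_osp (t : ℝ) {k : Ham n m} (hk : k ∈ osp n m) : hψ.psiVar t k = 0 := by
  let Φ : Ham n m →ₗ[ℝ] SPoly (parLV n m q) := slice G.τ ∘ₗ ∑ w,
    LinearMap.mulLeft ℝ (lmap ψ (G.X w)) ∘ₗ (hψ.deform t).ev.toLinearMap ∘ₗ pderiv (parV n m) w
  have hΦ : ∀ f, hψ.psiVar t f = Φ f := fun f => by simp [Φ, psiVar]
  suffices h : osp n m ≤ LinearMap.ker Φ by rw [hΦ]; exact h hk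
  refine (homogDeg_le_span_monomial _ 2).trans (Submodule.span_le.2 ?_)
  rintro _ ⟨w, rfl⟩
  change Φ _ = 0
  have hw : lmap ψ (G.X (w 1)) ∈ par (G.Field n m) (parV n m (w 1)) := by
    simpa using lmap_mem hψ.even (G.X_mem (n := n) (m := m) (w 1))
  have h1 : ∑ v, lmap ψ (G.X v) * (hψ.deform t).ev (pderiv (parV n m) v
      (gen _ (w 0) * gen _ (w 1))) = lmap ψ (G.X (w 0)) * (hψ.deform t).X (w 1) +
        (hψ.deform t).X (w 0) * lmap ψ (G.X (w 1)) := by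
    simp only [pderiv_gen_mul, pderiv_gen, map_add, map_smul, map_mul, mul_add,
      Finset.sum_add_distrib]
    congr 1
    · simp
    · rw [Finset.sum_eq_single (w 1)]
      · rw [if_pos rfl, map_one, mul_one, ev_gen, mul_smul_comm,
          mul_comm_of_mem ((hψ.deform t).X_mem (w 0)) hw, mul_comm (parV n m (w 1))]
      · intro v _ hv
        rw [if_neg hv, map_zero, mul_zero, smul_zero, mul_zero]
      · simp
  rw [← hΦ, show monomial (parV n m) w = gen _ (w 0) * gen _ (w 1) by simp [monomial], psiVar, h1,
    map_add, ← hψ.lmap_deform_X hψ.apply_apply t (w 0)]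
  have h2 := hψ.slice_lmap_mul (n := n) (m := m) ((hψ.deform t).X (w 0)) ((hψ.deform t).X (w 1))
  rw [hψ.lmap_deform_X hψ.apply_apply t (w 1)] at h2
  exact (congrArg (· + _) h2).trans (neg_add_cancel _)

/-- The quadratic function of a variation has the variation of `Ψ` as its derivatives along the
projected Hamiltonian vector fields. -/
theorem ham_deform_quad (t : ℝ) {δ : ZMod 2} {h : Ham n m} (hh : h ∈ par _ δ)
    (h2 : h ∈ hamTwo n m) :
    (hψ.deform t).ham δ h (G.quad ψ 0 n m) = sgn δ • hψ.psiVar t h := by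
  have h3 := (hψ.deform t).ham_quad (φ := ψ) (ε := 0) hψ.even
    (fun a b => by rw [Jp_zero]; exact hψ.skew a b) (fun b => by
      rw [GaugeData.P_apply]
      exact Finset.sum_eq_zero fun c _ => by
        rw [show (hψ.deform t).π c (ψ b) = 0 from hψ.π_apply c b, zero_smul]) hψ.ε_apply hh h2
  rw [hψ.deform_quad 0 hψ.apply_apply hψ.apply_apply, mul_zero, add_zero] at h3
  rw [h3]
  congr 2
  refine Finset.sum_congr rfl fun w _ => ?_
  rw [hψ.lmap_deform_X hψ.apply_apply]

theorem psiVar_mem (t : ℝ) {δ : ZMod 2} {h : Ham n m} (hh : h ∈ par _ δ)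
    (h2 : h ∈ hamTwo n m) : hψ.psiVar t h ∈ par _ (δ + 1) := by
  have h3 : (hψ.deform t).ham δ h (G.quad ψ 0 n m) ∈ par _ (δ + (0 + 1)) :=
    ((hψ.deform t).isSDer_ham hh).mem (G.quad_mem hψ.even)
  rw [hψ.ham_deform_quad t hh h2, zero_add] at h3
  have h4 := Submodule.smul_mem _ (sgn δ) h3
  rwa [smul_smul, sgn_mul_sgn_self, one_smul] at h4

variable {E : SPoly (parLV n m q) →ₗ[ℝ] ℝ} (hE : SchwingerDyson (G.quad G.d 1 n m) E)

include hE in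
/-- The weight does not change under a deformation, hence neither do its mean values. -/
theorem schwingerDyson_deform (t : ℝ) :
    SchwingerDyson ((hψ.deform t).quad (hψ.deform t).d 1 n m) E := by
  rw [show (hψ.deform t).d = G.d from rfl, hψ.deform_quad 1 hψ.d_apply hψ.apply_d]
  exact hE

/-- The integrand of the homotopy. -/
abbrev integrand (E : SPoly (parLV n m q) →ₗ[ℝ] ℝ) (t : ℝ) : Chain n m →ₗ[ℝ] ℝ :=
  E ∘ₗ LinearMap.mulLeft ℝ (G.quad ψ 0 n m) ∘ₗ
    chainProd (hψ.deform t).psi (hψ.deform t).isOddMap_psi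

include hE in
/-- Integration by parts along a projected Hamiltonian vector field. -/
theorem expectation_quad_mul_ham (t : ℝ) {δ : ZMod 2} {h : Ham n m} (hh : h ∈ par _ δ)
    (h2 : h ∈ hamTwo n m) (f : SPoly (parLV n m q)) :
    E (G.quad ψ 0 n m * (hψ.deform t).ham δ h f) = -E (hψ.psiVar t h * f) := by
  have h1 := (hψ.deform t).expectation_ham (hψ.schwingerDyson_deform hE t) hh h2
    (G.quad ψ 0 n m * f)
  rw [((hψ.deform t).isSDer_ham hh).leibniz, Jp_of_mem _ (G.quad_mem hψ.even),
    hψ.ham_deform_quad t hh h2, zero_add, mul_one, smul_mul_assoc, smul_mul_assoc, ← smul_add,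
    map_smul, smul_eq_mul, map_add] at h1
  have h3 := (mul_eq_zero.1 h1).resolve_left (sgn_ne_zero δ)
  linarith

include hE in
/-- The integrand vanishes on the action of quadratic Hamiltonians, as these do not change under
the deformation. -/
theorem integrand_ospAct (t : ℝ) {l : ℕ} {g : Fin l → gTilde n m} {P : Fin l → ZMod 2}
    (hg : IsHomogFamily g P) {k : osp n m} {κ : ZMod 2} (hk : k.1 ∈ par (Ham n m) κ) :
    hψ.integrand E t (ospAct k κ g P) = 0 := by
  simp only [integrand, LinearMap.comp_apply, LinearMap.mulLeft_apply]
  rw [chainProd_psi_ospAct _ hg hk, mul_smul_comm, map_smul,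
    hψ.expectation_quad_mul_ham hE t hk (osp_le_hamTwo k.2), hψ.psiVar_osp t k.2, zero_mul,
    map_zero, neg_zero, smul_zero]

/-- The products of the deformed `Ψ` depend polynomially on `t`. -/
theorem exists_chainProd_mem_polyPath (c : Chain n m) :
    ∃ f' : ℝ → SPoly (parLV n m q),
      ((fun t => chainProd (hψ.deform t).psi (hψ.deform t).isOddMap_psi c, f') :
        (ℝ → SPoly (parLV n m q)) × (ℝ → SPoly (parLV n m q))) ∈ polyPath _ := by
  have hc : c ∈ Submodule.span ℝ {c : Chain n m | ∃ (l : ℕ) (h : Fin l → FrobeniusDGA.Mono n m),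
      c = wedge fun i => (h i).toG} := by rw [span_wedge_toG]; trivial
  induction hc using Submodule.span_induction with
  | mem c hc =>
    obtain ⟨l, h, rfl⟩ := hc
    have h1 := Submodule.smul_mem _ (sgn (crossSum (fun i => (h i).par) fun _ => 1))
      (ofFn_prod_mem_polyPath fun i => hψ.psi_mem_polyPath (h i).toG.1)
    rw [show (fun t => chainProd (hψ.deform t).psi (hψ.deform t).isOddMap_psi
        (wedge fun i => (h i).toG)) = sgn (crossSum (fun i => (h i).par) fun _ => 1) •
          fun t => (List.ofFn fun i => (hψ.deform t).psi (h i).toG.1).prod from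
      funext fun t => chainProd_wedge _ (isHomogFamily_toG h)]
    exact ⟨_, h1⟩
  | zero => exact ⟨0, by simp only [map_zero]; exact Submodule.zero_mem _⟩
  | add a b _ _ ha hb =>
    obtain ⟨f, hf⟩ := ha
    obtain ⟨g, hg⟩ := hb
    refine ⟨f + g, ?_⟩
    simp only [map_add]
    exact Submodule.add_mem _ hf hg
  | smul r a _ ha =>
    obtain ⟨f, hf⟩ := ha
    refine ⟨r • f, ?_⟩
    simp only [map_smul]
    exact Submodule.smul_mem _ r hf

theorem continuous_integrand (E : SPoly (parLV n m q) →ₗ[ℝ] ℝ) (c : Chain n m) :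
    Continuous fun t => hψ.integrand E t c := by
  obtain ⟨f', hf⟩ := hψ.exists_chainProd_mem_polyPath c
  have h := map_mem_polyPath hf (E ∘ₗ LinearMap.mulLeft ℝ (G.quad ψ 0 n m))
  exact continuous_iff_continuousAt.2 fun t => ((hasDerivAt_of_mem_polyPath h).1 t).continuousAt

include hE in
/-- The integrand at a Chevalley-Eilenberg boundary is the derivative of the mean value. -/
theorem hasDerivAt_expectation_wedge {l : ℕ} {g : Fin l → gTilde n m} {P : Fin l → ZMod 2}
    (hg : IsHomogFamily g P) (t : ℝ) :
    HasDerivAt (fun t => E (chainProd (hψ.deform t).psi (hψ.deform t).isOddMap_psi (wedge g)))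
      (-hψ.integrand E t (ceDelta g P)) t := by
  have h := map_mem_polyPath (ofFn_prod_mem_polyPath fun i => hψ.psi_mem_polyPath (g i).1)
    (sgn (crossSum P fun _ => 1) • E)
  have h1 := (hasDerivAt_of_mem_polyPath h).1 t
  simp only [chainProd_wedge _ hg, map_smul]
  refine h1.congr_deriv ?_
  simp only [integrand, LinearMap.comp_apply, LinearMap.mulLeft_apply]
  rw [LinearMap.smul_apply, chainProd_psi_ceDelta _ hg, mul_smul_comm, map_smul, Finset.mul_sum,
    map_sum, map_sum, ← smul_neg, ← Finset.sum_neg_distrib]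
  congr 1
  refine Finset.sum_congr rfl fun i _ => ?_
  rw [mul_smul_comm, map_smul,
    hψ.expectation_quad_mul_ham hE t (hg i) (gTilde_le_hamTwo (g i).2),
    ofFn_prod_update (fun j => (hψ.deform t).psi_mem (hg j)) i
      (hψ.psiVar_mem t (hg i) (gTilde_le_hamTwo (g i).2)), map_smul, smul_neg, neg_neg]

/-- Deformations of a gauge change the cocycle by a coboundary. -/
theorem isCoboundary_deform :
    IsCoboundary ((hψ.deform 1).cochain E (hψ.schwingerDyson_deform hE 1) -
      (hψ.deform 0).cochain E (hψ.schwingerDyson_deform hE 0)) := by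
  have hint : ∀ c, IntervalIntegrable (fun t => hψ.integrand E t c) MeasureTheory.volume 0 1 :=
    fun c => (hψ.continuous_integrand E c).intervalIntegrable 0 1
  let K : Chain n m →ₗ[ℝ] ℝ :=
    { toFun := fun c => -∫ t in (0 : ℝ)..1, hψ.integrand E t c
      map_add' := fun a b => by
        simp only [map_add]
        rw [intervalIntegral.integral_add (hint a) (hint b)]
        ring
      map_smul' := fun r a => by
        simp only [map_smul, smul_eq_mul, RingHom.id_apply]
        rw [intervalIntegral.integral_const_mul]
        ring }
  have hK : ospImage n m ≤ LinearMap.ker K := by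
    rw [ospImage, Submodule.span_le]
    rintro _ ⟨k, κ, l, g, P, hk, hg, rfl⟩
    change -∫ t in (0 : ℝ)..1, hψ.integrand E t (ospAct k κ g P) = 0
    simp only [hψ.integrand_ospAct hE _ hg ((mem_par_iff_isHomog _).2 hk)]
    simp
  refine ⟨(ospImage n m).liftQ K hK, fun l g P hg => ?_⟩
  change E _ - E _ = -∫ t in (0 : ℝ)..1, hψ.integrand E t (ceDelta g P)
  rw [← intervalIntegral.integral_neg]
  exact (intervalIntegral.integral_eq_sub_of_hasDerivAt
    (fun t _ => hψ.hasDerivAt_expectation_wedge hE hg t) (hint _).neg).symm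

end IsVariation
end GaugeData
end DualConstruction

namespace DualConstruction
open SuperAlg (J)

/-! ### Comparison of two gauges -/

namespace GaugeData
open FrobeniusDGA (parLV)

variable {B : Type*} [Ring B] [Algebra ℝ B] [SuperAlg B] {r : ℕ} {q : Fin r → ZMod 2}
  {G G' : GaugeData B q} {n m : ℕ}

theorem X_congr (he : G.e = G'.e) (w : Coord n m) :
    (G.X w : STensor B (SPoly (parLV n m q))) = G'.X w := by
  rw [X, X, he]

theorem psi_congr (he : G.e = G'.e) (hτ : G.τ = G'.τ) :
    (G.psi : Ham n m →ₗ[ℝ] _) = G'.psi := by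
  have h : (G.ev : Ham n m →ₐ[ℝ] _) = G'.ev :=
    spoly_algHom_ext _ fun w => by rw [ev_gen, ev_gen, X_congr he]
  rw [psi, psi, hτ, h]

theorem quad_congr (he : G.e = G'.e) (hτ : G.τ = G'.τ) (φ : B →ₗ[ℝ] B) (ε : ZMod 2) :
    G.quad φ ε n m = G'.quad φ ε n m := by
  have h : ∀ i j : Coord n m, slice G.τ (G.X i * lmap φ (G.X j)) =
      slice G'.τ (G'.X i * lmap φ (G'.X j)) := by
    intro i j
    rw [hτ, X_congr he, X_congr he]
  simp only [quad, h]

/-- The cochain depends only on the trace and the basis of the Lagrangian subspace. -/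
theorem cochain_congr (he : G.e = G'.e) (hτ : G.τ = G'.τ) {E : SPoly (parLV n m q) →ₗ[ℝ] ℝ}
    (hE : SchwingerDyson (G.quad G.d 1 n m) E) (hE' : SchwingerDyson (G'.quad G'.d 1 n m) E) :
    G.cochain E hE = G'.cochain E hE' := by
  refine Submodule.linearMap_qext _ (LinearMap.ext_on span_wedge_toG ?_)
  rintro _ ⟨l, h, rfl⟩
  change G.cochain E hE (toRel _) = G'.cochain E hE' (toRel _)
  rw [cochain_toRel, cochain_toRel, chainProd_wedge _ (isHomogFamily_toG h),
    chainProd_wedge _ (isHomogFamily_toG h), psi_congr he hτ]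

/-- The difference of the projections of two gauges with the same complement is a variation. -/
theorem isVariation_sub (hτ : G.τ = G'.τ) (hε : G.ε = G'.ε) (hd : G.d = G'.d)
    (h1 : ∀ b, G.P (G'.P b) = G.P b) (h2 : ∀ b, G'.P (G.P b) = G'.P b)
    (h3 : ∀ b, G.d (G'.P b) = G.d (G.P b)) : G.IsVariation (G'.P - G.P) where
  even b := by
    rw [LinearMap.sub_apply, map_sub, G.P_even, G'.P_even, ← smul_sub]; rfl
  skew a b := by
    have h := G.lagrangian a b
    have h' := G'.lagrangian a b
    simp only [← P_apply, ← hτ, ← hε] at h h'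
    simp only [LinearMap.sub_apply, sub_mul, mul_sub, map_sub]
    linarith
  P_apply b := by
    have h := h1 (G.P b)
    rw [h2] at h
    rw [LinearMap.sub_apply, map_sub, h1, ← h, h1, sub_self]
  apply_P b := by
    have h := h1 (G.P b)
    rw [h2, h1] at h
    rw [LinearMap.sub_apply, LinearMap.sub_apply, h2, ← h]
  ε_apply b := by
    have h : ∀ c, G.ε (G'.e c) = 0 := fun c => by rw [hε, G'.ε_e]
    simp [P_apply, G.ε_e, h]
  d_apply b := by rw [LinearMap.sub_apply, map_sub, h3, sub_self]
  apply_d b := by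
    have h := G'.P_d b
    rw [← hd] at h
    rw [LinearMap.sub_apply, h, G.P_d, sub_self]

end GaugeData

namespace FrobeniusDGA

variable {A : Type*} [NonUnitalRing A] [Module ℝ A] [IsScalarTower ℝ A A] [SMulCommClass ℝ A A]
  {𝒜 : ZMod 2 → Submodule ℝ A} [DirectSum.Decomposition 𝒜] (F : FrobeniusDGA 𝒜)
  {L L' : Submodule ℝ A} {n m r : ℕ} {q : Fin r → ZMod 2}

theorem gauge_P (hL : F.IsGauge L) (e : Module.Basis (Fin r) ℝ L) (he : ∀ a, (e a : A) ∈ 𝒜 (q a))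
    (x : F.Ext) : (F.gauge hL e he).P x =
      F.incl (∑ c, F.gaugeCoord hL e c (F.toA x) • (e c : A)) := by
  rw [GaugeData.P_apply, map_sum]
  exact Finset.sum_congr rfl fun c _ => (map_smul F.incl _ _).symm

/-- A homogeneous basis of a gauge determines bases of all other gauges, equal to it modulo the
range of `d`. -/
theorem exists_basis_sub_mem_range (hL : F.IsGauge L) (hL' : F.IsGauge L')
    (e : Module.Basis (Fin r) ℝ L) (he : ∀ a, (e a : A) ∈ 𝒜 (q a)) :
    ∃ e' : Module.Basis (Fin r) ℝ L', (∀ a, (e' a : A) ∈ 𝒜 (q a)) ∧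
      ∀ a, ∃ y, (e' a : A) = e a + F.d y := by
  let f : L ≃ₗ[ℝ] L' := (Submodule.quotientEquivOfIsCompl _ L hL.isCompl.symm).symm.trans
    (Submodule.quotientEquivOfIsCompl _ L' hL'.isCompl.symm)
  have hf : ∀ a, ∃ y, (f a : A) = a + F.d y := by
    intro a
    have h1 : (Submodule.quotientEquivOfIsCompl _ L' hL'.isCompl.symm).symm (f a) =
        (Submodule.quotientEquivOfIsCompl _ L hL.isCompl.symm).symm a := by
      simp only [f, LinearEquiv.trans_apply, LinearEquiv.symm_apply_apply]
    rw [Submodule.quotientEquivOfIsCompl_symm_apply, Submodule.quotientEquivOfIsCompl_symm_apply,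
      Submodule.Quotient.eq] at h1
    obtain ⟨y, hy⟩ := h1
    exact ⟨y, by rw [hy]; abel⟩
  refine ⟨e.map f, fun a => ?_, fun a => hf (e a)⟩
  obtain ⟨y, hy⟩ := hf (e a)
  rw [Module.Basis.map_apply]
  generalize f (e a) = x at hy
  refine mem_of_inv (sub_eq_zero.1 ?_)
  -- The difference lies both in the graded subspace `L'` and in the range of `d`.
  refine (Submodule.disjoint_def.1 hL'.isCompl.disjoint) _ (Submodule.sub_mem _ ?_
    (Submodule.smul_mem _ _ x.2)) ?_
  · rw [inv, LinearMap.sum_apply]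
    exact Submodule.sum_mem _ fun i _ => Submodule.smul_mem _ _ (hL'.isotropic.1 x x.2 i)
  · rw [hy, map_add, inv_of_mem (he a), F.inv_d]
    exact ⟨-inv 𝒜 y - sgn (q a) • y, by rw [map_sub, map_neg, map_smul]; module⟩

/-- Two gauges are both complementary to `d A`, so that the second is a graph over the first of a
map into `d A`, and a linear family of gauges joins them. -/
theorem isCoboundary_sub [FiniteDimensional ℝ A] (hL : F.IsGauge L) (hL' : F.IsGauge L')
    {S S' : RelCochain n m} (hS : F.IsDualFunctional L S) (hS' : F.IsDualFunctional L' S') :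
    IsCoboundary (S' - S) := by
  obtain ⟨r, e, q, he⟩ := F.exists_homogeneous_basis hL
  obtain ⟨e', he', h⟩ := F.exists_basis_sub_mem_range hL hL' e he
  obtain ⟨E, h1, hE, -⟩ := F.exists_gauge_expectation hL e he n m
  have hP : ∀ x : F.Ext, ∃ y, F.toA x =
      ∑ c, F.gaugeCoord hL e c (F.toA x) • (e c : A) + F.d y := fun x =>
    F.exists_gauge_decomp hL e (F.toA x)
  have hP' : ∀ x : F.Ext, ∃ y, F.toA x =
      ∑ c, F.gaugeCoord hL' e' c (F.toA x) • (e' c : A) + F.d y := fun x =>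
    F.exists_gauge_decomp hL' e' (F.toA x)
  -- The map of the graph is the difference of the projections along the range of `d`.
  have hψ : (F.gauge hL e he).IsVariation ((F.gauge hL' e' he').P - (F.gauge hL e he).P) := by
    refine GaugeData.isVariation_sub rfl rfl rfl (fun x => ?_) (fun x => ?_) fun x => ?_
    · obtain ⟨y, hy⟩ := hP' x
      rw [gauge_P, gauge_P, gauge_P]
      congr 2
      funext c
      conv_rhs => rw [hy, map_add, gaugeCoord_d, add_zero]
      rfl
    · obtain ⟨y, hy⟩ := hP x
      rw [gauge_P, gauge_P, gauge_P]
      congr 2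
      funext c
      conv_rhs => rw [hy, map_add, gaugeCoord_d, add_zero]
      rfl
    · obtain ⟨y, hy⟩ := hP x
      obtain ⟨y', hy'⟩ := hP' x
      rw [gauge_P, gauge_P]
      change F.incl (F.d _) = F.incl (F.d _)
      have h2 := congrArg F.d hy
      have h2' := congrArg F.d hy'
      rw [map_add, F.d_d, add_zero] at h2 h2'
      exact congrArg F.incl (h2'.symm.trans h2)
  -- Since `e' a` and `e a` differ by a boundary, they have equal projections along the range of `d`.
  have he1 : (hψ.deform 1).e = (F.gauge hL' e' he').e := by
    funext a
    change (F.gauge hL e he).e a + (1 : ℝ) • ((F.gauge hL' e' he').P ((F.gauge hL e he).e a) -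
      (F.gauge hL e he).P ((F.gauge hL e he).e a)) = _
    rw [GaugeData.P_e, one_smul, add_sub_cancel, ← (F.gauge hL' e' he').P_e, gauge_P, gauge_P]
    congr 2
    funext c
    obtain ⟨y, hy⟩ := h a
    change F.gaugeCoord hL' e' c (e a : A) • _ = F.gaugeCoord hL' e' c (e' a : A) • _
    rw [hy, map_add, gaugeCoord_d, add_zero]
  have he0 : (hψ.deform 0).e = (F.gauge hL e he).e := by
    funext a
    change (F.gauge hL e he).e a + (0 : ℝ) • _ = _
    rw [zero_smul, add_zero]
  have hE' : SchwingerDyson ((F.gauge hL' e' he').quad (F.gauge hL' e' he').d 1 n m) E := by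
    rw [← GaugeData.quad_congr he1 rfl]
    exact hψ.schwingerDyson_deform hE 1
  have hc := hψ.isCoboundary_deform hE
  rw [GaugeData.cochain_congr he1 rfl _ hE', GaugeData.cochain_congr he0 rfl _ hE] at hc
  rwa [hS.unique F hL (F.isDualFunctional_cochain hL e he h1 hE),
    hS'.unique F hL' (F.isDualFunctional_cochain hL' e' he' h1 hE')]

end FrobeniusDGA
end DualConstruction

end

theorem mainTheorem1 {A : Type*} [NonUnitalRing A] [Module ℝ A] [IsScalarTower ℝ A A]
    [SMulCommClass ℝ A A] [FiniteDimensional ℝ A] (𝒜 : ZMod 2 → Submodule ℝ A)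
    [DirectSum.Decomposition 𝒜] (F : DualConstruction.FrobeniusDGA 𝒜) (n m : ℕ) :
    (∀ L : Submodule ℝ A, F.IsGauge L →
      (∃! S : DualConstruction.RelCochain n m, F.IsDualFunctional L S) ∧
      ∀ S : DualConstruction.RelCochain n m, F.IsDualFunctional L S →
        DualConstruction.IsCocycle S) ∧
    (∀ L₀ L₁ : Submodule ℝ A, F.IsGauge L₀ → F.IsGauge L₁ →
      ∀ S₀ S₁ : DualConstruction.RelCochain n m,
        F.IsDualFunctional L₀ S₀ → F.IsDualFunctional L₁ S₁ →
          DualConstruction.IsCoboundary (S₁ - S₀)) := by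
  exact ⟨fun L hL => ⟨F.existsUnique_isDualFunctional hL, fun S hS => hS.isCocycle F hL⟩,
    fun L₀ L₁ h₀ h₁ S₀ S₁ hS₀ hS₁ => F.isCoboundary_sub h₀ h₁ hS₀ hS₁⟩
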